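/- Let $(M,g)$ be a compact Riemannian manifold (Hausdorff, without boundary), let $L$ be a smooth Hermitian line bundle over $M$, and let $\nabla$ be a smooth Hermitian connection on $L$. For a positive integer $k$, $\nabla$ induces a connection on $L^{\otimes k}$ by the Leibniz rule, and hence the bundle Laplacian $\Delta=-\operatorname{trace}(\nabla^2)$ on $C^\infty(M,L^{\otimes k})$, where $\nabla^2 s$ is formed with the Levi-Civita connection on $T^*M$ and the induced connection on $L^{\otimes k}$. Denote by $\mathrm{Spec}(L,\nabla,k)$ the spectrum of $\Delta$ on $C^\infty(M,L^{\otimes k})$, i.e. its eigenvalues together with the dimensions of the eigenspaces of smooth sections, and, for a real-valued $Q\in C^\infty(M)$, by $\mathrm{Spec}(Q;L,\nabla,k)$ the spectrum of $\Delta+Q$ in the same sense. Let $G$ be a finite group acting smoothly on $L$, carrying fibers complex-linearly to fibers and preserving $\nabla$, such that the induced action on $M$ is by isometries. For $i=1,2$ let $\Gamma_i$ be a subgroup of $G$ whose action on $M$ is free and which preserves the Hermitian structure of $L$ (the latter is automatic if $M$ is connected). Then $L_i:=\Gamma_i\backslash L$ is a Hermitian line bundle over the compact Riemannian manifold $M_i:=\Gamma_i\backslash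 M$, and $\nabla$ induces a Hermitian connection $\nabla_i$ on $L_i$; that is, there is a Hermitian line bundle $L_i\to M_i$ with Hermitian connection $\nabla_i$ over a compact Riemannian manifold, with a smooth bundle map $L\to L_i$ over a surjective local isometry $M\to M_i$ which is unitary on fibers, pulls $\nabla_i$ back to $\nabla$, and whose fibers (on total spaces and on bases) are the $\Gamma_i$-orbits. Suppose that $\Gamma_1$ and $\Gamma_2$ are almost conjugate in $G$, i.e. there is a bijection $\Gamma_1\to\Gamma_2$ carrying each element to an element conjugate to it in $G$. Then: (i) $\mathrm{Spec}(L_1,\nabla_1,k)=\mathrm{Spec}(L_2,\nabla_2,k)$ for all positive integers $k$. (ii) If $Q\in C^\infty(M)$ is real-valued and $G$-invariant, and $Q_i$ denotes the function on $M_i$ induced by $Q$, then $\mathrm{Spec}(Q_1;L_1,\nabla_1,k)=\mathrm{Spec}(Q_2;L_2,\nabla_2,k)$ for all positive integers $k$. -/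

import Mathlib

open Bundle Manifold Module
open scoped Manifold ContDiff Bundle Topology TensorProduct

universe u v w z

noncomputable section

namespace SunadaLine

/-! ## The Levi-Civita connection (Koszul formula) -/

section LeviCivita

variable {E : Type*} [NormedAddCommGroup E] [NormedSpace ℝ E]
  {M : Type*} [TopologicalSpace M] [ChartedSpace E M] [IsManifold 𝓘(ℝ, E) ∞ M]
  [RiemannianBundle (fun x : M => TangentSpace 𝓘(ℝ, E) x)]

/-- The right-hand side of the Koszul formula,
`X⟨Y,Z⟩ + Y⟨X,Z⟩ - Z⟨X,Y⟩ + ⟨[X,Y],Z⟩ - ⟨[X,Z],Y⟩ - ⟨[Y,Z],X⟩`, at the point `x`. -/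
def koszul (X Y Z : Π x : M, TangentSpace 𝓘(ℝ, E) x) (x : M) : ℝ :=
  mvfderiv 𝓘(ℝ, E) (fun y => inner ℝ (Y y) (Z y)) x (X x)
    + mvfderiv 𝓘(ℝ, E) (fun y => inner ℝ (X y) (Z y)) x (Y x)
    - mvfderiv 𝓘(ℝ, E) (fun y => inner ℝ (X y) (Y y)) x (Z x)
    + inner ℝ (VectorField.mlieBracket 𝓘(ℝ, E) X Y x) (Z x)
    - inner ℝ (VectorField.mlieBracket 𝓘(ℝ, E) X Z x) (Y x)
    - inner ℝ (VectorField.mlieBracket 𝓘(ℝ, E) Y Z x) (X x)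

/-- `w` is the value at `x` of the Levi-Civita derivative `D_X Y`: it satisfies the Koszul formula
`2⟨w, Z⟩ = koszul X Y Z` at `x` for every vector field `Z` that is differentiable at `x`. -/
def IsLeviCivitaAt (X Y : Π x : M, TangentSpace 𝓘(ℝ, E) x) (x : M)
    (w : TangentSpace 𝓘(ℝ, E) x) : Prop :=
  ∀ Z : Π x : M, TangentSpace 𝓘(ℝ, E) x,
    MDifferentiableAt 𝓘(ℝ, E) (𝓘(ℝ, E).prod 𝓘(ℝ, E)) (fun y => TotalSpace.mk' E y (Z y)) x →
    2 * inner ℝ w (Z x) = koszul X Y Z x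

open Classical in
/-- The Levi-Civita covariant derivative `D_X Y` of vector fields that are differentiable
at the point in question (junk value `0` where `X` or `Y` is not regular enough). -/
def leviCivita (X Y : Π x : M, TangentSpace 𝓘(ℝ, E) x) (x : M) : TangentSpace 𝓘(ℝ, E) x :=
  if h : ∃ w, IsLeviCivitaAt X Y x w then h.choose else 0

end LeviCivita

/-! ## Tensor powers of a line bundle, and the induced connection and Laplacian -/

section TensorPowers

variable {E : Type*} [NormedAddCommGroup E] [NormedSpace ℝ E]
  {M : Type*} [TopologicalSpace M] [ChartedSpace E M]
  (L : M → Type*) [∀ x, NormedAddCommGroup (L x)] [∀ x, InnerProductSpace ℂ (L x)]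
  [TopologicalSpace (TotalSpace ℂ L)] [FiberBundle ℂ L] [VectorBundle ℂ ℂ L]

/-- A (not necessarily smooth) section of the `k`-th tensor power `L^{⊗k}`, whose fiber at `x` is
the tensor power over `ℂ` of the line `L x`. -/
abbrev TensorSection (k : ℕ) : Type _ := Π x : M, ⨂[ℂ]^k (L x)

/-- The local trivialization of `L^{⊗k}` near `x` induced by the local trivialization
`φ : L|_U → U × ℂ` of `L` near `x`: on the fiber at `y` it is
`v₁ ⊗ ⋯ ⊗ v_k ↦ φ_y(v₁) ⋯ φ_y(v_k)`. -/
def tensorCoord (k : ℕ) (x y : M) : ⨂[ℂ]^k (L y) →ₗ[ℂ] ℂ :=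
  PiTensorProduct.lift ((MultilinearMap.mkPiAlgebra ℂ (Fin k) ℂ).compLinearMap
    (fun _ => (trivializationAt ℂ L x).linearMapAt ℂ y))

/-- The local frame of `L` near `x` given by the local trivialization of `L` near `x`. -/
def frame (x y : M) : L y := (trivializationAt ℂ L x).symm y 1

variable {L}

/-- Smoothness of a section of `L^{⊗k}`: it is smooth when read in the local trivializations
of `L^{⊗k}` induced by those of `L`. -/
def IsSmoothTensorSection {k : ℕ} (σ : TensorSection L k) : Prop :=
  ∀ x : M, ContMDiffAt 𝓘(ℝ, E) 𝓘(ℝ, ℂ) ∞ (fun y => tensorCoord L k x y (σ y)) x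

/-- The connection on `L^{⊗k}` induced by a connection `cov` on `L`, by the Leibniz rule: near `x`
write `σ = c • e ⊗ ⋯ ⊗ e` with `e` a local frame of `L` and `c` a function; then
`∇_u σ = dc(u) • e ⊗ ⋯ ⊗ e + c • ∑ j, e ⊗ ⋯ ⊗ ∇_u e ⊗ ⋯ ⊗ e` (`∇_u e` in the `j`-th place). -/
def tensorConnection (cov : CovariantDerivative 𝓘(ℝ, E) ℂ L) {k : ℕ} (σ : TensorSection L k)
    (x : M) (u : TangentSpace 𝓘(ℝ, E) x) : ⨂[ℂ]^k (L x) :=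
  mvfderiv 𝓘(ℝ, E) (fun y => tensorCoord L k x y (σ y)) x u •
      PiTensorProduct.tprod ℂ (fun _ : Fin k => frame L x x)
    + tensorCoord L k x x (σ x) • ∑ j : Fin k, PiTensorProduct.tprod ℂ
        (Function.update (fun _ : Fin k => frame L x x) j (cov (frame L x) x u))

variable [IsManifold 𝓘(ℝ, E) ∞ M] [RiemannianBundle (fun x : M => TangentSpace 𝓘(ℝ, E) x)]

/-- The second covariant derivative `∇²σ` (the connection on `T*M ⊗ L^{⊗k}` coming from the
Levi-Civita connection and the connection on `L^{⊗k}`, applied to `∇σ`):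
`(∇²σ)(u, v) = (∇_u (∇σ))(V) = ∇_u (∇_V σ) - ∇_{D_u V} σ`
for vector fields `U`, `V` extending `u`, `v`. -/
def secondCovariantDerivative (cov : CovariantDerivative 𝓘(ℝ, E) ℂ L) {k : ℕ}
    (σ : TensorSection L k) (x : M) (u v : TangentSpace 𝓘(ℝ, E) x) : ⨂[ℂ]^k (L x) :=
  tensorConnection cov (fun y => tensorConnection cov σ y (FiberBundle.extend E v y)) x u
    - tensorConnection cov σ x (leviCivita (FiberBundle.extend E u) (FiberBundle.extend E v) x)

instance instFiniteDimensionalTangentSpace [FiniteDimensional ℝ E] (x : M) :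
    FiniteDimensional ℝ (TangentSpace 𝓘(ℝ, E) x) :=
  inferInstanceAs (FiniteDimensional ℝ E)

/-- The bundle Laplacian `Δ = -trace ∇²` on sections of `L^{⊗k}`, the trace being taken in an
orthonormal basis of the tangent space for the Riemannian metric. -/
def bundleLaplacian [FiniteDimensional ℝ E] (cov : CovariantDerivative 𝓘(ℝ, E) ℂ L) {k : ℕ}
    (σ : TensorSection L k) : TensorSection L k := fun x =>
  - ∑ i, secondCovariantDerivative cov σ x
      (stdOrthonormalBasis ℝ (TangentSpace 𝓘(ℝ, E) x) i)
      (stdOrthonormalBasis ℝ (TangentSpace 𝓘(ℝ, E) x) i)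

/-- The Schrödinger operator `Δ + Q` on sections of `L^{⊗k}`. -/
def schrodinger [FiniteDimensional ℝ E] (cov : CovariantDerivative 𝓘(ℝ, E) ℂ L) (Q : M → ℝ)
    {k : ℕ} (σ : TensorSection L k) : TensorSection L k := fun x =>
  bundleLaplacian cov σ x + (Q x : ℂ) • σ x

variable (E) in
/-- The spectrum, with multiplicities, of an operator `T` on the smooth sections of `L^{⊗k}`: the
function that assigns to `μ` the dimension of the eigenspace `{σ smooth | T σ = μ σ}`.
(For a linear operator this set is a linear subspace and taking the span changes nothing.) -/
def spectrumMult {k : ℕ} (T : TensorSection L k → TensorSection L k) (μ : ℂ) : Cardinal :=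
  Module.rank ℂ (Submodule.span ℂ
    {σ : TensorSection L k | IsSmoothTensorSection (E := E) σ ∧ T σ = μ • σ})

end TensorPowers

/-! ## Hermitian line bundles with Hermitian connection over compact Riemannian manifolds -/

/-- A compact Riemannian manifold (Hausdorff, without boundary, modelled on `E`) together with a
smooth Hermitian line bundle over it and a smooth Hermitian connection on the bundle. -/
structure LineBundleWithConnection (E : Type w) [NormedAddCommGroup E] [NormedSpace ℝ E] where
  /-- the base manifold -/
  M : Type u
  [topM : TopologicalSpace M]
  [t2M : T2Space M]
  [compactM : CompactSpace M]
  [chartedM : ChartedSpace E M]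
  [manifoldM : IsManifold 𝓘(ℝ, E) ∞ M]
  /-- the Riemannian metric -/
  [riemM : RiemannianBundle (fun x : M => TangentSpace 𝓘(ℝ, E) x)]
  [smoothRiemM : IsContMDiffRiemannianBundle 𝓘(ℝ, E) ∞ E (fun x : M => TangentSpace 𝓘(ℝ, E) x)]
  /-- the fibers of the line bundle -/
  L : M → Type v
  [normedL : ∀ x, NormedAddCommGroup (L x)]
  /-- the Hermitian inner products on the fibers -/
  [innerL : ∀ x, InnerProductSpace ℂ (L x)]
  [topL : TopologicalSpace (TotalSpace ℂ L)]
  [fiberL : FiberBundle ℂ L]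
  [complexL : VectorBundle ℂ ℂ L]
  [realL : VectorBundle ℝ ℂ L]
  [smoothL : ContMDiffVectorBundle ∞ ℂ L 𝓘(ℝ, E)]
  /-- the Hermitian inner product of two smooth local sections is a smooth function -/
  hermitian_smooth : ∀ (s t : Π x, L x) (x : M),
    ContMDiffAt 𝓘(ℝ, E) (𝓘(ℝ, E).prod 𝓘(ℝ, ℂ)) ∞ (fun y => TotalSpace.mk' ℂ y (s y)) x →
    ContMDiffAt 𝓘(ℝ, E) (𝓘(ℝ, E).prod 𝓘(ℝ, ℂ)) ∞ (fun y => TotalSpace.mk' ℂ y (t y)) x →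
    ContMDiffAt 𝓘(ℝ, E) 𝓘(ℝ, ℂ) ∞ (fun y => inner ℂ (s y) (t y)) x
  /-- the connection -/
  conn : CovariantDerivative 𝓘(ℝ, E) ℂ L
  conn_smooth : CovariantDerivative.ContMDiffCovariantDerivative conn ∞
  conn_complex : ∀ (s : Π x, L x) (c : ℂ) (x : M) (u : TangentSpace 𝓘(ℝ, E) x),
    MDifferentiableAt 𝓘(ℝ, E) (𝓘(ℝ, E).prod 𝓘(ℝ, ℂ)) (fun y => TotalSpace.mk' ℂ y (s y)) x →
    conn (c • s) x u = c • conn s x u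
  conn_hermitian : ∀ (s t : Π x, L x) (x : M) (u : TangentSpace 𝓘(ℝ, E) x),
    MDifferentiableAt 𝓘(ℝ, E) (𝓘(ℝ, E).prod 𝓘(ℝ, ℂ)) (fun y => TotalSpace.mk' ℂ y (s y)) x →
    MDifferentiableAt 𝓘(ℝ, E) (𝓘(ℝ, E).prod 𝓘(ℝ, ℂ)) (fun y => TotalSpace.mk' ℂ y (t y)) x →
    mvfderiv 𝓘(ℝ, E) (fun y => inner ℂ (s y) (t y)) x u
      = inner ℂ (conn s x u) (t x) + inner ℂ (s x) (conn t x u)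

attribute [instance] LineBundleWithConnection.topM LineBundleWithConnection.t2M
  LineBundleWithConnection.compactM LineBundleWithConnection.chartedM
  LineBundleWithConnection.manifoldM LineBundleWithConnection.riemM
  LineBundleWithConnection.smoothRiemM LineBundleWithConnection.normedL
  LineBundleWithConnection.innerL LineBundleWithConnection.topL
  LineBundleWithConnection.fiberL LineBundleWithConnection.complexL
  LineBundleWithConnection.realL LineBundleWithConnection.smoothL

section Spectra

variable {E : Type*} [NormedAddCommGroup E] [NormedSpace ℝ E] [FiniteDimensional ℝ E]

/-- `Spec(L, ∇, k)`: the spectrum with multiplicities of the bundle Laplacian on the smooth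
sections of `L^{⊗k}`. -/
def LineBundleWithConnection.spec (X : LineBundleWithConnection E) (k : ℕ) : ℂ → Cardinal :=
  spectrumMult E (L := X.L) (k := k) (bundleLaplacian X.conn)

/-- `Spec(Q; L, ∇, k)`: the spectrum with multiplicities of the Schrödinger operator `Δ + Q` on
the smooth sections of `L^{⊗k}`. -/
def LineBundleWithConnection.specPotential (X : LineBundleWithConnection E) (Q : X.M → ℝ)
    (k : ℕ) : ℂ → Cardinal :=
  spectrumMult E (L := X.L) (k := k) (schrodinger X.conn Q)

end Spectra

/-! ## Group actions and quotients -/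

section Quotients

variable {E : Type*} [NormedAddCommGroup E] [NormedSpace ℝ E]

/-- A smooth action of a group `G` on (the total space of) the line bundle `L` over `M` that
carries fibers linearly to fibers, preserves the connection, and induces an action by isometries
on the base `M`. -/
structure BundleAction (G : Type*) [Group G] (X : LineBundleWithConnection E) where
  /-- the induced action on the base -/
  [actM : MulAction G X.M]
  /-- the action on the total space of the bundle -/
  [actL : MulAction G (TotalSpace ℂ X.L)]
  /-- the action of `g` as a linear map from the fiber at `x` to the fiber at `g • x` -/
  onFiber (g : G) (x : X.M) : X.L x →ₗ[ℂ] X.L (g • x)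
  smul_eq : ∀ (g : G) (x : X.M) (v : X.L x),
    g • (⟨x, v⟩ : TotalSpace ℂ X.L) = ⟨g • x, onFiber g x v⟩
  smooth_base : ∀ g : G, ContMDiff 𝓘(ℝ, E) 𝓘(ℝ, E) ∞ (fun x : X.M => g • x)
  smooth_total : ∀ g : G, ContMDiff (𝓘(ℝ, E).prod 𝓘(ℝ, ℂ)) (𝓘(ℝ, E).prod 𝓘(ℝ, ℂ)) ∞
    (fun p : TotalSpace ℂ X.L => g • p)
  isometry : ∀ (g : G) (x : X.M) (u v : TangentSpace 𝓘(ℝ, E) x),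
    inner ℝ (mfderiv 𝓘(ℝ, E) 𝓘(ℝ, E) (fun y : X.M => g • y) x u)
      (mfderiv 𝓘(ℝ, E) 𝓘(ℝ, E) (fun y : X.M => g • y) x v) = inner ℝ u v
  /-- if `t = g · s` is the translate of the section `s`, then `∇_{dg(u)} t = g · ∇_u s` -/
  preserves_conn : ∀ (g : G) (s t : Π x, X.L x), (∀ x, t (g • x) = onFiber g x (s x)) →
    ∀ (x : X.M) (u : TangentSpace 𝓘(ℝ, E) x),
    MDifferentiableAt 𝓘(ℝ, E) (𝓘(ℝ, E).prod 𝓘(ℝ, ℂ)) (fun y => TotalSpace.mk' ℂ y (s y)) x →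
    X.conn t (g • x) (mfderiv 𝓘(ℝ, E) 𝓘(ℝ, E) (fun y : X.M => g • y) x u)
      = onFiber g x (X.conn s x u)

variable {G : Type*} [Group G] {X : LineBundleWithConnection E}

/-- The point `g • x` of the base manifold. -/
def BundleAction.act (A : BundleAction G X) (g : G) (x : X.M) : X.M :=
  letI := A.actM; g • x

/-- The point `g • p` of the total space of the line bundle. -/
def BundleAction.actTotal (A : BundleAction G X) (g : G) (p : TotalSpace ℂ X.L) :
    TotalSpace ℂ X.L :=
  letI := A.actL; g • p

/-- The subgroup `Γ` acts freely on the base manifold. -/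
def BundleAction.ActsFreely (A : BundleAction G X) (Γ : Subgroup G) : Prop :=
  ∀ γ ∈ Γ, ∀ x : X.M, A.act γ x = x → γ = 1

/-- The subgroup `Γ` preserves the Hermitian structure of the line bundle. -/
def BundleAction.PreservesHermitian (A : BundleAction G X) (Γ : Subgroup G) : Prop :=
  ∀ γ ∈ Γ, ∀ (x : X.M) (v : X.L x), ‖A.onFiber γ x v‖ = ‖v‖

/-- `Y` (a Hermitian line bundle `L'` with connection `∇'` over a compact Riemannian manifold `M'`)
is the quotient of `X` by `Γ`: there is a bundle map from `L → M` to `L' → M'`, over a local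
isometry `M → M'`, unitary on fibers, whose fibers (on the base and on total spaces) are exactly
the `Γ`-orbits, and which pulls `∇'` back to `∇`. -/
structure QuotientMap (A : BundleAction G X) (Γ : Subgroup G)
    (Y : LineBundleWithConnection E) where
  /-- the projection `M → M' = Γ\M` -/
  proj : X.M → Y.M
  /-- the projection `L → L' = Γ\L`, fiber by fiber -/
  onFiber (x : X.M) : X.L x ≃ₗᵢ[ℂ] Y.L (proj x)
  proj_surjective : Function.Surjective proj
  proj_eq_iff : ∀ x y : X.M, proj x = proj y ↔ ∃ γ ∈ Γ, A.act γ x = y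
  total_eq_iff : ∀ p q : TotalSpace ℂ X.L,
    (⟨proj p.1, onFiber p.1 p.2⟩ : TotalSpace ℂ Y.L) = ⟨proj q.1, onFiber q.1 q.2⟩ ↔
      ∃ γ ∈ Γ, A.actTotal γ p = q
  proj_localDiffeo : IsLocalDiffeomorph 𝓘(ℝ, E) 𝓘(ℝ, E) ∞ proj
  total_smooth : ContMDiff (𝓘(ℝ, E).prod 𝓘(ℝ, ℂ)) (𝓘(ℝ, E).prod 𝓘(ℝ, ℂ)) ∞
    (fun p : TotalSpace ℂ X.L => (⟨proj p.1, onFiber p.1 p.2⟩ : TotalSpace ℂ Y.L))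
  isometry : ∀ (x : X.M) (u v : TangentSpace 𝓘(ℝ, E) x),
    inner ℝ (mfderiv 𝓘(ℝ, E) 𝓘(ℝ, E) proj x u) (mfderiv 𝓘(ℝ, E) 𝓘(ℝ, E) proj x v)
      = inner ℝ u v
  /-- if `s` is the pull-back of the section `t`, then `∇_u s` is the pull-back of
  `∇'_{d proj(u)} t` -/
  conn_eq : ∀ (s : Π x, X.L x) (t : Π y, Y.L y), (∀ x, t (proj x) = onFiber x (s x)) →
    ∀ (x : X.M) (u : TangentSpace 𝓘(ℝ, E) x),
    MDifferentiableAt 𝓘(ℝ, E) (𝓘(ℝ, E).prod 𝓘(ℝ, ℂ)) (fun y => TotalSpace.mk' ℂ y (s y)) x →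
    Y.conn t (proj x) (mfderiv 𝓘(ℝ, E) 𝓘(ℝ, E) proj x u) = onFiber x (X.conn s x u)

/-- The function on the quotient induced by a `Γ`-invariant function `Q` on `M`. -/
def QuotientMap.induced {A : BundleAction G X} {Γ : Subgroup G} {Y : LineBundleWithConnection E}
    (q : QuotientMap A Γ Y) (Q : X.M → ℝ) : Y.M → ℝ :=
  fun y => Q (Function.surjInv q.proj_surjective y)

end Quotients

/-- `Γ₁` and `Γ₂` are almost conjugate in `G`: there is a bijection `Γ₁ → Γ₂` carrying each element
to a conjugate (in `G`) element. -/
def AlmostConjugate {G : Type*} [Group G] (Γ₁ Γ₂ : Subgroup G) : Prop :=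
  ∃ φ : Γ₁ ≃ Γ₂, ∀ γ : Γ₁, IsConj (γ : G) (φ γ : G)

end SunadaLine

end

noncomputable section

namespace SunadaLine

set_option linter.unusedSectionVars false

/-! ### Derivatives of complex-valued functions on a real manifold -/

section ComplexDerivatives

variable {E : Type*} [NormedAddCommGroup E] [NormedSpace ℝ E]
  {M : Type*} [TopologicalSpace M] [ChartedSpace E M]

/-! The theorem reduces to the representation theory of a finite group. An element g of G acts on
sections of L^{⊗k} by pull-back under g⁻¹. Since g preserves ∇ and acts isometrically on M, this
commutes with Δ, and with Δ + Q if Q is invariant; hence G acts on each eigenspace V of Δ + Q on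
smooth sections. Pull-back along L → L_i identifies the corresponding eigenspace on M_i with the
Γ_i-invariants of V (`QuotientMap.eigenspaceEquiv`). The dimension of the invariants is the mean of
the character over Γ_i, and characters are class functions, so almost conjugate subgroups give equal
dimensions (`AlmostConjugate.rank_invariants_eq`). Part (i) is the case Q = 0.

Finite-dimensionality of V, which would need elliptic theory, is avoided: by Maschke's theorem V is
a direct sum of simple, hence finite-dimensional, modules, and the dimensions of the invariants add
up as cardinals.

The geometric core is naturality of Δ under a `ConnectionMap`, a notion that covers both the action
of g and the projection to the quotient (`ConnectionMap.bundleLaplacian_pullback`). Its fibre maps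
are only linear isomorphisms, because Δ does not see the Hermitian metric of L. The definition of Δ
involves choices that such maps do not respect: trivializations, extensions of vectors, orthonormal
bases. Each choice is shown to be irrelevant (`tensorConnection_eq`,
`secondCovariantDerivative_eq_hessian`, `bundleLaplacian_eq_sum`); naturality of the Levi-Civita
derivative comes from the Koszul formula.

The quotient is built on chosen representatives of orbits. These choices need not be continuous, but
two continuous lifts of the same map to Γ\M differ near a point by one fixed element of Γ
(`OrbitSpace.eventually_act_eq`), so smoothness, metric and connection descend from the properties
of single group elements. -/

lemma mdifferentiableAt_ofReal {f : M → ℝ} {x : M} (hf : MDifferentiableAt 𝓘(ℝ, E) 𝓘(ℝ, ℝ) f x) :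
    MDifferentiableAt 𝓘(ℝ, E) 𝓘(ℝ, ℂ) (fun y => (f y : ℂ)) x :=
  (Complex.ofRealCLM.differentiableAt.mdifferentiableAt).comp x hf

lemma mvfderiv_clm_comp {F F' : Type*} [NormedAddCommGroup F] [NormedSpace ℝ F]
    [NormedAddCommGroup F'] [NormedSpace ℝ F'] (A : F →L[ℝ] F') {f : M → F} {x : M}
    (hf : MDifferentiableAt 𝓘(ℝ, E) 𝓘(ℝ, F) f x) (u : TangentSpace 𝓘(ℝ, E) x) :
    mvfderiv 𝓘(ℝ, E) (fun y => A (f y)) x u = A (mvfderiv 𝓘(ℝ, E) f x u) := by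
  have h := mfderiv_comp x (I' := 𝓘(ℝ, F)) (g := fun z => A z)
    (A.differentiableAt.mdifferentiableAt) hf
  have h2 : mfderiv 𝓘(ℝ, F) 𝓘(ℝ, F') (fun z => A z) (f x) = A := by
    rw [mfderiv_eq_fderiv]; exact A.fderiv
  have h3 := congrArg (fun B => B u) h
  rw [h2] at h3
  exact h3

lemma mvfderiv_mul_complex {f g : M → ℂ} {x : M} (hf : MDifferentiableAt 𝓘(ℝ, E) 𝓘(ℝ, ℂ) f x)
    (hg : MDifferentiableAt 𝓘(ℝ, E) 𝓘(ℝ, ℂ) g x) (u : TangentSpace 𝓘(ℝ, E) x) :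
    mvfderiv 𝓘(ℝ, E) (fun y => f y * g y) x u
      = f x * mvfderiv 𝓘(ℝ, E) g x u + mvfderiv 𝓘(ℝ, E) f x u * g x := by
  have h := (hf.hasMFDerivAt.mul' hg.hasMFDerivAt).mfderiv
  have h3 := congrArg (fun B => B u) h
  exact h3

lemma mdifferentiableAt_mul_complex {f g : M → ℂ} {x : M}
    (hf : MDifferentiableAt 𝓘(ℝ, E) 𝓘(ℝ, ℂ) f x)
    (hg : MDifferentiableAt 𝓘(ℝ, E) 𝓘(ℝ, ℂ) g x) :
    MDifferentiableAt 𝓘(ℝ, E) 𝓘(ℝ, ℂ) (fun y => f y * g y) x :=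
  (hf.hasMFDerivAt.mul' hg.hasMFDerivAt).mdifferentiableAt

lemma mvfderiv_pow_complex {f : M → ℂ} {x : M} (hf : MDifferentiableAt 𝓘(ℝ, E) 𝓘(ℝ, ℂ) f x)
    (k : ℕ) (u : TangentSpace 𝓘(ℝ, E) x) :
    MDifferentiableAt 𝓘(ℝ, E) 𝓘(ℝ, ℂ) (fun y => f y ^ k) x ∧
    mvfderiv 𝓘(ℝ, E) (fun y => f y ^ k) x u
      = k * f x ^ (k - 1) * mvfderiv 𝓘(ℝ, E) f x u := by
  induction k with
  | zero => simp [mdifferentiableAt_const, mvfderiv_const]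
  | succ k ih =>
    simp only [pow_succ]
    refine ⟨mdifferentiableAt_mul_complex ih.1 hf, ?_⟩
    rw [mvfderiv_mul_complex ih.1 hf, ih.2]
    -- The exponent `k - 1` is a truncated subtraction, so k = 0 is separated off.
    rcases k with _ | k
    · simp
    · simp only [Nat.add_sub_cancel, Nat.cast_add, Nat.cast_one]
      ring

lemma mvfderiv_congr {F : Type*} [NormedAddCommGroup F] [NormedSpace ℝ F] {f g : M → F} {x : M}
    (h : f =ᶠ[𝓝 x] g) (u : TangentSpace 𝓘(ℝ, E) x) :
    mvfderiv 𝓘(ℝ, E) f x u = mvfderiv 𝓘(ℝ, E) g x u := by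
  have h2 := congrArg (fun B => B u) (h.mfderiv_eq (I := 𝓘(ℝ, E)) (I' := 𝓘(ℝ, F)))
  exact h2

end ComplexDerivatives

/-! ### Coordinates and frames of a complex line bundle -/

section Line

variable {E : Type*} [NormedAddCommGroup E] [NormedSpace ℝ E]
  {M : Type*} [TopologicalSpace M] [ChartedSpace E M]
  (L : M → Type*) [∀ x, NormedAddCommGroup (L x)] [∀ x, InnerProductSpace ℂ (L x)]
  [TopologicalSpace (TotalSpace ℂ L)] [FiberBundle ℂ L] [VectorBundle ℂ ℂ L]

/-- The fibre coordinate at `y` in the trivialization of the line bundle around `x`. -/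
def coord (x y : M) : L y →ₗ[ℂ] ℂ := (trivializationAt ℂ L x).linearMapAt ℂ y

variable {L}

lemma coord_eq {x y : M} (hy : y ∈ (trivializationAt ℂ L x).baseSet) (v : L y) :
    coord L x y v = (trivializationAt ℂ L x ⟨y, v⟩).2 :=
  congrFun ((trivializationAt ℂ L x).coe_linearMapAt_of_mem (R := ℂ) hy) v

lemma baseSet_mem_nhds (x : M) : (trivializationAt ℂ L x).baseSet ∈ 𝓝 x :=
  (trivializationAt ℂ L x).open_baseSet.mem_nhds (FiberBundle.mem_baseSet_trivializationAt' x)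

lemma frame_eq_symmₗ {x y : M} (hy : y ∈ (trivializationAt ℂ L x).baseSet) :
    frame L x y = (trivializationAt ℂ L x).symmₗ ℂ y 1 :=
  ((trivializationAt ℂ L x).symmₗ_apply (R := ℂ) hy 1).symm

lemma coord_smul_frame {x y : M} (hy : y ∈ (trivializationAt ℂ L x).baseSet) (v : L y) :
    coord L x y v • frame L x y = v := by
  have h := (trivializationAt ℂ L x).symmₗ_linearMapAt (R := ℂ) hy v
  have h2 := ((trivializationAt ℂ L x).symmₗ ℂ y).map_smul (coord L x y v) 1
  rw [smul_eq_mul, mul_one] at h2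
  rw [frame_eq_symmₗ hy]
  exact h2.symm.trans h

lemma coord_frame {x y : M} (hy : y ∈ (trivializationAt ℂ L x).baseSet) :
    coord L x y (frame L x y) = 1 := by
  rw [frame_eq_symmₗ hy]
  exact (trivializationAt ℂ L x).linearMapAt_symmₗ (R := ℂ) hy 1

lemma coord_eq_zero_iff {x y : M} (hy : y ∈ (trivializationAt ℂ L x).baseSet) (v : L y) :
    coord L x y v = 0 ↔ v = 0 := by
  constructor
  · intro h
    rw [← coord_smul_frame hy v, h, zero_smul]
  · rintro rfl
    exact map_zero _

/-- One-dimensionality of the fibres. It supplies the connection coefficient a with ∇_u e = a e for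
a nonvanishing section e. -/
lemma exists_smul_eq {y : M} {e : L y} (he : e ≠ 0) (v : L y) : ∃ a : ℂ, v = a • e := by
  have hy : y ∈ (trivializationAt ℂ L y).baseSet := FiberBundle.mem_baseSet_trivializationAt' y
  refine ⟨coord L y y v / coord L y y e, ?_⟩
  have h0 : coord L y y e ≠ 0 := fun h => he ((coord_eq_zero_iff hy e).1 h)
  rw [← coord_smul_frame hy v, ← coord_smul_frame hy e]
  simp only [map_smul, coord_frame hy, smul_eq_mul, mul_one]
  rw [smul_smul, div_mul_cancel₀ _ h0]

variable [VectorBundle ℝ ℂ L] [IsManifold 𝓘(ℝ, E) ∞ M] [ContMDiffVectorBundle ∞ ℂ L 𝓘(ℝ, E)]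

lemma mdifferentiableAt_iff_coord (s : Π y, L y) (x : M) :
    MDifferentiableAt 𝓘(ℝ, E) (𝓘(ℝ, E).prod 𝓘(ℝ, ℂ)) (fun y => TotalSpace.mk' ℂ y (s y)) x ↔
      MDifferentiableAt 𝓘(ℝ, E) 𝓘(ℝ, ℂ) (fun y => coord L x y (s y)) x := by
  rw [mdifferentiableAt_section]
  refine Filter.EventuallyEq.mdifferentiableAt_iff ?_
  filter_upwards [baseSet_mem_nhds (L := L) x] with y hy
  exact (coord_eq hy _).symm

/-- Unlike in `mdifferentiableAt_iff_coord`, the trivialization may be centred at a point other than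
x. This is what makes a local frame smooth on its whole base set. -/
lemma contMDiffAt_iff_coord {n : ℕ∞ω} (s : Π y, L y) (x₀ x : M)
    (hx : x ∈ (trivializationAt ℂ L x₀).baseSet) (hn : n ≤ ∞) :
    ContMDiffAt 𝓘(ℝ, E) (𝓘(ℝ, E).prod 𝓘(ℝ, ℂ)) n (fun y => TotalSpace.mk' ℂ y (s y)) x ↔
      ContMDiffAt 𝓘(ℝ, E) 𝓘(ℝ, ℂ) n (fun y => coord L x₀ y (s y)) x := by
  have : ContMDiffVectorBundle n ℂ L 𝓘(ℝ, E) := ContMDiffVectorBundle.of_le (n := ∞) hn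
  rw [Trivialization.contMDiffAt_section_iff (trivializationAt ℂ L x₀) hx]
  refine Filter.EventuallyEq.contMDiffAt_iff ?_
  filter_upwards [(trivializationAt ℂ L x₀).open_baseSet.mem_nhds hx] with y hy
  exact (coord_eq hy _).symm

lemma contMDiffOn_frame (x : M) :
    ContMDiffOn 𝓘(ℝ, E) (𝓘(ℝ, E).prod 𝓘(ℝ, ℂ)) ∞ (fun y => TotalSpace.mk' ℂ y (frame L x y))
      (trivializationAt ℂ L x).baseSet := by
  intro y hy
  refine ContMDiffAt.contMDiffWithinAt ?_
  rw [contMDiffAt_iff_coord _ x y hy le_rfl]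
  refine (contMDiffAt_const (c := (1 : ℂ))).congr_of_eventuallyEq ?_
  filter_upwards [(trivializationAt ℂ L x).open_baseSet.mem_nhds hy] with y' hy'
  exact coord_frame hy'

lemma mdifferentiableAt_frame (x : M) :
    MDifferentiableAt 𝓘(ℝ, E) (𝓘(ℝ, E).prod 𝓘(ℝ, ℂ))
      (fun y => TotalSpace.mk' ℂ y (frame L x y)) x :=
  ((contMDiffOn_frame x).contMDiffAt (baseSet_mem_nhds x)).mdifferentiableAt (by simp)

lemma frame_ne_zero {x y : M} (hy : y ∈ (trivializationAt ℂ L x).baseSet) :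
    frame L x y ≠ 0 := by
  intro h
  have := coord_frame hy
  rw [h, map_zero] at this
  exact zero_ne_one this

/-- The product of a complex function and a section of `L` is differentiable. -/
lemma mdifferentiableAt_smul {f : M → ℂ} {s : Π y, L y} {x : M}
    (hf : MDifferentiableAt 𝓘(ℝ, E) 𝓘(ℝ, ℂ) f x)
    (hs : MDifferentiableAt 𝓘(ℝ, E) (𝓘(ℝ, E).prod 𝓘(ℝ, ℂ)) (fun y => TotalSpace.mk' ℂ y (s y)) x) :
    MDifferentiableAt 𝓘(ℝ, E) (𝓘(ℝ, E).prod 𝓘(ℝ, ℂ))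
      (fun y => TotalSpace.mk' ℂ y (f y • s y)) x := by
  rw [mdifferentiableAt_iff_coord] at hs ⊢
  simp only [map_smul, smul_eq_mul]
  exact mdifferentiableAt_mul_complex hf hs

end Line

/-! ### The complex Leibniz rule -/

section Leibniz

variable {E : Type w} [NormedAddCommGroup E] [NormedSpace ℝ E]
  {X : LineBundleWithConnection.{u, v, w} E}

namespace LineBundleWithConnection

/-- The Leibniz rule for complex-valued functions. -/
lemma conn_smul {f : X.M → ℂ} {s : Π y, X.L y} {x : X.M}
    (hf : MDifferentiableAt 𝓘(ℝ, E) 𝓘(ℝ, ℂ) f x)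
    (hs : MDifferentiableAt 𝓘(ℝ, E) (𝓘(ℝ, E).prod 𝓘(ℝ, ℂ)) (fun y => TotalSpace.mk' ℂ y (s y)) x)
    (u : TangentSpace 𝓘(ℝ, E) x) :
    X.conn (fun y => f y • s y) x u = f x • X.conn s x u + mvfderiv 𝓘(ℝ, E) f x u • s x := by
  have hre : MDifferentiableAt 𝓘(ℝ, E) 𝓘(ℝ, ℝ) (fun y => Complex.reCLM (f y)) x :=
    Complex.reCLM.differentiableAt.mdifferentiableAt.comp x hf
  have him : MDifferentiableAt 𝓘(ℝ, E) 𝓘(ℝ, ℝ) (fun y => Complex.imCLM (f y)) x :=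
    Complex.imCLM.differentiableAt.mdifferentiableAt.comp x hf
  have hIs : MDifferentiableAt 𝓘(ℝ, E) (𝓘(ℝ, E).prod 𝓘(ℝ, ℂ))
      (fun y => TotalSpace.mk' ℂ y ((Complex.I • s) y)) x :=
    mdifferentiableAt_smul (f := fun _ => Complex.I) mdifferentiableAt_const hs
  -- The covariant derivative satisfies the Leibniz rule for real functions only. Writing f s = (Re
  -- f) s + (Im f)(i s) and using complex linearity of ∇ gives the complex rule.
  have hdec : (fun y => f y • s y) = ((fun y => Complex.reCLM (f y)) • s)
      + ((fun y => Complex.imCLM (f y)) • (Complex.I • s)) := by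
    funext y
    simp only [Pi.add_apply, Pi.smul_apply', Pi.smul_apply, Complex.reCLM_apply,
      Complex.imCLM_apply]
    rw [← Complex.coe_smul, ← Complex.coe_smul, smul_smul, ← add_smul, Complex.re_add_im]
  have hc := X.conn.isCovariantDerivativeOnUniv
  have h1 := hc.leibniz hs hre
  have h2 := hc.leibniz hIs him
  rw [hdec, hc.add (hre.smul_section hs) (him.smul_section hIs), h1, h2]
  simp only [add_apply, smul_apply,
    ContinuousLinearMap.smulRight_apply, X.conn_complex s Complex.I x u hs,
    mvfderiv_clm_comp Complex.reCLM hf, mvfderiv_clm_comp Complex.imCLM hf]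
  simp only [Pi.smul_apply, Complex.reCLM_apply, Complex.imCLM_apply]
  conv_rhs => rw [← Complex.re_add_im (f x), ← Complex.re_add_im (mvfderiv 𝓘(ℝ, E) f x u)]
  simp only [add_smul, mul_smul, Complex.coe_smul]
  abel

end LineBundleWithConnection

end Leibniz

/-! ### The induced connection on tensor powers -/

section TensorPowersOfLines

variable {E : Type w} [NormedAddCommGroup E] [NormedSpace ℝ E]
  {X : LineBundleWithConnection.{u, v, w} E} {k : ℕ}

namespace LineBundleWithConnection

lemma tensorCoord_tprod (x y : X.M) (v : Fin k → X.L y) :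
    tensorCoord X.L k x y (PiTensorProduct.tprod ℂ v) = ∏ j, coord X.L x y (v j) := by
  simp [tensorCoord, coord]

lemma tensorCoord_smul_frame {x y : X.M} (hy : y ∈ (trivializationAt ℂ X.L x).baseSet)
    (t : ⨂[ℂ]^k (X.L y)) :
    tensorCoord X.L k x y t • PiTensorProduct.tprod ℂ (fun _ : Fin k => frame X.L x y) = t := by
  induction t using PiTensorProduct.induction_on with
  | smul_tprod r v =>
    rw [map_smul, tensorCoord_tprod, smul_assoc, ← MultilinearMap.map_smul_univ]
    simp only [coord_smul_frame hy]
  | add a b ha hb => rw [map_add, add_smul, ha, hb]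

lemma tensorCoord_frame {x y : X.M} (hy : y ∈ (trivializationAt ℂ X.L x).baseSet) :
    tensorCoord X.L k x y (PiTensorProduct.tprod ℂ (fun _ : Fin k => frame X.L x y)) = 1 := by
  simp [tensorCoord_tprod, coord_frame hy]

lemma tprod_const_smul {y : X.M} (a : ℂ) (e : X.L y) :
    PiTensorProduct.tprod ℂ (fun _ : Fin k => a • e)
      = a ^ k • PiTensorProduct.tprod ℂ (fun _ : Fin k => e) := by
  rw [MultilinearMap.map_smul_univ _ (fun _ => a)]
  simp

/-- On a line, ∇_u e = a e, so the k summands of the Leibniz rule coincide; this is the origin of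
the factor k in `tensorConnection_eq`. -/
lemma sum_tprod_update {y : X.M} (a : ℂ) (e : X.L y) :
    ∑ j : Fin k, PiTensorProduct.tprod ℂ (Function.update (fun _ : Fin k => e) j (a • e))
      = (k * a) • PiTensorProduct.tprod ℂ (fun _ : Fin k => e) := by
  have : ∀ j : Fin k, PiTensorProduct.tprod ℂ (Function.update (fun _ : Fin k => e) j (a • e))
      = a • PiTensorProduct.tprod ℂ (fun _ : Fin k => e) := by
    intro j
    rw [MultilinearMap.map_update_smul, Function.update_eq_self_iff.2 rfl]
  simp only [this, Finset.sum_const, Finset.card_univ, Fintype.card_fin, mul_smul]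
  rw [Nat.cast_smul_eq_nsmul]

/-- Differentiability at a point of a section of `L^{⊗k}`. -/
def TensorDifferentiableAt (σ : TensorSection X.L k) (x : X.M) : Prop :=
  MDifferentiableAt 𝓘(ℝ, E) 𝓘(ℝ, ℂ) (fun y => tensorCoord X.L k x y (σ y)) x

lemma tensorCoord_eq_of_eventually {σ : TensorSection X.L k} {x x₀ : X.M} {e : Π y, X.L y}
    {c : X.M → ℂ} (hσ : ∀ᶠ y in 𝓝 x, σ y = c y • PiTensorProduct.tprod ℂ (fun _ : Fin k => e y)) :
    (fun y => tensorCoord X.L k x₀ y (σ y)) =ᶠ[𝓝 x] fun y => c y * coord X.L x₀ y (e y) ^ k := by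
  filter_upwards [hσ] with y hy
  rw [hy, map_smul, tensorCoord_tprod]
  simp

lemma tensorDifferentiableAt_of_eventually {σ : TensorSection X.L k} {x : X.M} {e : Π y, X.L y}
    {c : X.M → ℂ}
    (he : MDifferentiableAt 𝓘(ℝ, E) (𝓘(ℝ, E).prod 𝓘(ℝ, ℂ)) (fun y => TotalSpace.mk' ℂ y (e y)) x)
    (hc : MDifferentiableAt 𝓘(ℝ, E) 𝓘(ℝ, ℂ) c x)
    (hσ : ∀ᶠ y in 𝓝 x, σ y = c y • PiTensorProduct.tprod ℂ (fun _ : Fin k => e y)) :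
    TensorDifferentiableAt σ x := by
  rw [mdifferentiableAt_iff_coord] at he
  refine MDifferentiableAt.congr_of_eventuallyEq ?_ (tensorCoord_eq_of_eventually hσ)
  exact mdifferentiableAt_mul_complex hc (mvfderiv_pow_complex he k 0).1

/-- The induced connection on `L^{⊗k}` may be computed in any differentiable local frame. -/
lemma tensorConnection_eq {σ : TensorSection X.L k} {x : X.M} {e : Π y, X.L y} {c : X.M → ℂ}
    (he : MDifferentiableAt 𝓘(ℝ, E) (𝓘(ℝ, E).prod 𝓘(ℝ, ℂ)) (fun y => TotalSpace.mk' ℂ y (e y)) x)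
    (hc : MDifferentiableAt 𝓘(ℝ, E) 𝓘(ℝ, ℂ) c x)
    (hσ : ∀ᶠ y in 𝓝 x, σ y = c y • PiTensorProduct.tprod ℂ (fun _ : Fin k => e y))
    (hex : e x ≠ 0) (u : TangentSpace 𝓘(ℝ, E) x) {a : ℂ} (ha : X.conn e x u = a • e x) :
    tensorConnection X.conn σ x u
      = (mvfderiv 𝓘(ℝ, E) c x u + k * c x * a) • PiTensorProduct.tprod ℂ (fun _ : Fin k => e x) := by
  have hx : x ∈ (trivializationAt ℂ X.L x).baseSet := FiberBundle.mem_baseSet_trivializationAt' x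
  have hfx := frame_ne_zero hx
  have hfd := mdifferentiableAt_frame (E := E) (L := X.L) x
  have heq := tensorCoord_eq_of_eventually (x₀ := x) hσ
  have hh := (mdifferentiableAt_iff_coord e x).1 he
  obtain ⟨w, hw⟩ := exists_smul_eq hfx (X.conn (frame X.L x) x u)
  have hhx : coord X.L x x (e x) ≠ 0 := fun h => hex ((coord_eq_zero_iff hx _).1 h)
  have hee : ∀ᶠ y in 𝓝 x, e y = coord X.L x y (e y) • frame X.L x y := by
    filter_upwards [baseSet_mem_nhds (L := X.L) x] with y hy
    exact (coord_smul_frame hy _).symm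
  have hconn : X.conn e x u = (coord X.L x x (e x) * w
      + mvfderiv 𝓘(ℝ, E) (fun y => coord X.L x y (e y)) x u) • frame X.L x x := by
    have h1 : X.conn e x = X.conn (fun y => coord X.L x y (e y) • frame X.L x y) x :=
      X.conn.isCovariantDerivativeOnUniv.congr_of_eventuallyEq he
        (mdifferentiableAt_smul hh hfd) Filter.univ_mem hee
    rw [h1, conn_smul hh hfd, hw, smul_smul, add_smul]
  -- With h the coordinate of e and ∇_u f = w f for the standard frame f, this is the transformation
  -- rule a h = h w + dh(u) of the connection form.
  have hrel : a * coord X.L x x (e x) = coord X.L x x (e x) * w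
      + mvfderiv 𝓘(ℝ, E) (fun y => coord X.L x y (e y)) x u := by
    have h2 := congrArg (coord X.L x x) (ha.symm.trans hconn)
    rw [map_smul, map_smul, coord_frame hx] at h2
    simpa using h2
  have hex2 : e x = coord X.L x x (e x) • frame X.L x x := (coord_smul_frame hx _).symm
  have hex3 : PiTensorProduct.tprod ℂ (fun _ : Fin k => e x)
      = coord X.L x x (e x) ^ k • PiTensorProduct.tprod ℂ (fun _ : Fin k => frame X.L x x) := by
    conv_lhs => rw [hex2]
    rw [tprod_const_smul]
  have hpow := mvfderiv_pow_complex hh k u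
  unfold tensorConnection
  rw [mvfderiv_congr heq, mvfderiv_mul_complex hc hpow.1, hpow.2, hw, sum_tprod_update,
    heq.eq_of_nhds, hex3, smul_smul, smul_smul, ← add_smul]
  congr 1
  -- For positive k the two sides differ by the rule `hrel`, since the coordinate of σ is c h^k and
  -- its derivative contains k c h^(k-1) dh.
  rcases k with _ | k
  · simp
  · simp only [Nat.add_sub_cancel, pow_succ]
    have : mvfderiv 𝓘(ℝ, E) (fun y => coord X.L x y (e y)) x u
      = a * coord X.L x x (e x) - coord X.L x x (e x) * w := by rw [hrel]; ring
    rw [this]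
    ring

lemma eventually_eq_tensorCoord_smul (σ : TensorSection X.L k) (x : X.M) :
    ∀ᶠ y in 𝓝 x, σ y = tensorCoord X.L k x y (σ y) •
      PiTensorProduct.tprod ℂ (fun _ : Fin k => frame X.L x y) := by
  filter_upwards [baseSet_mem_nhds (L := X.L) x] with y hy
  exact (tensorCoord_smul_frame hy _).symm

lemma tensorConnection_add_vector (σ : TensorSection X.L k) (x : X.M)
    (u v : TangentSpace 𝓘(ℝ, E) x) :
    tensorConnection X.conn σ x (u + v)
      = tensorConnection X.conn σ x u + tensorConnection X.conn σ x v := by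
  unfold tensorConnection
  simp only [map_add, MultilinearMap.map_update_add, Finset.sum_add_distrib, add_smul, smul_add]
  abel

lemma tensorConnection_smul_vector (σ : TensorSection X.L k) (x : X.M) (r : ℝ)
    (u : TangentSpace 𝓘(ℝ, E) x) :
    tensorConnection X.conn σ x (r • u) = (r : ℂ) • tensorConnection X.conn σ x u := by
  unfold tensorConnection
  simp only [map_smul, smul_add, ← Complex.coe_smul, MultilinearMap.map_update_smul,
    ← Finset.smul_sum, smul_eq_mul, mul_smul]
  rw [smul_comm (tensorCoord X.L k x x (σ x))]

lemma tensorConnection_add {σ τ : TensorSection X.L k} {x : X.M}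
    (hσ : TensorDifferentiableAt σ x) (hτ : TensorDifferentiableAt τ x)
    (u : TangentSpace 𝓘(ℝ, E) x) :
    tensorConnection X.conn (fun y => σ y + τ y) x u
      = tensorConnection X.conn σ x u + tensorConnection X.conn τ x u := by
  unfold tensorConnection
  simp only [map_add]
  rw [mvfderiv_fun_add hσ hτ]
  simp only [add_apply, add_smul]
  abel

lemma tensorConnection_smul {f : X.M → ℂ} {σ : TensorSection X.L k} {x : X.M}
    (hf : MDifferentiableAt 𝓘(ℝ, E) 𝓘(ℝ, ℂ) f x) (hσ : TensorDifferentiableAt σ x)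
    (u : TangentSpace 𝓘(ℝ, E) x) :
    tensorConnection X.conn (fun y => f y • σ y) x u
      = f x • tensorConnection X.conn σ x u + mvfderiv 𝓘(ℝ, E) f x u • σ x := by
  have hx : x ∈ (trivializationAt ℂ X.L x).baseSet := FiberBundle.mem_baseSet_trivializationAt' x
  unfold tensorConnection
  simp only [map_smul, smul_eq_mul]
  rw [mvfderiv_mul_complex hf hσ]
  conv_rhs => rw [← tensorCoord_smul_frame hx (σ x)]
  simp only [add_smul, mul_smul, smul_add, map_smul, tensorCoord_frame hx, smul_eq_mul, mul_one]
  abel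

end LineBundleWithConnection

end TensorPowersOfLines

/-! ### Differentiability of the covariant derivative of a smooth section -/

section SecondDerivatives

variable {E : Type w} [NormedAddCommGroup E] [NormedSpace ℝ E]

section Arithmetic

variable {H M : Type*} [TopologicalSpace H] {I : ModelWithCorners ℝ E H} [TopologicalSpace M]
  [ChartedSpace H M] {f g : M → ℂ} {x : M} {n : ℕ∞ω}

lemma contMDiffAt_mul_complex (hf : ContMDiffAt I 𝓘(ℝ, ℂ) n f x)
    (hg : ContMDiffAt I 𝓘(ℝ, ℂ) n g x) : ContMDiffAt I 𝓘(ℝ, ℂ) n (fun y => f y * g y) x :=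
  (contDiff_mul.contMDiff.contMDiffAt (x := (f x, g x))).comp x (hf.prodMk_space hg)

lemma contMDiffAt_inv_complex (hf : ContMDiffAt I 𝓘(ℝ, ℂ) n f x) (h0 : f x ≠ 0) :
    ContMDiffAt I 𝓘(ℝ, ℂ) n (fun y => (f y)⁻¹) x :=
  (contDiffAt_inv ℝ h0).contMDiffAt.comp x hf

lemma contMDiffAt_pow_complex (hf : ContMDiffAt I 𝓘(ℝ, ℂ) n f x) (k : ℕ) :
    ContMDiffAt I 𝓘(ℝ, ℂ) n (fun y => f y ^ k) x :=
  ((contDiff_id.pow k).contMDiff.contMDiffAt (x := f x)).comp x hf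

end Arithmetic

lemma mdifferentiableAt_mvfderiv_apply {M : Type*} [TopologicalSpace M] [ChartedSpace E M]
    [IsManifold 𝓘(ℝ, E) ∞ M] {F : Type*} [NormedAddCommGroup F] [NormedSpace ℝ F]
    {c : M → F} {x : M} (hc : ContMDiffAt 𝓘(ℝ, E) 𝓘(ℝ, F) ∞ c x)
    {V : Π y : M, TangentSpace 𝓘(ℝ, E) y}
    (hV : MDifferentiableAt 𝓘(ℝ, E) (𝓘(ℝ, E).prod 𝓘(ℝ, E)) (fun y => TotalSpace.mk' E y (V y)) x) :
    MDifferentiableAt 𝓘(ℝ, E) 𝓘(ℝ, F) (fun y => mvfderiv 𝓘(ℝ, E) c y (V y)) x := by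
  have h1 := (ContMDiffAt.mfderiv_const (m := 1) hc (by norm_cast)).mdifferentiableAt one_ne_zero
  have h2 := MDifferentiableAt.clm_apply_of_inCoordinates (b₂ := c)
    (ϕ := fun y => mfderiv 𝓘(ℝ, E) 𝓘(ℝ, F) c y) (IB₂ := 𝓘(ℝ, F))
    (E₂ := fun z : F => TangentSpace 𝓘(ℝ, F) z) h1 hV (hc.mdifferentiableAt (by simp))
  rw [mdifferentiableAt_totalSpace] at h2
  refine h2.2.congr_of_eventuallyEq (Filter.Eventually.of_forall fun y => ?_)
  simp
  rfl

variable {X : LineBundleWithConnection.{u, v, w} E} {k : ℕ}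

namespace LineBundleWithConnection

/-- A smooth section of `L^{⊗k}` is a smooth multiple of the power of a smooth local frame. -/
lemma exists_contMDiffAt_coefficient {σ : TensorSection X.L k}
    (hσ : IsSmoothTensorSection (E := E) σ) {x : X.M} {e : Π y, X.L y}
    (he : ContMDiffAt 𝓘(ℝ, E) (𝓘(ℝ, E).prod 𝓘(ℝ, ℂ)) ∞ (fun y => TotalSpace.mk' ℂ y (e y)) x)
    (hex : e x ≠ 0) : ∃ c : X.M → ℂ, ContMDiffAt 𝓘(ℝ, E) 𝓘(ℝ, ℂ) ∞ c x ∧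
      ∀ᶠ y in 𝓝 x, σ y = c y • PiTensorProduct.tprod ℂ (fun _ : Fin k => e y) := by
  have hx : x ∈ (trivializationAt ℂ X.L x).baseSet := FiberBundle.mem_baseSet_trivializationAt' x
  have hh := (contMDiffAt_iff_coord e x x hx le_rfl).1 he
  have hhx : coord X.L x x (e x) ≠ 0 := fun h => hex ((coord_eq_zero_iff hx _).1 h)
  refine ⟨fun y => tensorCoord X.L k x y (σ y) / coord X.L x y (e y) ^ k,
    ?_, ?_⟩
  · simp only [div_eq_mul_inv]
    exact contMDiffAt_mul_complex (hσ x) (contMDiffAt_inv_complex (contMDiffAt_pow_complex hh k)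
      (pow_ne_zero k hhx))
  filter_upwards [baseSet_mem_nhds (L := X.L) x, hh.continuousAt.eventually_ne hhx] with y hy hne
  conv_lhs => rw [← tensorCoord_smul_frame hy (σ y)]
  have h2 : e y = coord X.L x y (e y) • frame X.L x y := (coord_smul_frame hy _).symm
  conv_rhs => rw [h2, tprod_const_smul, smul_smul]
  congr 1
  rw [← h2, div_mul_cancel₀ _ (pow_ne_zero k hne)]

lemma _root_.SunadaLine.IsSmoothTensorSection.tensorDifferentiableAt {σ : TensorSection X.L k}
    (hσ : IsSmoothTensorSection (E := E) σ) (x : X.M) : TensorDifferentiableAt σ x :=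
  (hσ x).mdifferentiableAt (by simp)

variable [FiniteDimensional ℝ E]

variable (X) in
-- A local frame is cut off by a bump function. A globally smooth section is wanted because
-- `conn_smooth` is applied on the whole manifold.
lemma exists_contMDiff_ne_zero (x : X.M) : ∃ e : Π y, X.L y,
    ContMDiff 𝓘(ℝ, E) (𝓘(ℝ, E).prod 𝓘(ℝ, ℂ)) ∞ (fun y => TotalSpace.mk' ℂ y (e y)) ∧ e x ≠ 0 := by
  obtain ⟨f, -, hf⟩ := (SmoothBumpFunction.nhds_basis_tsupport (I := 𝓘(ℝ, E)) x).mem_iff.1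
    (baseSet_mem_nhds (L := X.L) x)
  refine ⟨(f : X.M → ℝ) • frame X.L x, ?_, ?_⟩
  · exact ContMDiffOn.smul_section_of_tsupport f.contMDiff.contMDiffOn
      (trivializationAt ℂ X.L x).open_baseSet hf (contMDiffOn_frame x)
  · simpa using frame_ne_zero (FiberBundle.mem_baseSet_trivializationAt' x)

/-- The derivative of a smooth section of `L^{⊗k}` along a differentiable vector field is
differentiable. -/
lemma tensorDifferentiableAt_tensorConnection {σ : TensorSection X.L k}
    (hσ : IsSmoothTensorSection (E := E) σ) {x : X.M} {V : Π y : X.M, TangentSpace 𝓘(ℝ, E) y}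
    (hV : MDifferentiableAt 𝓘(ℝ, E) (𝓘(ℝ, E).prod 𝓘(ℝ, E)) (fun y => TotalSpace.mk' E y (V y)) x) :
    TensorDifferentiableAt (fun y => tensorConnection X.conn σ y (V y)) x := by
  -- By definition `tensorConnection` at y uses the frame of the trivialization around y, which need
  -- not vary continuously with y. A single section e, nonzero near x, expresses all these values at
  -- once.
  obtain ⟨e, he, hex⟩ := X.exists_contMDiff_ne_zero x
  obtain ⟨c, hc, hcσ⟩ := exists_contMDiffAt_coefficient hσ he.contMDiffAt hex
  have hx : x ∈ (trivializationAt ℂ X.L x).baseSet := FiberBundle.mem_baseSet_trivializationAt' x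
  have hed : ∀ y, MDifferentiableAt 𝓘(ℝ, E) (𝓘(ℝ, E).prod 𝓘(ℝ, ℂ))
      (fun y => TotalSpace.mk' ℂ y (e y)) y := fun y => he.contMDiffAt.mdifferentiableAt (by simp)
  have hh := (mdifferentiableAt_iff_coord e x).1 (hed x)
  have hhx : coord X.L x x (e x) ≠ 0 := fun h => hex ((coord_eq_zero_iff hx _).1 h)
  have hce := X.conn_smooth.contMDiff.contMDiff (σ := e) he.contMDiffOn
  have hce2 := ((hce x trivial).contMDiffAt Filter.univ_mem).mdifferentiableAt (by simp)
  have hce3 := (mdifferentiableAt_iff_coord _ x).1 (hce2.clm_bundle_apply hV)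
  have hdc := mdifferentiableAt_mvfderiv_apply hc hV
  -- The connection form of e evaluated on V, as the quotient of the coordinates of ∇_V e and e.
  have hω : MDifferentiableAt 𝓘(ℝ, E) 𝓘(ℝ, ℂ)
      (fun y => coord X.L x y (X.conn e y (V y)) * (coord X.L x y (e y))⁻¹) x :=
    mdifferentiableAt_mul_complex hce3 ((contMDiffAt_inv_complex
      ((contMDiffAt_iff_coord e x x hx le_rfl).1 he.contMDiffAt) hhx).mdifferentiableAt (by simp))
  refine tensorDifferentiableAt_of_eventually (hed x)
    (c := fun y => mvfderiv 𝓘(ℝ, E) c y (V y)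
      + ((k : ℂ) * c y) * (coord X.L x y (X.conn e y (V y)) * (coord X.L x y (e y))⁻¹)) ?_ ?_
  · exact hdc.add (mdifferentiableAt_mul_complex (mdifferentiableAt_mul_complex
      mdifferentiableAt_const (hc.mdifferentiableAt (by simp))) hω)
  · have hc1 : ∀ᶠ y in 𝓝 x, ContMDiffAt 𝓘(ℝ, E) 𝓘(ℝ, ℂ) 1 c y :=
      (contMDiffAt_iff_contMDiffAt_nhds (by simp)).1 (hc.of_le (by norm_cast))
    filter_upwards [hc1, hcσ.eventually_nhds, baseSet_mem_nhds (L := X.L) x,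
      hh.continuousAt.eventually_ne hhx] with y hcy hσy hy hne
    have hey : e y ≠ 0 := fun h => hne (by rw [h, map_zero])
    obtain ⟨a, ha⟩ := exists_smul_eq hey (X.conn e y (V y))
    rw [tensorConnection_eq (hed y) (hcy.mdifferentiableAt one_ne_zero) hσy hey (V y) ha, ha,
      map_smul, smul_eq_mul, mul_assoc a, mul_inv_cancel₀ hne, mul_one]

end LineBundleWithConnection

end SecondDerivatives

/-! ### Existence and rules of the Levi-Civita derivative -/

section LeviCivitaExistence

variable {E : Type*} [NormedAddCommGroup E] [NormedSpace ℝ E]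
  {M : Type*} [TopologicalSpace M] [ChartedSpace E M] [IsManifold 𝓘(ℝ, E) ∞ M]

/-- Differentiability of a vector field at a point. -/
abbrev VectorFieldDifferentiableAt (V : Π x : M, TangentSpace 𝓘(ℝ, E) x) (x : M) : Prop :=
  MDifferentiableAt 𝓘(ℝ, E) (𝓘(ℝ, E).prod 𝓘(ℝ, E)) (fun y => TotalSpace.mk' E y (V y)) x

variable {V V' W W' Z Z' : Π x : M, TangentSpace 𝓘(ℝ, E) x} {x : M} {f : M → ℝ}

lemma vectorFieldDifferentiableAt_extend (u : TangentSpace 𝓘(ℝ, E) x) :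
    VectorFieldDifferentiableAt (FiberBundle.extend E u) x :=
  FiberBundle.mdifferentiableAt_extend 𝓘(ℝ, E) E u

variable [RiemannianBundle (fun x : M => TangentSpace 𝓘(ℝ, E) x)]

lemma IsLeviCivitaAt.eq {w w' : TangentSpace 𝓘(ℝ, E) x} (h : IsLeviCivitaAt V W x w)
    (h' : IsLeviCivitaAt V W x w') : w = w' := by
  refine ext_inner_right ℝ fun z => ?_
  have h1 := h _ (vectorFieldDifferentiableAt_extend z)
  have h2 := h' _ (vectorFieldDifferentiableAt_extend z)
  rw [FiberBundle.extend_apply_self] at h1 h2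
  linarith

variable [IsContMDiffRiemannianBundle 𝓘(ℝ, E) ∞ E (fun x : M => TangentSpace 𝓘(ℝ, E) x)]

lemma mdifferentiableAt_inner (hV : VectorFieldDifferentiableAt V x)
    (hW : VectorFieldDifferentiableAt W x) :
    MDifferentiableAt 𝓘(ℝ, E) 𝓘(ℝ, ℝ) (fun y => inner ℝ (V y) (W y)) x :=
  MDifferentiableAt.inner_bundle (E := fun x : M => TangentSpace 𝓘(ℝ, E) x) hV hW

lemma mvfderiv_inner_add_left (hV : VectorFieldDifferentiableAt V x)
    (hV' : VectorFieldDifferentiableAt V' x) (hW : VectorFieldDifferentiableAt W x)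
    (u : TangentSpace 𝓘(ℝ, E) x) :
    mvfderiv 𝓘(ℝ, E) (fun y => inner ℝ ((V + V') y) (W y)) x u
      = mvfderiv 𝓘(ℝ, E) (fun y => inner ℝ (V y) (W y)) x u
        + mvfderiv 𝓘(ℝ, E) (fun y => inner ℝ (V' y) (W y)) x u := by
  simp only [Pi.add_apply, inner_add_left]
  rw [mvfderiv_fun_add (mdifferentiableAt_inner hV hW) (mdifferentiableAt_inner hV' hW)]
  rfl

lemma mvfderiv_inner_add_right (hV : VectorFieldDifferentiableAt V x)
    (hW : VectorFieldDifferentiableAt W x) (hW' : VectorFieldDifferentiableAt W' x)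
    (u : TangentSpace 𝓘(ℝ, E) x) :
    mvfderiv 𝓘(ℝ, E) (fun y => inner ℝ (V y) ((W + W') y)) x u
      = mvfderiv 𝓘(ℝ, E) (fun y => inner ℝ (V y) (W y)) x u
        + mvfderiv 𝓘(ℝ, E) (fun y => inner ℝ (V y) (W' y)) x u := by
  simp only [Pi.add_apply, inner_add_right]
  rw [mvfderiv_fun_add (mdifferentiableAt_inner hV hW) (mdifferentiableAt_inner hV hW')]
  rfl

lemma mvfderiv_inner_smul_left (hf : MDifferentiableAt 𝓘(ℝ, E) 𝓘(ℝ, ℝ) f x)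
    (hV : VectorFieldDifferentiableAt V x) (hW : VectorFieldDifferentiableAt W x)
    (u : TangentSpace 𝓘(ℝ, E) x) :
    mvfderiv 𝓘(ℝ, E) (fun y => inner ℝ ((f • V) y) (W y)) x u
      = f x * mvfderiv 𝓘(ℝ, E) (fun y => inner ℝ (V y) (W y)) x u
        + mvfderiv 𝓘(ℝ, E) f x u * inner ℝ (V x) (W x) := by
  simp only [Pi.smul_apply', real_inner_smul_left]
  rw [mvfderiv_fun_mul hf (mdifferentiableAt_inner hV hW)]
  simp [mul_comm]

lemma mvfderiv_inner_smul_right (hf : MDifferentiableAt 𝓘(ℝ, E) 𝓘(ℝ, ℝ) f x)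
    (hV : VectorFieldDifferentiableAt V x) (hW : VectorFieldDifferentiableAt W x)
    (u : TangentSpace 𝓘(ℝ, E) x) :
    mvfderiv 𝓘(ℝ, E) (fun y => inner ℝ (V y) ((f • W) y)) x u
      = f x * mvfderiv 𝓘(ℝ, E) (fun y => inner ℝ (V y) (W y)) x u
        + mvfderiv 𝓘(ℝ, E) f x u * inner ℝ (V x) (W x) := by
  simp only [Pi.smul_apply', real_inner_smul_right]
  rw [mvfderiv_fun_mul hf (mdifferentiableAt_inner hV hW)]
  simp [mul_comm]

variable [FiniteDimensional ℝ E]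

/-- The terms V(f)⟨W,Z⟩ and W(f)⟨V,Z⟩ from differentiating the inner products cancel against those
from the brackets [V, fZ] and [W, fZ]. -/
lemma koszul_tensorialAt (hV : VectorFieldDifferentiableAt V x)
    (hW : VectorFieldDifferentiableAt W x) :
    TensorialAt 𝓘(ℝ, E) E (fun Z => koszul V W Z x) x where
  smul {f Z} hf hZ := by
    simp only [koszul]
    rw [mvfderiv_inner_smul_right hf hW hZ, mvfderiv_inner_smul_right hf hV hZ,
      VectorField.mlieBracket_smul_right hf hZ, VectorField.mlieBracket_smul_right hf hZ]
    simp only [Pi.smul_apply', map_smul, inner_add_left, real_inner_smul_left,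
      real_inner_smul_right, smul_eq_mul, real_inner_comm]
    ring
  add {Z Z'} hZ hZ' := by
    simp only [koszul]
    rw [mvfderiv_inner_add_right hW hZ hZ', mvfderiv_inner_add_right hV hZ hZ',
      VectorField.mlieBracket_add_right hZ hZ', VectorField.mlieBracket_add_right hZ hZ']
    simp only [Pi.add_apply, map_add, inner_add_left, inner_add_right]
    ring

lemma koszul_add_left (hV : VectorFieldDifferentiableAt V x)
    (hV' : VectorFieldDifferentiableAt V' x) (hW : VectorFieldDifferentiableAt W x)
    (hZ : VectorFieldDifferentiableAt Z x) :
    koszul (V + V') W Z x = koszul V W Z x + koszul V' W Z x := by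
  simp only [koszul]
  rw [mvfderiv_inner_add_left hV hV' hZ, mvfderiv_inner_add_left hV hV' hW,
    VectorField.mlieBracket_add_left hV hV', VectorField.mlieBracket_add_left hV hV']
  simp only [Pi.add_apply, map_add, inner_add_left, inner_add_right]
  ring

lemma koszul_smul_left (hf : MDifferentiableAt 𝓘(ℝ, E) 𝓘(ℝ, ℝ) f x)
    (hV : VectorFieldDifferentiableAt V x) (hW : VectorFieldDifferentiableAt W x)
    (hZ : VectorFieldDifferentiableAt Z x) :
    koszul (f • V) W Z x = f x * koszul V W Z x := by
  simp only [koszul]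
  rw [mvfderiv_inner_smul_left hf hV hZ, mvfderiv_inner_smul_left hf hV hW,
    VectorField.mlieBracket_smul_left hf hV, VectorField.mlieBracket_smul_left hf hV]
  simp only [Pi.smul_apply', map_smul, inner_add_left, real_inner_smul_left,
    real_inner_smul_right, smul_eq_mul, inner_neg_left, neg_smul]
  rw [real_inner_comm (W x) (V x), real_inner_comm (Z x) (V x)]
  ring

lemma koszul_add_middle (hV : VectorFieldDifferentiableAt V x)
    (hW : VectorFieldDifferentiableAt W x) (hW' : VectorFieldDifferentiableAt W' x)
    (hZ : VectorFieldDifferentiableAt Z x) :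
    koszul V (W + W') Z x = koszul V W Z x + koszul V W' Z x := by
  simp only [koszul]
  rw [mvfderiv_inner_add_left hW hW' hZ, mvfderiv_inner_add_right hV hW hW',
    VectorField.mlieBracket_add_right hW hW', VectorField.mlieBracket_add_left hW hW']
  simp only [Pi.add_apply, map_add, inner_add_left, inner_add_right]
  ring

/-- Here the Z(f) terms cancel, but V(f)⟨W,Z⟩ occurs twice: once from the derivative, once from [V,
fW]. Matched with the 2 in the Koszul formula, it becomes the Leibniz term of D_V(fW). -/
lemma koszul_smul_middle (hf : MDifferentiableAt 𝓘(ℝ, E) 𝓘(ℝ, ℝ) f x)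
    (hV : VectorFieldDifferentiableAt V x) (hW : VectorFieldDifferentiableAt W x)
    (hZ : VectorFieldDifferentiableAt Z x) :
    koszul V (f • W) Z x
      = f x * koszul V W Z x + 2 * (mvfderiv 𝓘(ℝ, E) f x (V x) * inner ℝ (W x) (Z x)) := by
  simp only [koszul]
  rw [mvfderiv_inner_smul_left hf hW hZ, mvfderiv_inner_smul_right hf hV hW,
    VectorField.mlieBracket_smul_right hf hW, VectorField.mlieBracket_smul_left hf hW]
  simp only [Pi.smul_apply', map_smul, inner_add_left, real_inner_smul_left,
    real_inner_smul_right, smul_eq_mul, inner_neg_left, neg_smul]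
  rw [real_inner_comm (W x) (V x)]
  ring

/-- By tensoriality the Koszul expression is a linear functional of the value Z(x), and half of it
is represented by a vector by the Riesz theorem. -/
lemma exists_isLeviCivitaAt (hV : VectorFieldDifferentiableAt V x)
    (hW : VectorFieldDifferentiableAt W x) : ∃ w, IsLeviCivitaAt V W x w := by
  have hT := koszul_tensorialAt hV hW
  let ℓ : StrongDual ℝ (TangentSpace 𝓘(ℝ, E) x) := TensorialAt.mkHom _ x hT
  have : CompleteSpace (TangentSpace 𝓘(ℝ, E) x) := FiniteDimensional.complete ℝ _
  refine ⟨(InnerProductSpace.toDual ℝ (TangentSpace 𝓘(ℝ, E) x)).symm ((1 / 2 : ℝ) • ℓ), ?_⟩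
  intro Z hZ
  rw [InnerProductSpace.toDual_symm_apply]
  have : ℓ (Z x) = koszul V W Z x := TensorialAt.mkHom_apply hT hZ
  rw [smul_apply, this]
  simp

lemma isLeviCivitaAt_leviCivita (hV : VectorFieldDifferentiableAt V x)
    (hW : VectorFieldDifferentiableAt W x) : IsLeviCivitaAt V W x (leviCivita V W x) := by
  have h := exists_isLeviCivitaAt hV hW
  unfold leviCivita
  rw [dif_pos h]
  exact h.choose_spec

lemma leviCivita_tensorialAt (hW : VectorFieldDifferentiableAt W x) :
    TensorialAt 𝓘(ℝ, E) E (fun V => leviCivita V W x) x where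
  smul {f V} hf hV := by
    refine (isLeviCivitaAt_leviCivita (hf.smul_section hV) hW).eq fun Z hZ => ?_
    rw [koszul_smul_left hf hV hW hZ, real_inner_smul_left,
      ← isLeviCivitaAt_leviCivita hV hW Z hZ]
    ring
  add {V V'} hV hV' := by
    refine (isLeviCivitaAt_leviCivita (mdifferentiableAt_add_section hV hV') hW).eq fun Z hZ => ?_
    rw [koszul_add_left hV hV' hW hZ, inner_add_left, mul_add,
      ← isLeviCivitaAt_leviCivita hV hW Z hZ, ← isLeviCivitaAt_leviCivita hV' hW Z hZ]

lemma leviCivita_add (hV : VectorFieldDifferentiableAt V x)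
    (hW : VectorFieldDifferentiableAt W x) (hW' : VectorFieldDifferentiableAt W' x) :
    leviCivita V (W + W') x = leviCivita V W x + leviCivita V W' x := by
  refine (isLeviCivitaAt_leviCivita hV (mdifferentiableAt_add_section hW hW')).eq fun Z hZ => ?_
  rw [koszul_add_middle hV hW hW' hZ, inner_add_left, mul_add,
    ← isLeviCivitaAt_leviCivita hV hW Z hZ, ← isLeviCivitaAt_leviCivita hV hW' Z hZ]

lemma leviCivita_smul (hf : MDifferentiableAt 𝓘(ℝ, E) 𝓘(ℝ, ℝ) f x)
    (hV : VectorFieldDifferentiableAt V x) (hW : VectorFieldDifferentiableAt W x) :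
    leviCivita V (f • W) x = f x • leviCivita V W x + mvfderiv 𝓘(ℝ, E) f x (V x) • W x := by
  refine (isLeviCivitaAt_leviCivita hV (hf.smul_section hW)).eq fun Z hZ => ?_
  rw [koszul_smul_middle hf hV hW hZ, inner_add_left, mul_add, real_inner_smul_left,
    real_inner_smul_left, ← isLeviCivitaAt_leviCivita hV hW Z hZ]
  ring

end LeviCivitaExistence

/-! ### Tensoriality of the second covariant derivative -/

section SecondCovariantDerivative

variable {E : Type w} [NormedAddCommGroup E] [NormedSpace ℝ E] [FiniteDimensional ℝ E]
  {X : LineBundleWithConnection.{u, v, w} E} {k : ℕ}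

namespace LineBundleWithConnection

/-- The expression `∇_V (∇_W σ) - ∇_{D_V W} σ` at `x`. -/
def hessian (σ : TensorSection X.L k) (x : X.M) (V W : Π y : X.M, TangentSpace 𝓘(ℝ, E) y) :
    ⨂[ℂ]^k (X.L x) :=
  tensorConnection X.conn (fun y => tensorConnection X.conn σ y (W y)) x (V x)
    - tensorConnection X.conn σ x (leviCivita V W x)

lemma hessian_tensorialAt_left {σ : TensorSection X.L k}
    {x : X.M} {W : Π y : X.M, TangentSpace 𝓘(ℝ, E) y} (hW : VectorFieldDifferentiableAt W x) :
    TensorialAt 𝓘(ℝ, E) E (fun V => hessian σ x V W) x where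
  smul {f V} hf hV := by
    simp only [hessian]
    rw [(leviCivita_tensorialAt hW).smul hf hV, Pi.smul_apply', tensorConnection_smul_vector,
      tensorConnection_smul_vector, ← Complex.coe_smul, smul_sub]
  add {V V'} hV hV' := by
    simp only [hessian]
    rw [(leviCivita_tensorialAt hW).add hV hV', Pi.add_apply, tensorConnection_add_vector,
      tensorConnection_add_vector]
    abel

/-- Replacing W by fW produces df(V) ∇_W σ both in ∇_V(f ∇_W σ) and in ∇_{D_V(fW)} σ, and the two
cancel. Smoothness of σ makes ∇_W σ differentiable, as the Leibniz rule requires. -/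
lemma hessian_tensorialAt_right {σ : TensorSection X.L k}
    (hσ : IsSmoothTensorSection (E := E) σ)
    {x : X.M} {V : Π y : X.M, TangentSpace 𝓘(ℝ, E) y} (hV : VectorFieldDifferentiableAt V x) :
    TensorialAt 𝓘(ℝ, E) E (fun W => hessian σ x V W) x where
  smul {f W} hf hW := by
    simp only [hessian, Pi.smul_apply', tensorConnection_smul_vector]
    rw [leviCivita_smul hf hV hW, tensorConnection_add_vector, tensorConnection_smul_vector,
      tensorConnection_smul_vector, tensorConnection_smul (mdifferentiableAt_ofReal hf)
        (tensorDifferentiableAt_tensorConnection hσ hW), ← Complex.coe_smul, smul_sub]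
    have : mvfderiv 𝓘(ℝ, E) (fun y => (f y : ℂ)) x (V x) = (mvfderiv 𝓘(ℝ, E) f x (V x) : ℂ) :=
      mvfderiv_clm_comp Complex.ofRealCLM hf (V x)
    rw [this]
    abel
  add {W W'} hW hW' := by
    simp only [hessian, Pi.add_apply, tensorConnection_add_vector]
    rw [leviCivita_add hV hW hW', tensorConnection_add_vector,
      tensorConnection_add (tensorDifferentiableAt_tensorConnection hσ hW)
        (tensorDifferentiableAt_tensorConnection hσ hW')]
    abel

/-- The second covariant derivative may be computed with any extensions of the two vectors. -/
lemma secondCovariantDerivative_eq_hessian {σ : TensorSection X.L k}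
    (hσ : IsSmoothTensorSection (E := E) σ)
    {x : X.M} {V W : Π y : X.M, TangentSpace 𝓘(ℝ, E) y} (hV : VectorFieldDifferentiableAt V x)
    (hW : VectorFieldDifferentiableAt W x) :
    secondCovariantDerivative X.conn σ x (V x) (W x) = hessian σ x V W := by
  have h := TensorialAt.pointwise₂ (I := 𝓘(ℝ, E)) (F := E) (F' := E) (Φ := hessian σ x) (x := x)
    (fun _ h => hessian_tensorialAt_left h) (fun _ h => hessian_tensorialAt_right hσ h)
    (vectorFieldDifferentiableAt_extend (V x)) hV
    (vectorFieldDifferentiableAt_extend (W x)) hW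
    (FiberBundle.extend_apply_self E _) (FiberBundle.extend_apply_self E _)
  rw [← h]
  simp [secondCovariantDerivative, hessian]

end LineBundleWithConnection

end SecondCovariantDerivative

/-! ### Pull-back of sections under fibrewise isomorphisms -/

section PullbackOfSections

variable {E : Type*} [NormedAddCommGroup E] [NormedSpace ℝ E]
  {M : Type*} [TopologicalSpace M] [ChartedSpace E M] [IsManifold 𝓘(ℝ, E) ∞ M]
  {N : Type*} [TopologicalSpace N] [ChartedSpace E N] [IsManifold 𝓘(ℝ, E) ∞ N]
  {L : M → Type*} [∀ x, NormedAddCommGroup (L x)] [∀ x, InnerProductSpace ℂ (L x)]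
  [TopologicalSpace (TotalSpace ℂ L)] [FiberBundle ℂ L] [VectorBundle ℂ ℂ L]
  [VectorBundle ℝ ℂ L] [ContMDiffVectorBundle ∞ ℂ L 𝓘(ℝ, E)]
  {L' : N → Type*} [∀ x, NormedAddCommGroup (L' x)] [∀ x, InnerProductSpace ℂ (L' x)]
  [TopologicalSpace (TotalSpace ℂ L')] [FiberBundle ℂ L'] [VectorBundle ℂ ℂ L']
  [VectorBundle ℝ ℂ L'] [ContMDiffVectorBundle ∞ ℂ L' 𝓘(ℝ, E)]
  {f : M → N}

/-- The pull-back of a section under fibrewise isomorphisms covering `f`. -/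
def pullbackSection (φ : ∀ x, L x ≃ₗ[ℂ] L' (f x)) (t : Π y, L' y) : Π x, L x :=
  fun x => (φ x).symm (t (f x))

variable (φ : ∀ x, L x ≃ₗ[ℂ] L' (f x))

/-- The matrix (a complex number) of a bundle map in local trivializations. -/
def fiberRatio (x₀ x : M) : ℂ := coord L' (f x₀) (f x) (φ x (frame L x₀ x))

variable {φ}
  (hφ : ContMDiff (𝓘(ℝ, E).prod 𝓘(ℝ, ℂ)) (𝓘(ℝ, E).prod 𝓘(ℝ, ℂ)) ∞
    (fun p : TotalSpace ℂ L => (⟨f p.1, φ p.1 p.2⟩ : TotalSpace ℂ L')))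

include hφ in
-- Evaluate the smooth map of total spaces along the local frame, and read base and fibre components
-- separately.
lemma contMDiffAt_fiberRatio (x₀ : M) :
    ContMDiffAt 𝓘(ℝ, E) 𝓘(ℝ, E) ∞ f x₀ ∧
    ContMDiffAt 𝓘(ℝ, E) 𝓘(ℝ, ℂ) ∞ (fiberRatio φ x₀) x₀ := by
  have h1 := hφ.contMDiffAt.comp x₀
    ((contMDiffOn_frame (E := E) (L := L) x₀).contMDiffAt (baseSet_mem_nhds (L := L) x₀))
  have h2 := contMDiffAt_totalSpace.1 h1
  refine ⟨h2.1, h2.2.congr_of_eventuallyEq ?_⟩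
  filter_upwards [h2.1.continuousAt.preimage_mem_nhds (baseSet_mem_nhds (L := L') (f x₀))] with y hy
  exact coord_eq hy _

variable (φ) in
lemma fiberRatio_ne_zero (x₀ : M) : fiberRatio φ x₀ x₀ ≠ 0 := by
  intro h
  rw [fiberRatio, coord_eq_zero_iff (FiberBundle.mem_baseSet_trivializationAt' (f x₀)),
    LinearEquiv.map_eq_zero_iff] at h
  exact frame_ne_zero (FiberBundle.mem_baseSet_trivializationAt' x₀) h

lemma coord_apply {x₀ x : M} (hx : x ∈ (trivializationAt ℂ L x₀).baseSet) (v : L x) :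
    coord L' (f x₀) (f x) (φ x v) = coord L x₀ x v * fiberRatio φ x₀ x := by
  conv_lhs => rw [← coord_smul_frame hx v, map_smul, map_smul]
  rfl

include hφ in
lemma coord_pullbackSection_eventuallyEq (t : Π y, L' y) (x₀ : M) :
    (fun x => coord L x₀ x (pullbackSection φ t x)) =ᶠ[𝓝 x₀]
      fun x => coord L' (f x₀) (f x) (t (f x)) * (fiberRatio φ x₀ x)⁻¹ := by
  filter_upwards [baseSet_mem_nhds (L := L) x₀,
    (contMDiffAt_fiberRatio hφ x₀).2.continuousAt.eventually_ne (fiberRatio_ne_zero φ x₀)]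
    with x hx hne
  have h := coord_apply (φ := φ) hx (pullbackSection φ t x)
  rw [pullbackSection, LinearEquiv.apply_symm_apply] at h
  rw [h, mul_inv_cancel_right₀ hne]
  rfl

include hφ in
lemma mdifferentiableAt_pullbackSection {t : Π y, L' y} {x : M}
    (ht : MDifferentiableAt 𝓘(ℝ, E) (𝓘(ℝ, E).prod 𝓘(ℝ, ℂ))
      (fun y => TotalSpace.mk' ℂ y (t y)) (f x)) :
    MDifferentiableAt 𝓘(ℝ, E) (𝓘(ℝ, E).prod 𝓘(ℝ, ℂ))
      (fun y => TotalSpace.mk' ℂ y (pullbackSection φ t y)) x := by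
  have hh := contMDiffAt_fiberRatio hφ x
  rw [mdifferentiableAt_iff_coord] at ht ⊢
  refine MDifferentiableAt.congr_of_eventuallyEq ?_ (coord_pullbackSection_eventuallyEq hφ t x)
  exact mdifferentiableAt_mul_complex (ht.comp x (hh.1.mdifferentiableAt (by simp)))
    ((contMDiffAt_inv_complex hh.2 (fiberRatio_ne_zero φ x)).mdifferentiableAt (by simp))

include hφ in
lemma contMDiffAt_pullbackSection {t : Π y, L' y} {x : M} {n : ℕ∞ω} (hn : n ≤ ∞)
    (ht : ContMDiffAt 𝓘(ℝ, E) (𝓘(ℝ, E).prod 𝓘(ℝ, ℂ)) n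
      (fun y => TotalSpace.mk' ℂ y (t y)) (f x)) :
    ContMDiffAt 𝓘(ℝ, E) (𝓘(ℝ, E).prod 𝓘(ℝ, ℂ)) n
      (fun y => TotalSpace.mk' ℂ y (pullbackSection φ t y)) x := by
  have hh := contMDiffAt_fiberRatio hφ x
  rw [contMDiffAt_iff_coord _ _ _ (FiberBundle.mem_baseSet_trivializationAt' _) hn] at ht ⊢
  refine ContMDiffAt.congr_of_eventuallyEq ?_ (coord_pullbackSection_eventuallyEq hφ t x)
  exact contMDiffAt_mul_complex (ht.comp x (hh.1.of_le hn))
    ((contMDiffAt_inv_complex hh.2 (fiberRatio_ne_zero φ x)).of_le hn)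

end PullbackOfSections

/-! ### Maps of line bundles with connection; naturality of the induced connection -/

section ConnectionMap

variable {E : Type w} [NormedAddCommGroup E] [NormedSpace ℝ E]

/-- A local isometry between the base manifolds, covered by a smooth fibrewise isomorphism of line
bundles that pulls the connection back to the connection. -/
structure ConnectionMap (X Y : LineBundleWithConnection.{u, v, w} E) where
  /-- the map of base manifolds -/
  base : X.M → Y.M
  /-- the isomorphisms of fibres -/
  onFiber (x : X.M) : X.L x ≃ₗ[ℂ] Y.L (base x)
  localDiffeo : IsLocalDiffeomorph 𝓘(ℝ, E) 𝓘(ℝ, E) ∞ base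
  total_smooth : ContMDiff (𝓘(ℝ, E).prod 𝓘(ℝ, ℂ)) (𝓘(ℝ, E).prod 𝓘(ℝ, ℂ)) ∞
    (fun p : TotalSpace ℂ X.L => (⟨base p.1, onFiber p.1 p.2⟩ : TotalSpace ℂ Y.L))
  isometry : ∀ (x : X.M) (u v : TangentSpace 𝓘(ℝ, E) x),
    inner ℝ (mfderiv 𝓘(ℝ, E) 𝓘(ℝ, E) base x u) (mfderiv 𝓘(ℝ, E) 𝓘(ℝ, E) base x v) = inner ℝ u v
  conn_eq : ∀ (t : Π y, Y.L y) (x : X.M) (u : TangentSpace 𝓘(ℝ, E) x),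
    MDifferentiableAt 𝓘(ℝ, E) (𝓘(ℝ, E).prod 𝓘(ℝ, ℂ))
      (fun y => TotalSpace.mk' ℂ y (pullbackSection onFiber t y)) x →
    Y.conn t (base x) (mfderiv 𝓘(ℝ, E) 𝓘(ℝ, E) base x u)
      = onFiber x (X.conn (pullbackSection onFiber t) x u)

namespace ConnectionMap

variable {X Y : LineBundleWithConnection.{u, v, w} E} (F : ConnectionMap X Y) {k : ℕ}

/-- The isomorphism of the fibres of the tensor powers induced by a map of line bundles. -/
def onTensor (k : ℕ) (x : X.M) : (⨂[ℂ]^k (X.L x)) ≃ₗ[ℂ] (⨂[ℂ]^k (Y.L (F.base x))) :=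
  PiTensorProduct.congr (fun _ => F.onFiber x)

lemma onTensor_tprod (x : X.M) (v : Fin k → X.L x) :
    F.onTensor k x (PiTensorProduct.tprod ℂ v) = PiTensorProduct.tprod ℂ (fun j => F.onFiber x (v j)) :=
  PiTensorProduct.congr_tprod _ _

lemma onTensor_symm_tprod (x : X.M) (v : Fin k → Y.L (F.base x)) :
    (F.onTensor k x).symm (PiTensorProduct.tprod ℂ v)
      = PiTensorProduct.tprod ℂ (fun j => (F.onFiber x).symm (v j)) :=
  PiTensorProduct.congr_symm_tprod _ _

/-- The pull-back of sections of the tensor powers. -/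
def pullback (k : ℕ) : TensorSection Y.L k →ₗ[ℂ] TensorSection X.L k where
  toFun σ x := (F.onTensor k x).symm (σ (F.base x))
  map_add' σ τ := by ext x; simp
  map_smul' c σ := by ext x; simp

lemma pullback_apply (σ : TensorSection Y.L k) (x : X.M) :
    F.pullback k σ x = (F.onTensor k x).symm (σ (F.base x)) := rfl

lemma mdifferentiableAt_base (x : X.M) : MDifferentiableAt 𝓘(ℝ, E) 𝓘(ℝ, E) F.base x :=
  (F.localDiffeo x).mdifferentiableAt (by simp)

/-- On a decomposable tensor each of the k factors contributes one `fiberRatio`. -/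
lemma tensorCoord_pullback_eventuallyEq (σ : TensorSection Y.L k) (x₀ : X.M) :
    (fun x => tensorCoord Y.L k (F.base x₀) (F.base x) (σ (F.base x))) =ᶠ[𝓝 x₀]
      fun x => tensorCoord X.L k x₀ x (F.pullback k σ x) * fiberRatio F.onFiber x₀ x ^ k := by
  filter_upwards [baseSet_mem_nhds (L := X.L) x₀] with x hx
  have h : σ (F.base x) = F.onTensor k x (F.pullback k σ x) := by simp [pullback_apply]
  rw [h]
  generalize F.pullback k σ x = t
  induction t using PiTensorProduct.induction_on with
  | smul_tprod r v =>
    rw [map_smul, onTensor_tprod, map_smul, map_smul,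
      LineBundleWithConnection.tensorCoord_tprod, LineBundleWithConnection.tensorCoord_tprod]
    simp only [coord_apply hx, Finset.prod_mul_distrib, Finset.prod_const, Finset.card_univ,
      Fintype.card_fin, smul_eq_mul, mul_assoc]
  | add a b ha hb => rw [map_add, map_add, ha, hb, map_add, add_mul]

/-- A section is smooth if its pull-back is. -/
lemma contMDiffAt_of_pullback {σ : TensorSection Y.L k}
    (hσ : IsSmoothTensorSection (E := E) (F.pullback k σ)) (x : X.M) :
    ContMDiffAt 𝓘(ℝ, E) 𝓘(ℝ, ℂ) ∞ (fun z => tensorCoord Y.L k (F.base x) z (σ z)) (F.base x) := by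
  have hh := contMDiffAt_fiberRatio F.total_smooth x
  have h1 : ContMDiffAt 𝓘(ℝ, E) 𝓘(ℝ, ℂ) ∞
      (fun x' => tensorCoord Y.L k (F.base x) (F.base x') (σ (F.base x'))) x :=
    (contMDiffAt_mul_complex (hσ x) (contMDiffAt_pow_complex hh.2 k)).congr_of_eventuallyEq
      (F.tensorCoord_pullback_eventuallyEq σ x)
  have hd := F.localDiffeo x
  -- Smoothness along the base map is turned into smoothness on the target by composing with a local
  -- inverse, for which x must first be written as the value of that inverse.
  have hinv : hd.localInverse (F.base x) = x := hd.localInverse_left_inv hd.localInverse_mem_target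
  rw [← hinv] at h1
  refine (h1.comp (F.base x) hd.localInverse_contMDiffAt).congr_of_eventuallyEq ?_
  filter_upwards [hd.localInverse_eventuallyEq_right] with z hz
  simp only [Function.comp_apply, id_eq] at hz ⊢
  rw [hinv, hz]

lemma isSmooth_pullback {σ : TensorSection Y.L k} (hσ : IsSmoothTensorSection (E := E) σ) :
    IsSmoothTensorSection (E := E) (F.pullback k σ) := by
  intro x
  have hh := contMDiffAt_fiberRatio F.total_smooth x
  refine (contMDiffAt_mul_complex ((hσ (F.base x)).comp x hh.1)
    (contMDiffAt_inv_complex (contMDiffAt_pow_complex hh.2 k)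
      (pow_ne_zero k (fiberRatio_ne_zero F.onFiber x)))).congr_of_eventuallyEq ?_
  filter_upwards [F.tensorCoord_pullback_eventuallyEq σ x,
    hh.2.continuousAt.eventually_ne (fiberRatio_ne_zero F.onFiber x)] with y hy hne
  simp only [Function.comp_apply]
  rw [hy, mul_inv_cancel_right₀ (pow_ne_zero k hne)]

lemma isSmooth_of_pullback (hF : Function.Surjective F.base) {σ : TensorSection Y.L k}
    (hσ : IsSmoothTensorSection (E := E) (F.pullback k σ)) : IsSmoothTensorSection (E := E) σ := by
  intro y
  obtain ⟨x, rfl⟩ := hF y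
  exact F.contMDiffAt_of_pullback hσ x

/-- Naturality of the induced connection on the tensor powers. -/
lemma tensorConnection_pullback {σ : TensorSection Y.L k} {x : X.M}
    (hσ : LineBundleWithConnection.TensorDifferentiableAt σ (F.base x))
    (u : TangentSpace 𝓘(ℝ, E) x) :
    tensorConnection X.conn (F.pullback k σ) x u
      = (F.onTensor k x).symm
          (tensorConnection Y.conn σ (F.base x) (mfderiv 𝓘(ℝ, E) 𝓘(ℝ, E) F.base x u)) := by
  set e := frame Y.L (F.base x) with he
  have hx := FiberBundle.mem_baseSet_trivializationAt' (F := ℂ) (E := Y.L) (F.base x)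
  have hed : MDifferentiableAt 𝓘(ℝ, E) (𝓘(ℝ, E).prod 𝓘(ℝ, ℂ))
      (fun y => TotalSpace.mk' ℂ y (e y)) (F.base x) := mdifferentiableAt_frame (F.base x)
  have hex : e (F.base x) ≠ 0 := frame_ne_zero hx
  have hpd := mdifferentiableAt_pullbackSection F.total_smooth hed
  obtain ⟨a, ha⟩ := exists_smul_eq hex
    (Y.conn e (F.base x) (mfderiv 𝓘(ℝ, E) 𝓘(ℝ, E) F.base x u))
  -- The pulled-back frame has the same connection coefficient a as e. With coefficient functions c
  -- and c ∘ base, the two sides are then the same formula of `tensorConnection_eq`.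
  have ha' : X.conn (pullbackSection F.onFiber e) x u = a • pullbackSection F.onFiber e x := by
    have := F.conn_eq e x u hpd
    rw [ha] at this
    rw [← (F.onFiber x).symm_apply_apply (X.conn _ x u), ← this, map_smul]
    rfl
  have hev := LineBundleWithConnection.eventually_eq_tensorCoord_smul σ (F.base x)
  have hpe : pullbackSection F.onFiber e x ≠ 0 := by
    rw [pullbackSection]
    exact (LinearEquiv.map_ne_zero_iff _).2 hex
  rw [LineBundleWithConnection.tensorConnection_eq hed hσ hev hex _ ha,
    LineBundleWithConnection.tensorConnection_eq hpd (hσ.comp x (F.mdifferentiableAt_base x)) ?_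
      hpe u ha', map_smul, onTensor_symm_tprod]
  · congr 2
    have h := congrArg (fun B => B u) (mfderiv_comp x hσ (F.mdifferentiableAt_base x))
    exact h
  · filter_upwards [(F.localDiffeo x).contMDiffAt.continuousAt.eventually hev] with y hy
    rw [pullback_apply, hy, map_smul, onTensor_symm_tprod]
    rfl

end ConnectionMap

end ConnectionMap

/-! ### Naturality of the Levi-Civita and second covariant derivatives -/

section Naturality

variable {E : Type w} [NormedAddCommGroup E] [NormedSpace ℝ E]
  {X Y : LineBundleWithConnection.{u, v, w} E} (F : ConnectionMap X Y) {k : ℕ}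

namespace ConnectionMap

/-- The differential of the map of base manifolds, as a linear isometry. -/
def differential (x : X.M) :
    TangentSpace 𝓘(ℝ, E) x ≃ₗᵢ[ℝ] TangentSpace 𝓘(ℝ, E) (F.base x) :=
  LinearEquiv.isometryOfInner
    ((F.localDiffeo x).mfderivToContinuousLinearEquiv (by simp)).toLinearEquiv
    (fun u v => F.isometry x u v)

lemma differential_apply (x : X.M) (u : TangentSpace 𝓘(ℝ, E) x) :
    F.differential x u = mfderiv 𝓘(ℝ, E) 𝓘(ℝ, E) F.base x u := rfl

lemma isInvertible_mfderiv (x : X.M) : (mfderiv 𝓘(ℝ, E) 𝓘(ℝ, E) F.base x).IsInvertible :=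
  ⟨(F.localDiffeo x).mfderivToContinuousLinearEquiv (by simp),
    IsLocalDiffeomorphAt.mfderivToContinuousLinearEquiv_coe _ _⟩

/-- The pull-back of vector fields. -/
def pullbackField (V : Π y : Y.M, TangentSpace 𝓘(ℝ, E) y) : Π x : X.M, TangentSpace 𝓘(ℝ, E) x :=
  VectorField.mpullback 𝓘(ℝ, E) 𝓘(ℝ, E) F.base V

lemma differential_pullbackField (V : Π y : Y.M, TangentSpace 𝓘(ℝ, E) y) (x : X.M) :
    mfderiv 𝓘(ℝ, E) 𝓘(ℝ, E) F.base x (F.pullbackField V x) = V (F.base x) :=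
  (F.isInvertible_mfderiv x).self_apply_inverse _

lemma inner_pullbackField (V W : Π y : Y.M, TangentSpace 𝓘(ℝ, E) y) (x : X.M) :
    inner ℝ (F.pullbackField V x) (F.pullbackField W x)
      = inner ℝ (V (F.base x)) (W (F.base x)) := by
  rw [← F.isometry, differential_pullbackField, differential_pullbackField]

variable {V W Z : Π y : Y.M, TangentSpace 𝓘(ℝ, E) y} {x : X.M}

lemma mvfderiv_inner_pullbackField (hV : VectorFieldDifferentiableAt V (F.base x))
    (hW : VectorFieldDifferentiableAt W (F.base x)) (u : TangentSpace 𝓘(ℝ, E) x) :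
    mvfderiv 𝓘(ℝ, E) (fun y => inner ℝ (F.pullbackField V y) (F.pullbackField W y)) x u
      = mvfderiv 𝓘(ℝ, E) (fun y => inner ℝ (V y) (W y)) (F.base x)
          (mfderiv 𝓘(ℝ, E) 𝓘(ℝ, E) F.base x u) := by
  simp only [inner_pullbackField]
  have h := congrArg (fun B => B u)
    (mfderiv_comp x (mdifferentiableAt_inner hV hW) (F.mdifferentiableAt_base x))
  exact h

variable [FiniteDimensional ℝ E]

lemma vectorFieldDifferentiableAt_pullbackField (hV : VectorFieldDifferentiableAt V (F.base x)) :
    VectorFieldDifferentiableAt (F.pullbackField V) x :=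
  have : CompleteSpace E := FiniteDimensional.complete ℝ E
  MDifferentiableAt.mpullback_vectorField hV (F.localDiffeo x).contMDiffAt
    (F.isInvertible_mfderiv x) (by norm_cast)

lemma differential_mlieBracket (hV : VectorFieldDifferentiableAt V (F.base x))
    (hW : VectorFieldDifferentiableAt W (F.base x)) :
    VectorField.mlieBracket 𝓘(ℝ, E) (F.pullbackField V) (F.pullbackField W) x
      = F.pullbackField (VectorField.mlieBracket 𝓘(ℝ, E) V W) x :=
  have : CompleteSpace E := FiniteDimensional.complete ℝ E
  have : IsManifold 𝓘(ℝ, E) (minSmoothness ℝ 3) X.M := by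
    rw [minSmoothness_of_isRCLikeNormedField]
    exact IsManifold.of_le (n := ∞) (by norm_cast)
  have : IsManifold 𝓘(ℝ, E) (minSmoothness ℝ 3) Y.M := by
    rw [minSmoothness_of_isRCLikeNormedField]
    exact IsManifold.of_le (n := ∞) (by norm_cast)
  (VectorField.mpullback_mlieBracket hV hW (F.localDiffeo x).contMDiffAt
    (by rw [minSmoothness_of_isRCLikeNormedField]; norm_cast)).symm

/-- Every ingredient is natural: inner products because the base map is a local isometry, their
derivatives by the chain rule, brackets because the base map is a local diffeomorphism. -/
lemma koszul_pullbackField (hV : VectorFieldDifferentiableAt V (F.base x))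
    (hW : VectorFieldDifferentiableAt W (F.base x)) (hZ : VectorFieldDifferentiableAt Z (F.base x)) :
    koszul (F.pullbackField V) (F.pullbackField W) (F.pullbackField Z) x
      = koszul V W Z (F.base x) := by
  simp only [koszul]
  rw [F.mvfderiv_inner_pullbackField hW hZ, F.mvfderiv_inner_pullbackField hV hZ,
    F.mvfderiv_inner_pullbackField hV hW, F.differential_mlieBracket hV hW,
    F.differential_mlieBracket hV hZ, F.differential_mlieBracket hW hZ]
  simp only [differential_pullbackField, inner_pullbackField]

/-- A local isometry preserves the Levi-Civita connection. -/
lemma differential_leviCivita (hV : VectorFieldDifferentiableAt V (F.base x))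
    (hW : VectorFieldDifferentiableAt W (F.base x)) :
    mfderiv 𝓘(ℝ, E) 𝓘(ℝ, E) F.base x (leviCivita (F.pullbackField V) (F.pullbackField W) x)
      = leviCivita V W (F.base x) := by
  refine IsLeviCivitaAt.eq (V := V) (W := W) (fun Z hZ => ?_) (isLeviCivitaAt_leviCivita hV hW)
  rw [← F.koszul_pullbackField hV hW hZ, ← F.differential_pullbackField Z, F.isometry]
  exact isLeviCivitaAt_leviCivita (F.vectorFieldDifferentiableAt_pullbackField hV)
    (F.vectorFieldDifferentiableAt_pullbackField hW) _
    (F.vectorFieldDifferentiableAt_pullbackField hZ)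

open LineBundleWithConnection in
lemma hessian_pullback {σ : TensorSection Y.L k} (hσ : IsSmoothTensorSection (E := E) σ)
    (hV : VectorFieldDifferentiableAt V (F.base x))
    (hW : VectorFieldDifferentiableAt W (F.base x)) :
    hessian (F.pullback k σ) x (F.pullbackField V) (F.pullbackField W)
      = (F.onTensor k x).symm (hessian σ (F.base x) V W) := by
  have h : (fun y => tensorConnection X.conn (F.pullback k σ) y (F.pullbackField W y))
      = F.pullback k (fun z => tensorConnection Y.conn σ z (W z)) := by
    funext y
    rw [F.tensorConnection_pullback (hσ.tensorDifferentiableAt _), differential_pullbackField]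
    rfl
  unfold hessian
  rw [h, F.tensorConnection_pullback (tensorDifferentiableAt_tensorConnection hσ hW),
    F.tensorConnection_pullback (hσ.tensorDifferentiableAt _), differential_pullbackField,
    F.differential_leviCivita hV hW, map_sub]

/-- The extensions in the definition on X and on Y are unrelated. Vectors are extended on Y and the
extensions pulled back to X; independence of the extension on both sides then reduces the claim to
`hessian_pullback`. -/
lemma secondCovariantDerivative_pullback {σ : TensorSection Y.L k}
    (hσ : IsSmoothTensorSection (E := E) σ) (x : X.M) (u v : TangentSpace 𝓘(ℝ, E) x) :
    secondCovariantDerivative X.conn (F.pullback k σ) x u v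
      = (F.onTensor k x).symm (secondCovariantDerivative Y.conn σ (F.base x)
          (F.differential x u) (F.differential x v)) := by
  have key : ∀ u' : TangentSpace 𝓘(ℝ, E) x, ∃ V : Π y : Y.M, TangentSpace 𝓘(ℝ, E) y,
      VectorFieldDifferentiableAt V (F.base x) ∧ V (F.base x) = F.differential x u' ∧
      F.pullbackField V x = u' := by
    intro u'
    refine ⟨FiberBundle.extend E (F.differential x u'),
      vectorFieldDifferentiableAt_extend _, FiberBundle.extend_apply_self E _, ?_⟩
    apply (F.differential x).injective
    rw [differential_apply, differential_pullbackField, FiberBundle.extend_apply_self]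
  obtain ⟨V, hV, hVx, hVu⟩ := key u
  obtain ⟨W, hW, hWx, hWv⟩ := key v
  rw [← hVx, ← hWx, LineBundleWithConnection.secondCovariantDerivative_eq_hessian hσ hV hW,
    ← F.hessian_pullback hσ hV hW,
    ← LineBundleWithConnection.secondCovariantDerivative_eq_hessian (F.isSmooth_pullback hσ)
      (F.vectorFieldDifferentiableAt_pullbackField hV)
      (F.vectorFieldDifferentiableAt_pullbackField hW), hVu, hWv]

end ConnectionMap

end Naturality

/-! ### Naturality of the bundle Laplacian; eigenspaces -/

section Laplacian

variable {E : Type w} [NormedAddCommGroup E] [NormedSpace ℝ E] [FiniteDimensional ℝ E]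
  {X Y : LineBundleWithConnection.{u, v, w} E} {k : ℕ}

/-- The trace of a bilinear map may be computed in any orthonormal basis. -/
lemma sum_orthonormalBasis_eq {V : Type*} [NormedAddCommGroup V] [InnerProductSpace ℝ V]
    [FiniteDimensional ℝ V] {N : Type*} [AddCommGroup N] [Module ℝ N] (B : V →ₗ[ℝ] V →ₗ[ℝ] N)
    {ι κ : Type*} [Fintype ι] [Fintype κ] (b : OrthonormalBasis ι ℝ V)
    (c : OrthonormalBasis κ ℝ V) : ∑ i, B (b i) (b i) = ∑ j, B (c j) (c j) := by
  have h := (InnerProductSpace.canonicalCovariantTensor_eq_sum V b).symm.trans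
    (InnerProductSpace.canonicalCovariantTensor_eq_sum V c)
  simpa using congrArg (TensorProduct.lift B) h

namespace LineBundleWithConnection

/-- The second covariant derivative as a bilinear map. -/
def secondCovariantDerivativeBilin {σ : TensorSection X.L k}
    (hσ : IsSmoothTensorSection (E := E) σ) (x : X.M) :
    TangentSpace 𝓘(ℝ, E) x →ₗ[ℝ] TangentSpace 𝓘(ℝ, E) x →ₗ[ℝ] ⨂[ℂ]^k (X.L x) :=
  have ex (u : TangentSpace 𝓘(ℝ, E) x) : ∃ V : Π y : X.M, TangentSpace 𝓘(ℝ, E) y,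
      VectorFieldDifferentiableAt V x ∧ V x = u :=
    ⟨_, vectorFieldDifferentiableAt_extend u, FiberBundle.extend_apply_self E u⟩
  LinearMap.mk₂ ℝ (secondCovariantDerivative X.conn σ x)
    (fun u u' v => by
      obtain ⟨V, hV, rfl⟩ := ex u
      obtain ⟨V', hV', rfl⟩ := ex u'
      obtain ⟨W, hW, rfl⟩ := ex v
      rw [← Pi.add_apply, secondCovariantDerivative_eq_hessian hσ hV hW,
        secondCovariantDerivative_eq_hessian hσ hV' hW,
        secondCovariantDerivative_eq_hessian hσ (mdifferentiableAt_add_section hV hV') hW]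
      exact (hessian_tensorialAt_left hW).add hV hV')
    (fun r u v => by
      obtain ⟨V, hV, rfl⟩ := ex u
      obtain ⟨W, hW, rfl⟩ := ex v
      have h := (hessian_tensorialAt_left (σ := σ) hW).smul
        (mdifferentiableAt_const (c := r)) hV
      have h2 := secondCovariantDerivative_eq_hessian hσ
        (MDifferentiableAt.smul_section (mdifferentiableAt_const (c := r)) hV) hW
      rw [secondCovariantDerivative_eq_hessian hσ hV hW, ← h, ← h2]
      rfl)
    (fun u v v' => by
      obtain ⟨V, hV, rfl⟩ := ex u
      obtain ⟨W, hW, rfl⟩ := ex v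
      obtain ⟨W', hW', rfl⟩ := ex v'
      rw [← Pi.add_apply, secondCovariantDerivative_eq_hessian hσ hV hW,
        secondCovariantDerivative_eq_hessian hσ hV hW',
        secondCovariantDerivative_eq_hessian hσ hV (mdifferentiableAt_add_section hW hW')]
      exact (hessian_tensorialAt_right hσ hV).add hW hW')
    (fun r u v => by
      obtain ⟨V, hV, rfl⟩ := ex u
      obtain ⟨W, hW, rfl⟩ := ex v
      have h := (hessian_tensorialAt_right hσ hV).smul
        (mdifferentiableAt_const (c := r)) hW
      have h2 := secondCovariantDerivative_eq_hessian hσ hV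
        (MDifferentiableAt.smul_section (mdifferentiableAt_const (c := r)) hW)
      rw [secondCovariantDerivative_eq_hessian hσ hV hW, ← h, ← h2]
      rfl)

/-- The standard orthonormal basis at x need not be carried to the standard one at the image point,
so freedom in the basis is what makes the trace natural. -/
lemma bundleLaplacian_eq_sum {σ : TensorSection X.L k} (hσ : IsSmoothTensorSection (E := E) σ)
    (x : X.M) {ι : Type*} [Fintype ι] (b : OrthonormalBasis ι ℝ (TangentSpace 𝓘(ℝ, E) x)) :
    bundleLaplacian X.conn σ x = - ∑ i, secondCovariantDerivative X.conn σ x (b i) (b i) :=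
  congrArg Neg.neg (sum_orthonormalBasis_eq (secondCovariantDerivativeBilin hσ x) _ b)

lemma secondCovariantDerivative_add {σ τ : TensorSection X.L k}
    (hσ : IsSmoothTensorSection (E := E) σ) (hτ : IsSmoothTensorSection (E := E) τ) (x : X.M)
    (u v : TangentSpace 𝓘(ℝ, E) x) :
    secondCovariantDerivative X.conn (σ + τ) x u v
      = secondCovariantDerivative X.conn σ x u v + secondCovariantDerivative X.conn τ x u v := by
  unfold secondCovariantDerivative
  have h (y : X.M) (w : TangentSpace 𝓘(ℝ, E) y) : tensorConnection X.conn (σ + τ) y w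
      = tensorConnection X.conn σ y w + tensorConnection X.conn τ y w :=
    tensorConnection_add (hσ.tensorDifferentiableAt y) (hτ.tensorDifferentiableAt y) w
  simp only [h]
  rw [tensorConnection_add
    (tensorDifferentiableAt_tensorConnection hσ (vectorFieldDifferentiableAt_extend v))
    (tensorDifferentiableAt_tensorConnection hτ (vectorFieldDifferentiableAt_extend v))]
  abel

lemma secondCovariantDerivative_smul {σ : TensorSection X.L k}
    (hσ : IsSmoothTensorSection (E := E) σ) (c : ℂ) (x : X.M)
    (u v : TangentSpace 𝓘(ℝ, E) x) :
    secondCovariantDerivative X.conn (c • σ) x u v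
      = c • secondCovariantDerivative X.conn σ x u v := by
  unfold secondCovariantDerivative
  have h {τ : TensorSection X.L k} {y : X.M} (hτ : TensorDifferentiableAt τ y)
      (w : TangentSpace 𝓘(ℝ, E) y) : tensorConnection X.conn (fun z => c • τ z) y w
      = c • tensorConnection X.conn τ y w := by
    rw [tensorConnection_smul mdifferentiableAt_const hτ, mvfderiv_const]
    simp
  have h' (y : X.M) (w : TangentSpace 𝓘(ℝ, E) y) : tensorConnection X.conn (c • σ) y w
      = c • tensorConnection X.conn σ y w := h (hσ.tensorDifferentiableAt y) w
  simp only [h']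
  rw [h (tensorDifferentiableAt_tensorConnection hσ (vectorFieldDifferentiableAt_extend v)),
    smul_sub]

lemma schrodinger_add (Q : X.M → ℝ) {σ τ : TensorSection X.L k}
    (hσ : IsSmoothTensorSection (E := E) σ) (hτ : IsSmoothTensorSection (E := E) τ) :
    schrodinger X.conn Q (σ + τ) = schrodinger X.conn Q σ + schrodinger X.conn Q τ := by
  funext x
  simp only [schrodinger, bundleLaplacian, Pi.add_apply, secondCovariantDerivative_add hσ hτ,
    Finset.sum_add_distrib, smul_add]
  abel

lemma schrodinger_smul (Q : X.M → ℝ) (c : ℂ) {σ : TensorSection X.L k}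
    (hσ : IsSmoothTensorSection (E := E) σ) :
    schrodinger X.conn Q (c • σ) = c • schrodinger X.conn Q σ := by
  funext x
  simp only [schrodinger, bundleLaplacian, Pi.smul_apply, secondCovariantDerivative_smul hσ,
    ← Finset.smul_sum, smul_add, smul_neg]
  rw [smul_comm c]

lemma schrodinger_zero_potential :
    schrodinger (k := k) X.conn (fun _ => 0) = bundleLaplacian X.conn := by
  funext σ x
  simp [schrodinger]

lemma isSmooth_add {σ τ : TensorSection X.L k}
    (hσ : IsSmoothTensorSection (E := E) σ) (hτ : IsSmoothTensorSection (E := E) τ) :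
    IsSmoothTensorSection (E := E) (σ + τ) := fun x => by
  simp only [Pi.add_apply, map_add]
  exact (hσ x).add (hτ x)

lemma isSmooth_smul (c : ℂ) {σ : TensorSection X.L k}
    (hσ : IsSmoothTensorSection (E := E) σ) : IsSmoothTensorSection (E := E) (c • σ) := fun x => by
  simp only [Pi.smul_apply, map_smul, smul_eq_mul]
  exact contMDiffAt_mul_complex contMDiffAt_const (hσ x)

variable (X) in
lemma isSmooth_zero : IsSmoothTensorSection (E := E) (0 : TensorSection X.L k) := fun x => by
  simp only [Pi.zero_apply, map_zero]
  exact contMDiffAt_const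

/-- The eigenspace of the Schrödinger operator on smooth sections of `L^{⊗k}`. -/
def eigenspace (X : LineBundleWithConnection.{u, v, w} E) (Q : X.M → ℝ) (k : ℕ) (μ : ℂ) :
    Submodule ℂ (TensorSection X.L k) where
  carrier := {σ | IsSmoothTensorSection (E := E) σ ∧ schrodinger X.conn Q σ = μ • σ}
  add_mem' {σ τ} hσ hτ := ⟨isSmooth_add hσ.1 hτ.1, by
    rw [schrodinger_add Q hσ.1 hτ.1, hσ.2, hτ.2, smul_add]⟩
  zero_mem' := ⟨X.isSmooth_zero, by
    have h := schrodinger_smul Q 0 (X.isSmooth_zero (k := k))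
    rwa [zero_smul, zero_smul, ← smul_zero μ] at h⟩
  smul_mem' c σ hσ := ⟨isSmooth_smul c hσ.1, by
    rw [schrodinger_smul Q c hσ.1, hσ.2, smul_comm]⟩

lemma specPotential_eq_rank (X : LineBundleWithConnection.{u, v, w} E) (Q : X.M → ℝ) (k : ℕ)
    (μ : ℂ) : X.specPotential Q k μ = Module.rank ℂ (X.eigenspace Q k μ) := by
  have h : Submodule.span ℂ {σ : TensorSection X.L k | IsSmoothTensorSection (E := E) σ ∧
      schrodinger X.conn Q σ = μ • σ} = X.eigenspace Q k μ := Submodule.span_eq (X.eigenspace Q k μ)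
  rw [specPotential, spectrumMult, h]

lemma spec_eq_specPotential (X : LineBundleWithConnection.{u, v, w} E) (k : ℕ) :
    X.spec k = X.specPotential (fun _ => 0) k := by
  rw [spec, specPotential, schrodinger_zero_potential]

end LineBundleWithConnection

namespace ConnectionMap

variable (F : ConnectionMap X Y)

/-- Naturality of the bundle Laplacian. -/
lemma bundleLaplacian_pullback {σ : TensorSection Y.L k} (hσ : IsSmoothTensorSection (E := E) σ) :
    bundleLaplacian X.conn (F.pullback k σ) = F.pullback k (bundleLaplacian Y.conn σ) := by
  funext x
  rw [pullback_apply, LineBundleWithConnection.bundleLaplacian_eq_sum hσ (F.base x)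
    ((stdOrthonormalBasis ℝ (TangentSpace 𝓘(ℝ, E) x)).map (F.differential x)), map_neg, map_sum,
    bundleLaplacian]
  simp only [OrthonormalBasis.map_apply, F.secondCovariantDerivative_pullback hσ]

lemma schrodinger_pullback (Q : Y.M → ℝ) {σ : TensorSection Y.L k}
    (hσ : IsSmoothTensorSection (E := E) σ) :
    schrodinger X.conn (fun x => Q (F.base x)) (F.pullback k σ)
      = F.pullback k (schrodinger Y.conn Q σ) := by
  funext x
  simp only [schrodinger, F.bundleLaplacian_pullback hσ, pullback_apply, map_add, map_smul]

lemma pullback_mem_eigenspace {Q : Y.M → ℝ} {μ : ℂ} {σ : TensorSection Y.L k}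
    (hσ : σ ∈ Y.eigenspace Q k μ) :
    F.pullback k σ ∈ X.eigenspace (fun x => Q (F.base x)) k μ :=
  ⟨F.isSmooth_pullback hσ.1, by rw [F.schrodinger_pullback Q hσ.1, hσ.2, map_smul]⟩

lemma pullback_injective (hF : Function.Surjective F.base) :
    Function.Injective (F.pullback k) := by
  intro σ τ h
  funext y
  obtain ⟨x, rfl⟩ := hF y
  exact (F.onTensor k x).symm.injective (congrFun h x)

/-- Smoothness descends along a surjective local diffeomorphism. The eigenvalue equation may then be
checked after pull-back, which is injective and intertwines the operators. -/
lemma mem_eigenspace_of_pullback (hF : Function.Surjective F.base) {Q : Y.M → ℝ} {μ : ℂ}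
    {σ : TensorSection Y.L k}
    (hσ : F.pullback k σ ∈ X.eigenspace (fun x => Q (F.base x)) k μ) : σ ∈ Y.eigenspace Q k μ := by
  have hs := F.isSmooth_of_pullback hF hσ.1
  refine ⟨hs, F.pullback_injective hF ?_⟩
  rw [← F.schrodinger_pullback Q hs, hσ.2, map_smul]

end ConnectionMap

end Laplacian

/-! ### Functoriality of the pull-back -/

section Functoriality

/-- The vectors fixed by a subgroup. -/
def subgroupInvariants {G V : Type*} [Group G] [AddCommGroup V] [Module ℂ V]
    (ρ : Representation ℂ G V) (Γ : Subgroup G) : Submodule ℂ V :=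
  Representation.invariants (MonoidHom.comp ρ Γ.subtype)

lemma mem_subgroupInvariants {G V : Type*} [Group G] [AddCommGroup V] [Module ℂ V]
    {ρ : Representation ℂ G V} {Γ : Subgroup G} {v : V} :
    v ∈ subgroupInvariants ρ Γ ↔ ∀ γ ∈ Γ, ρ γ v = v := by
  rw [subgroupInvariants, Representation.mem_invariants]
  exact ⟨fun h γ hγ => h ⟨γ, hγ⟩, fun h γ => h γ γ.2⟩

lemma tensor_congr_trans {k : ℕ} {U V W : Type*} [AddCommGroup U] [Module ℂ U] [AddCommGroup V]
    [Module ℂ V] [AddCommGroup W] [Module ℂ W] (f : U ≃ₗ[ℂ] V) (g : V ≃ₗ[ℂ] W) (t : ⨂[ℂ]^k U) :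
    PiTensorProduct.congr (fun _ : Fin k => f ≪≫ₗ g) t
      = PiTensorProduct.congr (fun _ => g) (PiTensorProduct.congr (fun _ => f) t) := by
  induction t using PiTensorProduct.induction_on with
  | smul_tprod r v =>
    simp only [map_smul, PiTensorProduct.congr_tprod, LinearEquiv.trans_apply]
  | add a b ha hb => rw [map_add, map_add, map_add, ha, hb]

variable {E : Type w} [NormedAddCommGroup E] [NormedSpace ℝ E]
  {X Y Z : LineBundleWithConnection.{u, v, w} E} {k : ℕ}

/-- Base points that agree only up to a proved equality have fibres of different types. Stating the
equality in the sigma type lets the base points be substituted first. -/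
lemma sigma_tensor_congr_eq {B : Type*} {L : B → Type*} [∀ b, AddCommGroup (L b)]
    [∀ b, Module ℂ (L b)] {V : Type*} [AddCommGroup V] [Module ℂ V] {b b' : B}
    (f : V ≃ₗ[ℂ] L b) (f' : V ≃ₗ[ℂ] L b') (h : b = b')
    (hf : ∀ v, (⟨b, f v⟩ : TotalSpace ℂ L) = ⟨b', f' v⟩) (t : ⨂[ℂ]^k V) :
    (⟨b, PiTensorProduct.congr (fun _ => f) t⟩ : Σ b, ⨂[ℂ]^k (L b))
      = ⟨b', PiTensorProduct.congr (fun _ => f') t⟩ := by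
  subst h
  have : f = f' := by
    ext v
    exact eq_of_heq (TotalSpace.mk.inj (hf v)).2
  rw [this]

namespace ConnectionMap

/-- The map of total spaces. -/
def total (F : ConnectionMap X Y) (p : TotalSpace ℂ X.L) : TotalSpace ℂ Y.L :=
  ⟨F.base p.1, F.onFiber p.1 p.2⟩

lemma pullback_apply_eq_iff (F : ConnectionMap X Y) {σ : TensorSection Y.L k} {x : X.M}
    {t : ⨂[ℂ]^k (X.L x)} : F.pullback k σ x = t ↔ F.onTensor k x t = σ (F.base x) := by
  rw [pullback_apply, LinearEquiv.symm_apply_eq, eq_comm]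

/-- Factorizations are compared on total spaces, where no transport between fibres is needed. This
yields both the group law of the action on sections and the invariance of sections pulled back from
the quotient. -/
lemma pullback_eq_of_total_eq {F : ConnectionMap X Y} {H : ConnectionMap Y Z}
    {K : ConnectionMap X Z} (h : ∀ p, K.total p = H.total (F.total p)) (σ : TensorSection Z.L k) :
    K.pullback k σ = F.pullback k (H.pullback k σ) := by
  funext x
  have hx : H.base (F.base x) = K.base x := (congrArg TotalSpace.proj (h ⟨x, 0⟩)).symm
  rw [pullback_apply_eq_iff]
  set τ := F.pullback k (H.pullback k σ) x with hτ
  have h1 : F.onTensor k x τ = H.pullback k σ (F.base x) := F.pullback_apply_eq_iff.1 hτ.symm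
  have h2 := H.pullback_apply_eq_iff.1 h1.symm
  have h3 := sigma_tensor_congr_eq (F.onFiber x ≪≫ₗ H.onFiber (F.base x)) (K.onFiber x) hx
    (fun v => (h ⟨x, v⟩).symm) τ
  have h4 : PiTensorProduct.congr (fun _ : Fin k => F.onFiber x ≪≫ₗ H.onFiber (F.base x)) τ
      = H.onTensor k (F.base x) (F.onTensor k x τ) := tensor_congr_trans _ _ _
  rw [h4, h2] at h3
  have h5 : (⟨H.base (F.base x), σ (H.base (F.base x))⟩ : Σ b, ⨂[ℂ]^k (Z.L b))
      = ⟨K.base x, σ (K.base x)⟩ := by rw [hx]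
  exact eq_of_heq (Sigma.mk.inj (h3.symm.trans h5)).2

end ConnectionMap

end Functoriality

/-! ### The representation on eigenspaces and its invariants -/

section Actions

variable {E : Type w} [NormedAddCommGroup E] [NormedSpace ℝ E]
  {X : LineBundleWithConnection.{u, v, w} E} {G : Type z} [Group G]

namespace BundleAction

variable (A : BundleAction G X)

lemma act_one (x : X.M) : A.act 1 x = x := letI := A.actM; one_smul G x

lemma act_mul (g h : G) (x : X.M) : A.act (g * h) x = A.act g (A.act h x) :=
  letI := A.actM; mul_smul g h x

lemma act_inv_act (g : G) (x : X.M) : A.act g⁻¹ (A.act g x) = x := by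
  rw [← act_mul, inv_mul_cancel, act_one]

lemma act_act_inv (g : G) (x : X.M) : A.act g (A.act g⁻¹ x) = x := by
  rw [← act_mul, mul_inv_cancel, act_one]

lemma actTotal_one (p : TotalSpace ℂ X.L) : A.actTotal 1 p = p := letI := A.actL; one_smul G p

lemma actTotal_mul (g h : G) (p : TotalSpace ℂ X.L) :
    A.actTotal (g * h) p = A.actTotal g (A.actTotal h p) :=
  letI := A.actL; mul_smul g h p

lemma actTotal_mk (g : G) (x : X.M) (v : X.L x) :
    A.actTotal g ⟨x, v⟩ = ⟨A.act g x, A.onFiber g x v⟩ := A.smul_eq g x v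

lemma actTotal_injective (g : G) : Function.Injective (A.actTotal g) :=
  letI := A.actL; MulAction.injective g

/-- The inverse comes from g⁻¹ acting on the total space, which avoids identifying the fibre over
g⁻¹ g x with the one over x. -/
lemma onFiber_bijective (g : G) (x : X.M) : Function.Bijective (A.onFiber g x) := by
  constructor
  · intro v v' h
    have h2 : A.actTotal g ⟨x, v⟩ = A.actTotal g ⟨x, v'⟩ := by
      rw [actTotal_mk, actTotal_mk, h]
    exact eq_of_heq (TotalSpace.mk.inj (A.actTotal_injective g h2)).2
  · intro w
    obtain ⟨⟨y, v⟩, h⟩ : ∃ p, A.actTotal g p = ⟨A.act g x, w⟩ :=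
      ⟨A.actTotal g⁻¹ ⟨A.act g x, w⟩, by rw [← actTotal_mul, mul_inv_cancel, actTotal_one]⟩
    rw [actTotal_mk] at h
    obtain ⟨h1, h2⟩ := TotalSpace.mk.inj h
    have h3 : y = x := by rw [← A.act_inv_act g y, h1, act_inv_act]
    subst h3
    exact ⟨v, eq_of_heq h2⟩

/-- The action of `g` on the base, as a diffeomorphism. -/
def diffeo (g : G) : X.M ≃ₘ^∞⟮𝓘(ℝ, E), 𝓘(ℝ, E)⟯ X.M where
  toFun := A.act g
  invFun := A.act g⁻¹
  left_inv := A.act_inv_act g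
  right_inv := A.act_act_inv g
  contMDiff_toFun := A.smooth_base g
  contMDiff_invFun := A.smooth_base g⁻¹

/-- The action of `g` as a map of line bundles with connection. -/
def connectionMap (g : G) : ConnectionMap X X where
  base := A.act g
  onFiber x := LinearEquiv.ofBijective (A.onFiber g x) (A.onFiber_bijective g x)
  localDiffeo := (A.diffeo g).isLocalDiffeomorph
  total_smooth := by
    have h : (fun p : TotalSpace ℂ X.L => (⟨A.act g p.1, A.onFiber g p.1 p.2⟩ : TotalSpace ℂ X.L))
        = A.actTotal g := by
      funext p
      exact (A.actTotal_mk g p.1 p.2).symm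
    exact h ▸ A.smooth_total g
  isometry := A.isometry g
  conn_eq t x u ht := A.preserves_conn g _ t (fun y => by
    exact ((LinearEquiv.ofBijective (A.onFiber g y)
      (A.onFiber_bijective g y)).apply_symm_apply _).symm) x u ht

lemma connectionMap_total (g : G) (p : TotalSpace ℂ X.L) :
    (A.connectionMap g).total p = A.actTotal g p := (A.actTotal_mk g p.1 p.2).symm

lemma connectionMap_base_surjective (g : G) : Function.Surjective (A.connectionMap g).base :=
  (A.diffeo g).surjective

variable {k : ℕ}

lemma pullback_mul (g h : G) (σ : TensorSection X.L k) :
    (A.connectionMap (g * h)).pullback k σ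
      = (A.connectionMap h).pullback k ((A.connectionMap g).pullback k σ) :=
  ConnectionMap.pullback_eq_of_total_eq
    (fun p => by simp only [connectionMap_total, actTotal_mul]) σ

variable [FiniteDimensional ℝ E]

/-- The pull-back under 1 is idempotent by `pullback_mul` and injective, hence the identity. -/
lemma pullback_one (σ : TensorSection X.L k) : (A.connectionMap 1).pullback k σ = σ := by
  apply (A.connectionMap 1).pullback_injective (A.connectionMap_base_surjective 1)
  rw [← pullback_mul, one_mul]

variable {Q : X.M → ℝ} (hQ : ∀ (g : G) (x : X.M), Q (A.act g x) = Q x)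

/-- The representation of `G` on an eigenspace of an invariant Schrödinger operator. -/
def eigenspaceRepresentation (k : ℕ) (μ : ℂ) : Representation ℂ G (X.eigenspace Q k μ) where
  -- Pull-back reverses products, so the inverse is needed to obtain a left action.
  toFun g := ((A.connectionMap g⁻¹).pullback k).restrict (fun σ hσ => by
    have h := (A.connectionMap g⁻¹).pullback_mem_eigenspace hσ
    rwa [show (fun x => Q ((A.connectionMap g⁻¹).base x)) = Q from funext (hQ g⁻¹)] at h)
  map_one' := by
    ext1 σ
    apply Subtype.ext
    simp only [inv_one]
    exact A.pullback_one _
  map_mul' g h := by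
    ext1 σ
    apply Subtype.ext
    simp only [mul_inv_rev]
    exact A.pullback_mul _ _ _

lemma coe_eigenspaceRepresentation (k : ℕ) (μ : ℂ) (g : G) (σ : X.eigenspace Q k μ) :
    (A.eigenspaceRepresentation hQ k μ g σ : TensorSection X.L k)
      = (A.connectionMap g⁻¹).pullback k σ := rfl

end BundleAction

namespace QuotientMap

variable {A : BundleAction G X} {Γ : Subgroup G} {Y : LineBundleWithConnection.{u, v, w} E}
  (q : QuotientMap A Γ Y) {k : ℕ}

/-- The quotient map as a map of line bundles with connection. -/
def connectionMap : ConnectionMap X Y where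
  base := q.proj
  onFiber x := (q.onFiber x).toLinearEquiv
  localDiffeo := q.proj_localDiffeo
  total_smooth := q.total_smooth
  isometry := q.isometry
  conn_eq t x u ht := q.conn_eq _ t (fun y => ((q.onFiber y).apply_symm_apply _).symm) x u ht

lemma total_actTotal {γ : G} (hγ : γ ∈ Γ) (p : TotalSpace ℂ X.L) :
    q.connectionMap.total (A.actTotal γ p) = q.connectionMap.total p :=
  ((q.total_eq_iff p (A.actTotal γ p)).2 ⟨γ, hγ, rfl⟩).symm

lemma pullback_invariant {γ : G} (hγ : γ ∈ Γ) (σ : TensorSection Y.L k) :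
    (A.connectionMap γ).pullback k (q.connectionMap.pullback k σ)
      = q.connectionMap.pullback k σ :=
  (ConnectionMap.pullback_eq_of_total_eq
    (fun p => by rw [A.connectionMap_total, q.total_actTotal hγ]) σ).symm

/-- Invariant sections descend to the quotient. -/
lemma exists_pullback_eq {τ : TensorSection X.L k}
    (hτ : ∀ γ ∈ Γ, (A.connectionMap γ).pullback k τ = τ) :
    ∃ σ : TensorSection Y.L k, q.connectionMap.pullback k σ = τ := by
  -- The value at y is transported from one preimage; by invariance under Γ every other preimage,
  -- being in the same orbit, gives the same value.
  have key : ∀ y : Y.M, ∃ s : ⨂[ℂ]^k (Y.L y), ∀ x, q.proj x = y →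
      (⟨q.proj x, q.connectionMap.onTensor k x (τ x)⟩ : Σ y, ⨂[ℂ]^k (Y.L y)) = ⟨y, s⟩ := by
    intro y
    obtain ⟨x₀, rfl⟩ := q.proj_surjective y
    refine ⟨q.connectionMap.onTensor k x₀ (τ x₀), fun x hx => ?_⟩
    obtain ⟨γ, hγ, rfl⟩ := (q.proj_eq_iff x₀ x).1 hx.symm
    have h1 := (A.connectionMap γ).pullback_apply_eq_iff.1 (congrFun (hτ γ hγ) x₀)
    have h2 := sigma_tensor_congr_eq (k := k)
      ((A.connectionMap γ).onFiber x₀ ≪≫ₗ q.connectionMap.onFiber (A.act γ x₀))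
      (q.connectionMap.onFiber x₀) hx (fun v => by
        have := q.total_actTotal hγ ⟨x₀, v⟩
        rwa [A.actTotal_mk] at this) (τ x₀)
    refine Eq.trans ?_ h2
    congr 1
    refine (congrArg (q.connectionMap.onTensor k (A.act γ x₀)) h1.symm).trans ?_
    exact (tensor_congr_trans _ _ _).symm
  choose s hs using key
  refine ⟨s, ?_⟩
  funext x
  rw [ConnectionMap.pullback_apply_eq_iff]
  exact eq_of_heq (Sigma.mk.inj (hs (q.proj x) x rfl)).2

lemma induced_proj {Q : X.M → ℝ} (hQ : ∀ (g : G) (x : X.M), Q (A.act g x) = Q x) (x : X.M) :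
    q.induced Q (q.proj x) = Q x := by
  obtain ⟨γ, -, h⟩ := (q.proj_eq_iff _ _).1 (Function.surjInv_eq q.proj_surjective (q.proj x))
  rw [induced, ← hQ γ, h]

variable [FiniteDimensional ℝ E]

/-- The eigenspaces of the quotient are the invariant parts of the eigenspaces. -/
def eigenspaceEquiv {Q : X.M → ℝ} (hQ : ∀ (g : G) (x : X.M), Q (A.act g x) = Q x) (μ : ℂ) :
    Y.eigenspace (q.induced Q) k μ ≃ₗ[ℂ]
      subgroupInvariants (A.eigenspaceRepresentation hQ k μ) Γ :=
  have hQ' : (fun x => q.induced Q (q.connectionMap.base x)) = Q := funext (q.induced_proj hQ)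
  LinearEquiv.ofBijective
    (LinearMap.codRestrict _
      (LinearMap.restrict (q.connectionMap.pullback k) (q := X.eigenspace Q k μ) (fun σ hσ => by
        have h := q.connectionMap.pullback_mem_eigenspace hσ
        rwa [hQ'] at h))
      (fun σ => by
        rw [mem_subgroupInvariants]
        intro γ hγ
        apply Subtype.ext
        exact q.pullback_invariant (Γ.inv_mem hγ) σ.1))
    (by
      constructor
      · intro σ τ h
        apply Subtype.ext
        apply q.connectionMap.pullback_injective q.proj_surjective
        exact congrArg (fun a => (a.1.1 : TensorSection X.L k)) h
      · rintro ⟨τ, hτ⟩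
        rw [mem_subgroupInvariants] at hτ
        -- Pull-back under γ is the action of γ⁻¹, which also lies in Γ.
        obtain ⟨σ, hσ⟩ := q.exists_pullback_eq (τ := τ.1) (fun γ hγ => by
          have h := congrArg (fun a => (a.1 : TensorSection X.L k)) (hτ γ⁻¹ (Γ.inv_mem hγ))
          have h2 := A.coe_eigenspaceRepresentation hQ k μ γ⁻¹ τ
          rw [inv_inv] at h2
          exact h2.symm.trans h)
        refine ⟨⟨σ, q.connectionMap.mem_eigenspace_of_pullback q.proj_surjective ?_⟩, ?_⟩
        · rw [hσ, hQ']
          exact τ.2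
        · apply Subtype.ext
          apply Subtype.ext
          exact hσ)

lemma specPotential_eq {Q : X.M → ℝ} (hQ : ∀ (g : G) (x : X.M), Q (A.act g x) = Q x) (μ : ℂ) :
    Y.specPotential (q.induced Q) k μ
      = Module.rank ℂ (subgroupInvariants (A.eigenspaceRepresentation hQ k μ) Γ) := by
  rw [LineBundleWithConnection.specPotential_eq_rank]
  exact (q.eigenspaceEquiv hQ μ).rank_eq

lemma spec_eq (q : QuotientMap A Γ Y) (k : ℕ) (μ : ℂ) : Y.spec k μ = Module.rank ℂ
    (subgroupInvariants
      (A.eigenspaceRepresentation (Q := fun _ => 0) (fun _ _ => rfl) k μ) Γ) := by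
  rw [LineBundleWithConnection.spec_eq_specPotential]
  exact q.specPotential_eq (Q := fun _ => 0) (fun _ _ => rfl) μ

end QuotientMap

end Actions

/-! ### Invariants of almost conjugate subgroups -/

section Representations

variable {G : Type*} [Group G]

/-- The dimension of the invariants is the mean of the character over the subgroup. The bijection
preserves the order of the group and, since characters are constant on conjugacy classes, the sum.
-/
lemma AlmostConjugate.rank_invariants_eq_of_finiteDimensional [Finite G] {Γ₁ Γ₂ : Subgroup G}
    (hΓ : AlmostConjugate Γ₁ Γ₂) {V : Type*} [AddCommGroup V] [Module ℂ V] [FiniteDimensional ℂ V]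
    (ρ : Representation ℂ G V) :
    Module.rank ℂ (subgroupInvariants ρ Γ₁) = Module.rank ℂ (subgroupInvariants ρ Γ₂) := by
  obtain ⟨φ, hφ⟩ := hΓ
  have key (Γ : Subgroup G) : ∀ [Fintype Γ], (Nat.card Γ : ℂ)⁻¹ * ∑ γ : Γ, ρ.character γ
      = finrank ℂ (subgroupInvariants ρ Γ) := by
    intro _
    have : Invertible (Nat.card Γ : ℂ) :=
      invertibleOfNonzero (Nat.cast_ne_zero.2 Nat.card_pos.ne')
    exact Representation.card_inv_mul_sum_char_eq_finrank (MonoidHom.comp ρ Γ.subtype)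
  have := Fintype.ofFinite Γ₁
  have := Fintype.ofFinite Γ₂
  have h : (finrank ℂ (subgroupInvariants ρ Γ₁) : ℂ) = finrank ℂ (subgroupInvariants ρ Γ₂) := by
    rw [← key Γ₁, ← key Γ₂, Nat.card_congr φ]
    congr 1
    refine Fintype.sum_equiv φ _ _ fun γ => ?_
    obtain ⟨c, hc⟩ := isConj_iff.1 (hφ γ)
    rw [← hc, Representation.char_conj]
  rw [← finrank_eq_rank, ← finrank_eq_rank, Nat.cast_injective h]

/-- The representation on a module over the group algebra. -/
def moduleRepresentation (G : Type*) [Group G] (M : Type*) [AddCommGroup M] [Module ℂ M]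
    [Module (MonoidAlgebra ℂ G) M] [IsScalarTower ℂ (MonoidAlgebra ℂ G) M] :
    Representation ℂ G M where
  toFun g :=
    { toFun := fun m => MonoidAlgebra.of ℂ G g • m
      map_add' := smul_add _
      map_smul' := fun c m => by
        have : SMulCommClass (MonoidAlgebra ℂ G) ℂ M := IsScalarTower.to_smulCommClass'
        exact smul_comm _ _ _ }
  map_one' := by ext m; exact one_smul (MonoidAlgebra ℂ G) m
  map_mul' g h := by ext m; simp only [map_mul, mul_smul]; rfl

/-- Equivariant isomorphisms identify the invariants of a subgroup. -/
lemma rank_subgroupInvariants_congr {V W : Type v} [AddCommGroup V] [Module ℂ V] [AddCommGroup W]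
    [Module ℂ W] {ρ : Representation ℂ G V} {τ : Representation ℂ G W} (e : V ≃ₗ[ℂ] W)
    (he : ∀ g v, e (ρ g v) = τ g (e v)) (Γ : Subgroup G) :
    Module.rank ℂ (subgroupInvariants ρ Γ) = Module.rank ℂ (subgroupInvariants τ Γ) := by
  suffices h : (subgroupInvariants ρ Γ).map (e : V →ₗ[ℂ] W) = subgroupInvariants τ Γ by
    rw [← h]
    exact (e.submoduleMap (subgroupInvariants ρ Γ)).rank_eq
  ext w
  rw [Submodule.mem_map_equiv, mem_subgroupInvariants, mem_subgroupInvariants]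
  refine forall₂_congr fun γ _ => ?_
  rw [← e.injective.eq_iff, he, e.apply_symm_apply]

/-- The action is componentwise, so the invariants of a direct sum are the direct sum of the
invariants. -/
lemma rank_subgroupInvariants_dfinsupp {ι : Type v} {M : ι → Type w} [∀ i, AddCommGroup (M i)]
    [∀ i, Module ℂ (M i)] (ρ : ∀ i, Representation ℂ G (M i))
    (τ : Representation ℂ G (Π₀ i, M i)) (hτ : ∀ g f i, τ g f i = ρ i g (f i))
    (Γ : Subgroup G) :
    Module.rank ℂ (subgroupInvariants τ Γ)
      = Cardinal.sum fun i => Module.rank ℂ (subgroupInvariants (ρ i) Γ) := by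
  classical
  let j : (Π₀ i, subgroupInvariants (ρ i) Γ) →ₗ[ℂ] Π₀ i, M i :=
    DFinsupp.mapRange.linearMap fun i => (subgroupInvariants (ρ i) Γ).subtype
  have hj : Function.Injective j := by
    intro f f' h
    ext i
    exact DFunLike.congr_fun h i
  have hr : LinearMap.range j = subgroupInvariants τ Γ := by
    ext f
    rw [mem_subgroupInvariants, LinearMap.mem_range]
    constructor
    · rintro ⟨f, rfl⟩ γ hγ
      ext i
      rw [hτ]
      exact mem_subgroupInvariants.1 (f i).2 γ hγ
    · intro h
      have hi (i : ι) : f i ∈ subgroupInvariants (ρ i) Γ :=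
        mem_subgroupInvariants.2 fun γ hγ => by rw [← hτ, h γ hγ]
      refine ⟨DFinsupp.mk f.support fun i => ⟨f i, hi i⟩, ?_⟩
      ext i
      by_cases hs : i ∈ f.support
      · simp [j, hs]
      · simpa [j, hs] using (DFinsupp.notMem_support_iff.1 hs).symm
  rw [← hr, ← (LinearEquiv.ofInjective j hj).rank_eq]
  exact rank_directSum ℂ (fun i => subgroupInvariants (ρ i) Γ)

/-- Almost conjugate subgroups have spaces of invariants of the same dimension, in every
representation. -/
theorem AlmostConjugate.rank_invariants_eq [Finite G] {Γ₁ Γ₂ : Subgroup G}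
    (hΓ : AlmostConjugate Γ₁ Γ₂) {V : Type v} [AddCommGroup V] [Module ℂ V]
    (ρ : Representation ℂ G V) :
    Module.rank ℂ (subgroupInvariants ρ Γ₁) = Module.rank ℂ (subgroupInvariants ρ Γ₂) := by
  -- The order of G is nonzero in ℂ, so Maschke's theorem makes every ℂ[G]-module a direct sum of
  -- simple submodules, with no bound on the dimension.
  have : NeZero (Nat.card G : ℂ) := ⟨Nat.cast_ne_zero.2 Nat.card_pos.ne'⟩
  obtain ⟨s, e, -, hs⟩ :=
    IsSemisimpleModule.exists_linearEquiv_dfinsupp (MonoidAlgebra ℂ G) ρ.asModule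
  have tower (S : Submodule (MonoidAlgebra ℂ G) ρ.asModule) :
      IsScalarTower ℂ (MonoidAlgebra ℂ G) S := inferInstance
  have h (Γ : Subgroup G) : Module.rank ℂ (subgroupInvariants ρ Γ)
      = Cardinal.sum fun S : s =>
        Module.rank ℂ (subgroupInvariants (moduleRepresentation G S.1) Γ) := by
    rw [rank_subgroupInvariants_congr (τ := moduleRepresentation G (Π₀ S : s, S.1))
      (ρ.asModuleEquiv.symm ≪≫ₗ e.restrictScalars ℂ) ?_ Γ]
    · exact rank_subgroupInvariants_dfinsupp _ _ (fun g f i => rfl) Γ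
    · intro g v
      simp only [LinearEquiv.trans_apply, LinearEquiv.restrictScalars_apply,
        Representation.asModuleEquiv_symm_map_rho, map_smul]
      rfl
  rw [h, h]
  congr 1
  funext S
  -- A simple module is finitely generated over ℂ[G], which is finite-dimensional, so each summand
  -- is finite-dimensional and the character argument applies.
  have := hs S
  have : Module.Finite ℂ (MonoidAlgebra ℂ G) := inferInstance
  have : FiniteDimensional ℂ S.1 := Module.Finite.trans (MonoidAlgebra ℂ G) S.1
  exact hΓ.rank_invariants_eq_of_finiteDimensional _

end Representations

/-! ### Equality of the spectra -/

section Isospectrality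

variable {E : Type w} [NormedAddCommGroup E] [NormedSpace ℝ E] [FiniteDimensional ℝ E]
  {X Y₁ Y₂ : LineBundleWithConnection.{u, v, w} E} {G : Type z} [Group G] [Finite G]
  {A : BundleAction G X} {Γ₁ Γ₂ : Subgroup G} (q₁ : QuotientMap A Γ₁ Y₁)
  (q₂ : QuotientMap A Γ₂ Y₂)

lemma AlmostConjugate.specPotential_eq (hΓ : AlmostConjugate Γ₁ Γ₂) {Q : X.M → ℝ}
    (hQ : ∀ (g : G) (x : X.M), Q (A.act g x) = Q x) (k : ℕ) :
    Y₁.specPotential (q₁.induced Q) k = Y₂.specPotential (q₂.induced Q) k := by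
  funext μ
  rw [q₁.specPotential_eq hQ, q₂.specPotential_eq hQ, hΓ.rank_invariants_eq]

lemma AlmostConjugate.spec_eq (hΓ : AlmostConjugate Γ₁ Γ₂)
    (q₁ : QuotientMap A Γ₁ Y₁) (q₂ : QuotientMap A Γ₂ Y₂) (k : ℕ) : Y₁.spec k = Y₂.spec k := by
  funext μ
  rw [q₁.spec_eq, q₂.spec_eq, hΓ.rank_invariants_eq]

end Isospectrality

/-! ### Construction of a smooth line bundle from local trivializations -/

section LineAtlas

variable {E : Type*} [NormedAddCommGroup E] [NormedSpace ℝ E]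
  {N : Type*} [TopologicalSpace N] [ChartedSpace E N]
  {L : N → Type*} [∀ y, NormedAddCommGroup (L y)] [∀ y, InnerProductSpace ℂ (L y)]

variable (E L) in
/-- Local trivializations of a family of complex lines with smooth transition functions. -/
structure LineAtlas where
  /-- the domain of the trivialization around `b` -/
  baseSet (b : N) : Set N
  isOpen_baseSet (b : N) : IsOpen (baseSet b)
  mem_baseSet (b : N) : b ∈ baseSet b
  /-- the fibre coordinate at `y` of the trivialization around `b` -/
  coord (b y : N) : L y →ₗ[ℂ] ℂ
  /-- the frame at `y` of the trivialization around `b` -/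
  frame (b y : N) : L y
  coord_frame {b y : N} : y ∈ baseSet b → coord b y (frame b y) = 1
  coord_smul_frame {b y : N} (v : L y) : y ∈ baseSet b → coord b y v • frame b y = v
  contMDiffOn_transition (b b' : N) : ContMDiffOn 𝓘(ℝ, E) 𝓘(ℝ, ℂ) ∞
    (fun y => coord b' y (frame b y)) (baseSet b ∩ baseSet b')

namespace LineAtlas

variable (a : LineAtlas E L)

/-- The pretrivialization around `b`. -/
def pretrivialization (b : N) : Pretrivialization ℂ (π ℂ L) where
  toFun p := (p.1, a.coord b p.1 p.2)
  invFun q := ⟨q.1, q.2 • a.frame b q.1⟩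
  source := (π ℂ L) ⁻¹' a.baseSet b
  target := a.baseSet b ×ˢ Set.univ
  map_source' p hp := ⟨hp, trivial⟩
  map_target' q hq := hq.1
  left_inv' p hp := by
    obtain ⟨y, v⟩ := p
    exact congrArg (TotalSpace.mk' ℂ y) (a.coord_smul_frame v hp)
  right_inv' q hq := by
    refine Prod.ext rfl ?_
    simp only [map_smul, a.coord_frame hq.1, smul_eq_mul, mul_one]
  open_target := (a.isOpen_baseSet b).prod isOpen_univ
  baseSet := a.baseSet b
  open_baseSet := a.isOpen_baseSet b
  source_eq := rfl
  target_eq := rfl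
  proj_toFun _ _ := rfl

lemma pretrivialization_isLinear_complex (b : N) : (a.pretrivialization b).IsLinear ℂ where
  linear y _ := ⟨(a.coord b y).map_add, (a.coord b y).map_smul⟩

lemma pretrivialization_isLinear_real (b : N) : (a.pretrivialization b).IsLinear ℝ where
  linear y _ := ⟨(a.coord b y).map_add, ((a.coord b y).restrictScalars ℝ).map_smul⟩

lemma pretrivialization_symm {b y : N} (hy : y ∈ a.baseSet b) (c : ℂ) :
    (a.pretrivialization b).symm y c = c • a.frame b y := by
  have h := (a.pretrivialization b).mk_symm (b := y) hy c
  exact eq_of_heq (TotalSpace.mk.inj h).2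

/-- The fibres carry their norm topology beforehand. It agrees with the topology from the
trivialization because a linear isomorphism of finite-dimensional spaces is a homeomorphism. -/
lemma isInducing_pretrivialization (b : N) :
    Topology.IsInducing (a.pretrivialization b ∘ TotalSpace.mk' ℂ b) := by
  let e : L b ≃ₗ[ℂ] ℂ :=
    { a.coord b b with
      invFun := fun c => c • a.frame b b
      left_inv := fun v => a.coord_smul_frame v (a.mem_baseSet b)
      right_inv := fun c => by simp [a.coord_frame (a.mem_baseSet b)] }
  have : FiniteDimensional ℂ (L b) := e.symm.finiteDimensional
  exact Topology.isInducing_const_prod.2 e.toContinuousLinearEquiv.toHomeomorph.isInducing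

lemma exists_transition (b b' : N) : ∃ f : N → ℂ,
    ContMDiffOn 𝓘(ℝ, E) 𝓘(ℝ, ℂ) ∞ f (a.baseSet b ∩ a.baseSet b') ∧
    ∀ y ∈ a.baseSet b ∩ a.baseSet b', ∀ c : ℂ,
      f y * c = (a.pretrivialization b' ⟨y, (a.pretrivialization b).symm y c⟩).2 := by
  refine ⟨_, a.contMDiffOn_transition b b', fun y hy c => ?_⟩
  rw [a.pretrivialization_symm hy.1]
  change _ = a.coord b' y (c • a.frame b y)
  rw [map_smul, smul_eq_mul, mul_comm]

/-- The complex vector prebundle. -/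
def complexPrebundle : VectorPrebundle ℂ ℂ L where
  pretrivializationAtlas := Set.range a.pretrivialization
  pretrivialization_linear' := by
    rintro _ ⟨b, rfl⟩
    exact a.pretrivialization_isLinear_complex b
  pretrivializationAt := a.pretrivialization
  mem_base_pretrivializationAt := a.mem_baseSet
  pretrivialization_mem_atlas b := ⟨b, rfl⟩
  exists_coordChange := by
    rintro _ ⟨b, rfl⟩ _ ⟨b', rfl⟩
    obtain ⟨f, hf, h⟩ := a.exists_transition b b'
    exact ⟨fun y => ContinuousLinearMap.mul ℂ ℂ (f y),
      (ContinuousLinearMap.mul ℂ ℂ).continuous.comp_continuousOn hf.continuousOn, h⟩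
  totalSpaceMk_isInducing := a.isInducing_pretrivialization

/-- The real vector prebundle. -/
def realPrebundle : VectorPrebundle ℝ ℂ L where
  pretrivializationAtlas := Set.range a.pretrivialization
  pretrivialization_linear' := by
    rintro _ ⟨b, rfl⟩
    exact a.pretrivialization_isLinear_real b
  pretrivializationAt := a.pretrivialization
  mem_base_pretrivializationAt := a.mem_baseSet
  pretrivialization_mem_atlas b := ⟨b, rfl⟩
  exists_coordChange := by
    rintro _ ⟨b, rfl⟩ _ ⟨b', rfl⟩
    obtain ⟨f, hf, h⟩ := a.exists_transition b b'
    exact ⟨fun y => ContinuousLinearMap.mul ℝ ℂ (f y),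
      (ContinuousLinearMap.mul ℝ ℂ).continuous.comp_continuousOn hf.continuousOn, h⟩
  totalSpaceMk_isInducing := a.isInducing_pretrivialization

lemma realPrebundle_isContMDiff : a.realPrebundle.IsContMDiff 𝓘(ℝ, E) ∞ where
  exists_contMDiffCoordChange := by
    rintro _ ⟨b, rfl⟩ _ ⟨b', rfl⟩
    obtain ⟨f, hf, h⟩ := a.exists_transition b b'
    exact ⟨fun y => ContinuousLinearMap.mul ℝ ℂ (f y),
      (ContinuousLinearMap.mul ℝ ℂ).contMDiff.comp_contMDiffOn hf, h⟩

/-- The topology on the total space. -/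
@[reducible] def totalSpaceTopology : TopologicalSpace (TotalSpace ℂ L) :=
  a.complexPrebundle.totalSpaceTopology

/-- The fibre bundle defined by the local trivializations. -/
@[reducible] def fiberBundle : @FiberBundle N ℂ _ _ L a.totalSpaceTopology _ :=
  a.complexPrebundle.toFiberBundle

lemma complexVectorBundle :
    @VectorBundle ℂ _ ℂ L _ _ _ _ _ _ a.totalSpaceTopology _ a.fiberBundle :=
  a.complexPrebundle.toVectorBundle

/-- The real and complex prebundles have the same pretrivializations, so they define the same
topology and fibre bundle. The real structure is the one that smoothness refers to. -/
lemma realVectorBundle :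
    @VectorBundle ℝ _ ℂ L _ _ _ _ _ _ a.totalSpaceTopology _ a.fiberBundle :=
  a.realPrebundle.toVectorBundle

lemma contMDiffVectorBundle :
    @ContMDiffVectorBundle ∞ ℝ _ ℂ L _ _ _ _ _ _ 𝓘(ℝ, E) _ _ _ _ _ _ a.totalSpaceTopology _
      a.fiberBundle a.realVectorBundle :=
  have := a.realPrebundle_isContMDiff
  a.realPrebundle.contMDiffVectorBundle 𝓘(ℝ, E)

end LineAtlas

end LineAtlas

/-! ### The orbit space as a smooth manifold -/

section OrbitSpace

variable {E : Type w} [NormedAddCommGroup E] [NormedSpace ℝ E]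
  {X : LineBundleWithConnection.{u, v, w} E} {G : Type z} [Group G]

namespace BundleAction

/-- The action of a subgroup on the base. -/
@[reducible] def subgroupAction (A : BundleAction G X) (Γ : Subgroup G) : MulAction Γ X.M where
  smul γ x := A.act γ x
  one_smul := A.act_one
  mul_smul g h := A.act_mul g h

/-- The orbit relation of a subgroup on the base. -/
@[reducible] def orbitSetoid (A : BundleAction G X) (Γ : Subgroup G) : Setoid X.M :=
  @MulAction.orbitRel Γ X.M _ (A.subgroupAction Γ)

/-- The orbit space of a subgroup acting freely on the base. -/
def OrbitSpace (A : BundleAction G X) (Γ : Subgroup G) (_h : A.ActsFreely Γ) : Type u :=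
  Quotient (A.orbitSetoid Γ)

lemma contMDiff_act (A : BundleAction G X) (g : G) : ContMDiff 𝓘(ℝ, E) 𝓘(ℝ, E) ∞ (A.act g) :=
  A.smooth_base g

namespace OrbitSpace

variable {A : BundleAction G X} {Γ : Subgroup G} {h : A.ActsFreely Γ}

/-- The projection to the orbit space. -/
def mk (x : X.M) : A.OrbitSpace Γ h := Quotient.mk _ x

/-- A representative of an orbit. -/
def out (y : A.OrbitSpace Γ h) : X.M := Quotient.out y

@[simp] lemma mk_out (y : A.OrbitSpace Γ h) : mk (out y) = y := Quotient.out_eq y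

lemma mk_surjective : Function.Surjective (mk : X.M → A.OrbitSpace Γ h) :=
  fun y => ⟨out y, mk_out y⟩

lemma mk_eq_iff {x x' : X.M} :
    (mk x : A.OrbitSpace Γ h) = mk x' ↔ ∃ γ ∈ Γ, A.act γ x = x' := by
  let := A.subgroupAction Γ
  rw [eq_comm]
  refine Quotient.eq.trans ?_
  rw [MulAction.orbitRel_apply, MulAction.mem_orbit_iff]
  exact ⟨fun ⟨γ, hγ⟩ => ⟨γ, γ.2, hγ⟩, fun ⟨γ, hγ, hx⟩ => ⟨⟨γ, hγ⟩, hx⟩⟩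

lemma mk_act {γ : G} (hγ : γ ∈ Γ) (x : X.M) : (mk (A.act γ x) : A.OrbitSpace Γ h) = mk x :=
  (mk_eq_iff.2 ⟨γ, hγ, rfl⟩).symm

instance : TopologicalSpace (A.OrbitSpace Γ h) :=
  inferInstanceAs (TopologicalSpace (Quotient (A.orbitSetoid Γ)))

instance : CompactSpace (A.OrbitSpace Γ h) :=
  inferInstanceAs (CompactSpace (Quotient (A.orbitSetoid Γ)))

lemma continuous_mk : Continuous (mk : X.M → A.OrbitSpace Γ h) := continuous_quotient_mk'

variable [Finite G]

instance : T2Space (A.OrbitSpace Γ h) := by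
  let := A.subgroupAction Γ
  have : ContinuousConstSMul Γ X.M := ⟨fun γ => (A.contMDiff_act γ).continuous⟩
  exact t2Space_of_properlyDiscontinuousSMul_of_t2Space (Γ := Γ) (T := X.M)

/-- A finite group acts properly discontinuously; together with freeness the projection is a
covering. -/
lemma isLocalHomeomorph_mk : IsLocalHomeomorph (mk : X.M → A.OrbitSpace Γ h) := by
  let := A.subgroupAction Γ
  have : ContinuousConstSMul Γ X.M := ⟨fun γ => (A.contMDiff_act γ).continuous⟩
  have : IsCancelSMul Γ X.M := ⟨fun γ γ' x hx => by
    have h1 : A.act (γ'⁻¹ * γ : G) x = x := by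
      rw [A.act_mul, show A.act γ x = A.act γ' x from hx]
      exact A.act_inv_act _ _
    have h2 := h _ (Γ.mul_mem (Γ.inv_mem γ'.2) γ.2) x h1
    exact Subtype.ext (inv_mul_eq_one.1 h2).symm⟩
  exact (isQuotientCoveringMap_quotientMk_of_properlyDiscontinuousSMul
    (G := Γ) (E := X.M)).isCoveringMap.isLocalHomeomorph

/-- The chart at an orbit is the chart of M at the chosen representative, composed with the local
section through that representative. -/
instance : ChartedSpace E (A.OrbitSpace Γ h) :=
  isLocalHomeomorph_mk.chartedSpaceOfRightInverse (f := mk) (g := out) mk_out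

/-- The local section of the projection to the orbit space through the point `x`. -/
def localSection (x : X.M) : OpenPartialHomeomorph (A.OrbitSpace Γ h) X.M :=
  isLocalHomeomorph_mk.localInverseAt x

lemma mk_localSection {x : X.M} {y : A.OrbitSpace Γ h} (hy : y ∈ (localSection x).source) :
    mk (localSection x y) = y :=
  isLocalHomeomorph_mk.apply_localInverseAt_of_mem hy

lemma mem_localSection_source (x : X.M) :
    mk x ∈ (localSection x : OpenPartialHomeomorph (A.OrbitSpace Γ h) X.M).source :=
  isLocalHomeomorph_mk.apply_self_mem_localInverseAt_source

lemma localSection_mk (x : X.M) :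
    (localSection x : OpenPartialHomeomorph (A.OrbitSpace Γ h) X.M) (mk x) = x :=
  isLocalHomeomorph_mk.localInverseAt_apply_self

lemma localSection_symm (x : X.M) :
    ⇑(localSection x : OpenPartialHomeomorph (A.OrbitSpace Γ h) X.M).symm = mk :=
  IsLocalHomeomorph.localInverseAt_symm (x := x) isLocalHomeomorph_mk

lemma mem_localSection_out_source (y : A.OrbitSpace Γ h) : y ∈ (localSection (out y)).source := by
  have := mem_localSection_source (h := h) (out y)
  rwa [mk_out] at this

lemma localSection_out (y : A.OrbitSpace Γ h) : localSection (out y) y = out y := by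
  have := localSection_mk (h := h) (out y)
  rwa [mk_out] at this

variable (h) in
/-- Two maps which agree in the orbit space differ locally by an element of the group. -/
lemma eventually_act_eq {T : Type*} [TopologicalSpace T] {f g : T → X.M} {t : T}
    (hf : ContinuousAt f t) (hg : ContinuousAt g t)
    (hfg : ∀ᶠ s in 𝓝 t, (mk (f s) : A.OrbitSpace Γ h) = mk (g s)) {γ : G} (hγ : γ ∈ Γ)
    (ht : A.act γ (f t) = g t) : ∀ᶠ s in 𝓝 t, A.act γ (f s) = g s := by
  -- The projection is injective on the target of the local section through g(t). Near t this target
  -- contains both γ f(s) and g(s), which have the same orbit.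
  have hU := (localSection (h := h) (g t)).open_target.mem_nhds
    (isLocalHomeomorph_mk.self_mem_localInverseAt_target)
  have hf' : ContinuousAt (fun s => A.act γ (f s)) t :=
    (A.contMDiff_act γ).continuous.continuousAt.comp hf
  filter_upwards [hfg, hg hU, hf'.preimage_mem_nhds (t := (localSection (h := h) (g t)).target) (by rwa [ht])] with s h1 h2 h3
  refine isLocalHomeomorph_mk.injOn_localInverseAt_target (x := g t) h3 h2 ?_
  exact (mk_act (h := h) hγ _).trans h1

lemma chartAt_apply (y y' : A.OrbitSpace Γ h) :
    chartAt E y y' = chartAt E (out y) (localSection (out y) y') := rfl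

/-- Local sections depend on choices, but after composition with the projection they are locally the
action of one element of Γ. Smoothness and derivatives are then those of the action. -/
lemma eventually_localSection_mk {a : X.M} {x : X.M}
    (hx : (mk x : A.OrbitSpace Γ h) ∈ (localSection a).source) :
    ∃ γ ∈ Γ, A.act γ x = (localSection a : OpenPartialHomeomorph (A.OrbitSpace Γ h) X.M) (mk x) ∧
      ∀ᶠ x' in 𝓝 x, A.act γ x' =
        (localSection a : OpenPartialHomeomorph (A.OrbitSpace Γ h) X.M) (mk x') := by
  obtain ⟨γ, hγ, hγx⟩ := mk_eq_iff.1 (mk_localSection hx).symm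
  refine ⟨γ, hγ, hγx, eventually_act_eq h (f := fun x' => x') (g := fun x' => localSection a (mk x'))
    continuousAt_id (((localSection a).continuousAt hx).comp continuous_mk.continuousAt) ?_ hγ hγx⟩
  filter_upwards [continuous_mk.continuousAt.preimage_mem_nhds
    ((localSection a).open_source.mem_nhds hx)] with x' hx'
  exact (mk_localSection hx').symm

lemma contMDiffAt_localSection_comp_mk {a : X.M} {x : X.M}
    (hx : (mk x : A.OrbitSpace Γ h) ∈ (localSection a).source) :
    ContMDiffAt 𝓘(ℝ, E) 𝓘(ℝ, E) ∞
      (fun x' => (localSection a : OpenPartialHomeomorph (A.OrbitSpace Γ h) X.M) (mk x')) x := by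
  obtain ⟨γ, -, -, hγ⟩ := eventually_localSection_mk hx
  exact (A.contMDiff_act γ).contMDiffAt.congr_of_eventuallyEq (hγ.mono fun _ h => h.symm)

instance : IsManifold 𝓘(ℝ, E) ∞ (A.OrbitSpace Γ h) := by
  refine isManifold_of_contDiffOn _ _ _ ?_
  rintro _ _ ⟨a, rfl⟩ ⟨b, rfl⟩
  rw [← contMDiffOn_iff_contDiffOn]
  intro p hp
  refine ContMDiffAt.contMDiffWithinAt ?_
  obtain ⟨⟨hp1, hp2⟩, -⟩ := hp
  have h1 : p ∈ (chartAt E (out a)).target := hp1.1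
  have h2 : (localSection (h := h) (out a)).symm ((chartAt E (out a)).symm p) ∈
      ((localSection (h := h) (out b)).trans (chartAt E (out b))).source := hp2
  rw [localSection_symm] at h2
  have h3 : (mk ((chartAt E (out a)).symm p) : A.OrbitSpace Γ h) ∈ (localSection (out b)).source :=
    h2.1
  have h4 : localSection (h := h) (out b) (mk ((chartAt E (out a)).symm p))
      ∈ (chartAt E (out b)).source := h2.2
  have hc := (contMDiffOn_chart_symm (I := 𝓘(ℝ, E)) (n := ∞) (x := out a)).contMDiffAt
    ((chartAt E (out a)).open_target.mem_nhds h1)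
  have hd := (contMDiffOn_chart (I := 𝓘(ℝ, E)) (n := ∞) (x := out b)).contMDiffAt
    ((chartAt E (out b)).open_source.mem_nhds h4)
  have hm := hd.comp p ((contMDiffAt_localSection_comp_mk h3).comp p hc)
  refine hm.congr_of_eventuallyEq (Filter.Eventually.of_forall fun p' => ?_)
  change chartAt E (out b) (localSection (h := h) (out b)
    ((localSection (h := h) (out a)).symm ((chartAt E (out a)).symm p'))) = _
  rw [localSection_symm]
  rfl

lemma contMDiff_mk : ContMDiff 𝓘(ℝ, E) 𝓘(ℝ, E) ∞ (mk : X.M → A.OrbitSpace Γ h) := by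
  intro x
  rw [contMDiffAt_iff_target]
  refine ⟨continuous_mk.continuousAt, ?_⟩
  have hd : ContMDiffAt 𝓘(ℝ, E) 𝓘(ℝ, E) ∞ (chartAt E (out (mk x : A.OrbitSpace Γ h)))
      (localSection (out (mk x : A.OrbitSpace Γ h)) (mk x : A.OrbitSpace Γ h)) := by
    rw [localSection_out]
    exact contMDiffAt_extChartAt
  exact ContMDiffAt.comp x (g := chartAt E (out (mk x : A.OrbitSpace Γ h)))
    (f := fun x' => localSection (out (mk x : A.OrbitSpace Γ h)) (mk x' : A.OrbitSpace Γ h)) hd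
    (contMDiffAt_localSection_comp_mk (mem_localSection_out_source _))

/-- For the section through the representative of y this holds because the chart at y is built from
it. Any other section is, near y, that one followed by the projection and the other section. -/
lemma contMDiffOn_localSection (x : X.M) : ContMDiffOn 𝓘(ℝ, E) 𝓘(ℝ, E) ∞
    (localSection x : OpenPartialHomeomorph (A.OrbitSpace Γ h) X.M) (localSection x).source := by
  intro y hy
  refine ContMDiffAt.contMDiffWithinAt ?_
  have h0 := mem_localSection_out_source y
  have h1 := localSection_out y
  have hs : ContMDiffAt 𝓘(ℝ, E) 𝓘(ℝ, E) ∞ (localSection (h := h) (out y)) y := by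
    have hc : ContMDiffAt 𝓘(ℝ, E) 𝓘(ℝ, E) ∞ (chartAt E y) y := contMDiffAt_extChartAt
    have hc' : ContMDiffAt 𝓘(ℝ, E) 𝓘(ℝ, E) ∞ (chartAt E (out y)).symm (chartAt E y y) := by
      refine contMDiffOn_chart_symm.contMDiffAt ((chartAt E (out y)).open_target.mem_nhds ?_)
      rw [chartAt_apply, h1]
      exact mem_chart_target E (out y)
    refine (hc'.comp y hc).congr_of_eventuallyEq ?_
    filter_upwards [(localSection (h := h) (out y)).continuousAt h0
      ((chartAt E (out y)).open_source.mem_nhds (by rw [h1]; exact mem_chart_source E (out y)))]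
      with y' hy'
    rw [Function.comp_apply, chartAt_apply, (chartAt E (out y)).left_inv hy']
  have h2 : (mk (localSection (h := h) (out y) y) : A.OrbitSpace Γ h) ∈ (localSection x).source := by
    rwa [h1, mk_out]
  refine ((contMDiffAt_localSection_comp_mk h2).comp y hs).congr_of_eventuallyEq ?_
  filter_upwards [(localSection (h := h) (out y)).open_source.mem_nhds h0] with y' hy'
  rw [Function.comp_apply, mk_localSection hy']

lemma isLocalDiffeomorph_mk :
    IsLocalDiffeomorph 𝓘(ℝ, E) 𝓘(ℝ, E) ∞ (mk : X.M → A.OrbitSpace Γ h) := by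
  intro x
  have hs := localSection_symm (h := h) x
  refine ⟨{ (localSection (h := h) x).symm with
    contMDiffOn_toFun := ?_
    contMDiffOn_invFun := ?_ }, isLocalHomeomorph_mk.self_mem_localInverseAt_target, ?_⟩
  · exact (hs ▸ contMDiff_mk.contMDiffOn :)
  · exact contMDiffOn_localSection x
  · intro x' _
    exact (congrFun hs x').symm

end OrbitSpace

end BundleAction

end OrbitSpace

/-! ### The quotient line bundle -/

section QuotientBundle

variable {E : Type w} [NormedAddCommGroup E] [NormedSpace ℝ E]
  {X : LineBundleWithConnection.{u, v, w} E} {G : Type z} [Group G]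

namespace BundleAction

/-- The action of `g` on a fibre, with a prescribed target point. -/
def fiberMap (A : BundleAction G X) (g : G) {x x' : X.M} (hx : A.act g x = x') :
    X.L x ≃ₗ[ℂ] X.L x' :=
  hx ▸ (A.connectionMap g).onFiber x

lemma mk_fiberMap (A : BundleAction G X) (g : G) {x x' : X.M} (hx : A.act g x = x') (v : X.L x) :
    (⟨x', A.fiberMap g hx v⟩ : TotalSpace ℂ X.L) = A.actTotal g ⟨x, v⟩ := by
  subst hx
  exact (A.actTotal_mk g x v).symm

/-- The fibres of the quotient line bundle. -/
def Fiber (A : BundleAction G X) (Γ : Subgroup G) (h : A.ActsFreely Γ) (y : A.OrbitSpace Γ h) :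
    Type v :=
  X.L (OrbitSpace.out y)

namespace OrbitSpace

variable {A : BundleAction G X} {Γ : Subgroup G} {h : A.ActsFreely Γ}

instance (y : A.OrbitSpace Γ h) : NormedAddCommGroup (A.Fiber Γ h y) := X.normedL (out y)

instance (y : A.OrbitSpace Γ h) : InnerProductSpace ℂ (A.Fiber Γ h y) := X.innerL (out y)

variable (h) in
lemma exists_act_eq_out (x : X.M) : ∃ γ ∈ Γ, A.act γ x = out (mk x : A.OrbitSpace Γ h) :=
  mk_eq_iff.1 (mk_out (mk x : A.OrbitSpace Γ h)).symm

variable (h) in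
/-- The group element that moves a point to the representative of its orbit. -/
def toOut (x : X.M) : G := (exists_act_eq_out h x).choose

variable (h) in
lemma toOut_mem (x : X.M) : toOut h x ∈ Γ := (exists_act_eq_out h x).choose_spec.1

variable (h) in
lemma act_toOut (x : X.M) : A.act (toOut h x) x = out (mk x : A.OrbitSpace Γ h) :=
  (exists_act_eq_out h x).choose_spec.2

variable (h) in
/-- The projection to the quotient bundle, fibre by fibre. -/
def lift (x : X.M) : X.L x ≃ₗ[ℂ] A.Fiber Γ h (mk x) := A.fiberMap (toOut h x) (act_toOut h x)

variable (h) in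
/-- The projection to the total space of the quotient bundle. -/
def liftTotal (p : TotalSpace ℂ X.L) : TotalSpace ℂ (A.Fiber Γ h) := ⟨mk p.1, lift h p.1 p.2⟩

/-- The representative of an orbit in the total space. -/
def outTotal (p : TotalSpace ℂ (A.Fiber Γ h)) : TotalSpace ℂ X.L := ⟨out p.1, p.2⟩

/-- Identities in the quotient bundle can thus be verified in the total space of L, where G acts. -/
lemma outTotal_injective : Function.Injective (outTotal (A := A) (h := h)) := by
  rintro ⟨y, v⟩ ⟨y', v'⟩ hp
  obtain ⟨h1, h2⟩ := TotalSpace.mk.inj hp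
  have h3 : y = y' := by rw [← mk_out y, ← mk_out y']; exact congrArg mk h1
  subst h3
  exact congrArg (TotalSpace.mk' ℂ y) (eq_of_heq h2)

lemma outTotal_liftTotal (p : TotalSpace ℂ X.L) :
    outTotal (liftTotal h p) = A.actTotal (toOut h p.1) p :=
  A.mk_fiberMap (toOut h p.1) (act_toOut h p.1) p.2

lemma eq_of_act_eq (h : A.ActsFreely Γ) {γ γ' : G} (hγ : γ ∈ Γ) (hγ' : γ' ∈ Γ) {x : X.M}
    (hx : A.act γ x = A.act γ' x) : γ = γ' := by
  have h1 : A.act (γ'⁻¹ * γ) x = x := by rw [A.act_mul, hx, A.act_inv_act]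
  exact (inv_mul_eq_one.1 (h _ (Γ.mul_mem (Γ.inv_mem hγ') hγ) x h1)).symm

lemma actTotal_fst (g : G) (p : TotalSpace ℂ X.L) : (A.actTotal g p).1 = A.act g p.1 :=
  congrArg TotalSpace.proj (A.actTotal_mk g p.1 p.2)

/-- Freeness makes the element moving a point to its representative unique, so the elements chosen
for p and for γ p differ exactly by γ. -/
lemma liftTotal_eq_iff {p q : TotalSpace ℂ X.L} :
    liftTotal h p = liftTotal h q ↔ ∃ γ ∈ Γ, A.actTotal γ p = q := by
  rw [← outTotal_injective.eq_iff, outTotal_liftTotal, outTotal_liftTotal]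
  constructor
  · intro hpq
    refine ⟨(toOut h q.1)⁻¹ * toOut h p.1,
      Γ.mul_mem (Γ.inv_mem (toOut_mem h _)) (toOut_mem h _), ?_⟩
    rw [A.actTotal_mul, hpq, ← A.actTotal_mul, inv_mul_cancel, A.actTotal_one]
  · rintro ⟨γ, hγ, rfl⟩
    rw [← A.actTotal_mul]
    congr 1
    refine eq_of_act_eq h (toOut_mem h _) (Γ.mul_mem (toOut_mem h _) hγ) (x := p.1) ?_
    rw [A.act_mul, ← actTotal_fst γ p, act_toOut, act_toOut, actTotal_fst, mk_act hγ]

lemma liftTotal_actTotal {γ : G} (hγ : γ ∈ Γ) (p : TotalSpace ℂ X.L) :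
    liftTotal h (A.actTotal γ p) = liftTotal h p :=
  (liftTotal_eq_iff.2 ⟨γ, hγ, rfl⟩).symm

lemma liftTotal_outTotal (p : TotalSpace ℂ (A.Fiber Γ h)) : liftTotal h (outTotal p) = p := by
  apply outTotal_injective
  rw [outTotal_liftTotal]
  have h1 : toOut h (outTotal p).1 = 1 := by
    refine eq_of_act_eq h (toOut_mem h _) Γ.one_mem (x := (outTotal p).1) ?_
    rw [act_toOut, A.act_one]
    exact congrArg out (mk_out p.1)
  rw [h1, A.actTotal_one]

lemma eq_of_liftTotal_eq {p q : TotalSpace ℂ X.L} (h1 : p.1 = q.1)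
    (h2 : liftTotal h p = liftTotal h q) : p = q := by
  obtain ⟨x, v⟩ := p
  obtain ⟨x', v'⟩ := q
  dsimp only at h1
  subst h1
  exact congrArg (TotalSpace.mk' ℂ x) ((lift h x).injective (eq_of_heq (TotalSpace.mk.inj h2).2))

variable [Finite G]

/-- The domain of the trivialization of the quotient bundle around `b`. -/
def baseSet (b : A.OrbitSpace Γ h) : Set (A.OrbitSpace Γ h) :=
  (localSection (out b)).source ∩ localSection (out b) ⁻¹' (trivializationAt ℂ X.L (out b)).baseSet

/-- The group element that moves the representative of an orbit to a local section. -/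
def toSection (b y : A.OrbitSpace Γ h) : G :=
  -- The value is arbitrary outside `baseSet b`; inside, a suitable element exists.
  Classical.epsilon fun g => g ∈ Γ ∧ A.act g (out y) = localSection (out b) y

lemma toSection_spec {b y : A.OrbitSpace Γ h} (hy : y ∈ baseSet b) :
    toSection b y ∈ Γ ∧ A.act (toSection b y) (out y) = localSection (out b) y := by
  refine Classical.epsilon_spec (p := fun g => g ∈ Γ ∧ A.act g (out y) = localSection (out b) y) ?_
  exact mk_eq_iff.1 ((mk_out y).trans (mk_localSection hy.1).symm)

lemma act_toSection_mem {b y : A.OrbitSpace Γ h} (hy : y ∈ baseSet b) :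
    A.act (toSection b y) (out y) ∈ (trivializationAt ℂ X.L (out b)).baseSet := by
  rw [(toSection_spec hy).2]
  exact hy.2

/-- The identification of a fibre of the quotient bundle with the fibre over a local section. -/
def fiberMove (b y : A.OrbitSpace Γ h) :
    A.Fiber Γ h y ≃ₗ[ℂ] X.L (A.act (toSection b y) (out y)) :=
  (A.connectionMap (toSection b y)).onFiber (out y)

lemma mk_fiberMove (b y : A.OrbitSpace Γ h) (v : A.Fiber Γ h y) :
    (⟨A.act (toSection b y) (out y), fiberMove b y v⟩ : TotalSpace ℂ X.L)
      = A.actTotal (toSection b y) (outTotal ⟨y, v⟩) :=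
  (A.actTotal_mk (toSection b y) (out y) v).symm

/-- The fibre coordinate of the quotient bundle. -/
def fiberCoord (b y : A.OrbitSpace Γ h) : A.Fiber Γ h y →ₗ[ℂ] ℂ :=
  coord X.L (out b) (A.act (toSection b y) (out y)) ∘ₗ (fiberMove b y).toLinearMap

/-- The local frame of the quotient bundle. -/
def fiberFrame (b y : A.OrbitSpace Γ h) : A.Fiber Γ h y :=
  (fiberMove b y).symm (frame X.L (out b) (A.act (toSection b y) (out y)))

/-- The element in the definition of `fiberCoord` is chosen pointwise, without continuity in y. The
coordinate may instead be computed from any vector p of L over the local section that projects to v,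
and p can be chosen smoothly. -/
lemma fiberCoord_eq {b y : A.OrbitSpace Γ h} (hy : y ∈ baseSet b) {v : A.Fiber Γ h y}
    {p : TotalSpace ℂ X.L} (h1 : p.1 = localSection (out b) y) (h2 : liftTotal h p = ⟨y, v⟩) :
    fiberCoord b y v = (trivializationAt ℂ X.L (out b) p).2 := by
  have hp : p = A.actTotal (toSection b y) (outTotal ⟨y, v⟩) := by
    refine eq_of_liftTotal_eq (h := h) ?_ ?_
    · rw [h1, actTotal_fst]
      exact (toSection_spec hy).2.symm
    · rw [h2, liftTotal_actTotal (toSection_spec hy).1, liftTotal_outTotal]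
  rw [hp, ← mk_fiberMove]
  exact coord_eq (act_toSection_mem hy) _

lemma liftTotal_frame {b y : A.OrbitSpace Γ h} (hy : y ∈ baseSet b) :
    liftTotal h ⟨localSection (out b) y, frame X.L (out b) (localSection (out b) y)⟩
      = ⟨y, fiberFrame b y⟩ := by
  rw [← liftTotal_outTotal ⟨y, fiberFrame b y⟩,
    ← liftTotal_actTotal (toSection_spec hy).1 (outTotal ⟨y, fiberFrame b y⟩)]
  rw [← mk_fiberMove, fiberFrame, LinearEquiv.apply_symm_apply, (toSection_spec hy).2]

/-- Near y the two local sections differ by one fixed γ. The transition function is then the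
coordinate in L of γ applied to the frame along the first section. -/
lemma contMDiffOn_fiberCoord_fiberFrame (b b' : A.OrbitSpace Γ h) :
    ContMDiffOn 𝓘(ℝ, E) 𝓘(ℝ, ℂ) ∞ (fun y => fiberCoord b' y (fiberFrame b y))
      (baseSet b ∩ baseSet b') := by
  intro y hy
  refine ContMDiffAt.contMDiffWithinAt ?_
  have hs := (contMDiffOn_localSection (h := h) (out b)).contMDiffAt
    ((localSection (out b)).open_source.mem_nhds hy.1.1)
  have hs' := (contMDiffOn_localSection (h := h) (out b')).contMDiffAt
    ((localSection (out b')).open_source.mem_nhds hy.2.1)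
  obtain ⟨γ, hγ, hγy⟩ := mk_eq_iff.1
    ((mk_localSection (h := h) hy.1.1).trans (mk_localSection hy.2.1).symm)
  have hev := eventually_act_eq h hs.continuousAt hs'.continuousAt (by
    filter_upwards [(localSection (out b)).open_source.mem_nhds hy.1.1,
      (localSection (out b')).open_source.mem_nhds hy.2.1] with z hz hz'
    rw [mk_localSection hz, mk_localSection hz']) hγ hγy
  have hf : ContMDiffAt 𝓘(ℝ, E) (𝓘(ℝ, E).prod 𝓘(ℝ, ℂ)) ∞
      (fun z => A.actTotal γ ⟨localSection (out b) z, frame X.L (out b) (localSection (out b) z)⟩)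
      y :=
    (A.smooth_total γ).contMDiffAt.comp y ((((contMDiffOn_frame (E := E) (L := X.L)
      (out b)).contMDiffAt ((trivializationAt ℂ X.L (out b)).open_baseSet.mem_nhds hy.1.2))).comp
        y hs)
  have hmem : A.actTotal γ ⟨localSection (out b) y, frame X.L (out b) (localSection (out b) y)⟩
      ∈ (trivializationAt ℂ X.L (out b')).source := by
    rw [Trivialization.mem_source, actTotal_fst, hγy]
    exact hy.2.2
  refine ((Trivialization.contMDiffAt_iff (f := fun z => A.actTotal γ
    ⟨localSection (out b) z, frame X.L (out b) (localSection (out b) z)⟩) hmem).1 hf).2.congr_of_eventuallyEq ?_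
  have ho (c : A.OrbitSpace Γ h) : IsOpen (baseSet c) :=
    (localSection (out c)).isOpen_inter_preimage (trivializationAt ℂ X.L (out c)).open_baseSet
  filter_upwards [hev, (ho b).mem_nhds hy.1, (ho b').mem_nhds hy.2] with z hz hz1 hz2
  refine fiberCoord_eq hz2 ?_ ?_
  · rw [actTotal_fst, hz]
  · rw [liftTotal_actTotal hγ, liftTotal_frame hz1]

variable (A Γ h) in
/-- The local trivializations of the quotient bundle. -/
def lineAtlas : LineAtlas E (A.Fiber Γ h) where
  baseSet := baseSet
  isOpen_baseSet b :=
    (localSection (out b)).isOpen_inter_preimage (trivializationAt ℂ X.L (out b)).open_baseSet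
  mem_baseSet b := ⟨mem_localSection_out_source b, by
    rw [Set.mem_preimage, localSection_out]
    exact FiberBundle.mem_baseSet_trivializationAt' (out b)⟩
  coord := fiberCoord
  frame := fiberFrame
  coord_frame hy := by
    rw [fiberCoord, fiberFrame, LinearMap.comp_apply, LinearEquiv.coe_coe,
      LinearEquiv.apply_symm_apply, SunadaLine.coord_frame (act_toSection_mem hy)]
  coord_smul_frame v hy := by
    rw [fiberCoord, fiberFrame, LinearMap.comp_apply, LinearEquiv.coe_coe, ← map_smul]
    refine (LinearEquiv.symm_apply_eq _).2 ?_
    exact SunadaLine.coord_smul_frame (act_toSection_mem hy) _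
  contMDiffOn_transition := contMDiffOn_fiberCoord_fiberFrame

instance : TopologicalSpace (TotalSpace ℂ (A.Fiber Γ h)) := (lineAtlas A Γ h).totalSpaceTopology

instance : FiberBundle ℂ (A.Fiber Γ h) := (lineAtlas A Γ h).fiberBundle

instance : VectorBundle ℂ ℂ (A.Fiber Γ h) := (lineAtlas A Γ h).complexVectorBundle

instance : VectorBundle ℝ ℂ (A.Fiber Γ h) := (lineAtlas A Γ h).realVectorBundle

instance : ContMDiffVectorBundle ∞ ℂ (A.Fiber Γ h) 𝓘(ℝ, E) := (lineAtlas A Γ h).contMDiffVectorBundle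

/-- Near p the fibre coordinate of the projection is the fibre coordinate in L of γ q, for one fixed
γ. -/
lemma contMDiff_liftTotal :
    ContMDiff (𝓘(ℝ, E).prod 𝓘(ℝ, ℂ)) (𝓘(ℝ, E).prod 𝓘(ℝ, ℂ)) ∞ (liftTotal (A := A) h) := by
  intro p
  rw [contMDiffAt_totalSpace]
  have hproj : ContMDiffAt (𝓘(ℝ, E).prod 𝓘(ℝ, ℂ)) 𝓘(ℝ, E) ∞
      (fun q : TotalSpace ℂ X.L => q.1) p := (contMDiff_proj X.L).contMDiffAt
  have hmk : ContMDiffAt (𝓘(ℝ, E).prod 𝓘(ℝ, ℂ)) 𝓘(ℝ, E) ∞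
      (fun q : TotalSpace ℂ X.L => (mk q.1 : A.OrbitSpace Γ h)) p :=
    contMDiff_mk.contMDiffAt.comp p hproj
  refine ⟨hmk, ?_⟩
  set b : A.OrbitSpace Γ h := mk p.1 with hb
  have hbb : b ∈ baseSet b := (lineAtlas A Γ h).mem_baseSet b
  obtain ⟨γ, hγ, hγp, hev⟩ := eventually_localSection_mk (h := h) (a := out b) (x := p.1) hbb.1
  have hmem : A.actTotal γ p ∈ (trivializationAt ℂ X.L (out b)).source := by
    rw [Trivialization.mem_source, actTotal_fst, hγp]
    exact hbb.2
  refine ((Trivialization.contMDiffAt_iff hmem).1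
    (A.smooth_total γ).contMDiffAt).2.congr_of_eventuallyEq ?_
  filter_upwards [hproj.continuousAt.eventually hev, hmk.continuousAt.preimage_mem_nhds
    (((lineAtlas A Γ h).isOpen_baseSet b).mem_nhds hbb)] with q hq hq'
  refine fiberCoord_eq (p := A.actTotal γ q) hq' ?_ ?_
  · rw [actTotal_fst, hq]
  · rw [liftTotal_actTotal hγ]
    rfl

end OrbitSpace

end BundleAction

end QuotientBundle

/-! ### Smoothness of homomorphisms tested on sections -/

section HomBundle

/-- A map into a space of continuous linear maps with finite-dimensional domain is smooth if all
its evaluations are. -/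
lemma contMDiffAt_clm_of_apply {E : Type*} [NormedAddCommGroup E] [NormedSpace ℝ E]
    {M : Type*} [TopologicalSpace M] [ChartedSpace E M]
    {F₁ F₂ : Type*} [NormedAddCommGroup F₁] [NormedSpace ℝ F₁] [FiniteDimensional ℝ F₁]
    [NormedAddCommGroup F₂] [NormedSpace ℝ F₂] {n : ℕ∞ω} {f : M → F₁ →L[ℝ] F₂} {x : M}
    (hf : ∀ v, ContMDiffAt 𝓘(ℝ, E) 𝓘(ℝ, F₂) n (fun y => f y v) x) :
    ContMDiffAt 𝓘(ℝ, E) 𝓘(ℝ, F₁ →L[ℝ] F₂) n f x := by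
  have hd : finrank ℝ F₁ = finrank ℝ (Fin (finrank ℝ F₁) → ℝ) := (finrank_fin_fun ℝ).symm
  let e₁ := ContinuousLinearEquiv.ofFinrankEq hd
  let e₂ := (e₁.arrowCongr (1 : F₂ ≃L[ℝ] F₂)).trans
    (ContinuousLinearEquiv.piRing (Fin (finrank ℝ F₁)))
  rw [← Function.id_comp f, ← e₂.symm_comp_self]
  have h1 : ContMDiffAt 𝓘(ℝ, E) 𝓘(ℝ, Fin (finrank ℝ F₁) → F₂) n (e₂ ∘ f) x :=
    contMDiffAt_pi_space.2 fun i => hf _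
  exact e₂.symm.contDiff.contMDiff.contMDiffAt.comp x h1

/-- A section of a bundle of homomorphisms is smooth if it carries smooth sections to smooth
sections. -/
lemma contMDiffAt_hom_of_apply {E : Type*} [NormedAddCommGroup E] [NormedSpace ℝ E]
    {M : Type*} [TopologicalSpace M] [ChartedSpace E M]
    {F₁ : Type*} [NormedAddCommGroup F₁] [NormedSpace ℝ F₁] [FiniteDimensional ℝ F₁]
    {V₁ : M → Type*} [TopologicalSpace (TotalSpace F₁ V₁)] [∀ x, AddCommGroup (V₁ x)]
    [∀ x, Module ℝ (V₁ x)] [∀ x, TopologicalSpace (V₁ x)] [FiberBundle F₁ V₁]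
    [VectorBundle ℝ F₁ V₁]
    {F₂ : Type*} [NormedAddCommGroup F₂] [NormedSpace ℝ F₂]
    {V₂ : M → Type*} [TopologicalSpace (TotalSpace F₂ V₂)] [∀ x, AddCommGroup (V₂ x)]
    [∀ x, Module ℝ (V₂ x)] [∀ x, TopologicalSpace (V₂ x)] [FiberBundle F₂ V₂]
    [VectorBundle ℝ F₂ V₂]
    [∀ x, IsTopologicalAddGroup (V₂ x)] [∀ x, ContinuousSMul ℝ (V₂ x)]
    {n : ℕ∞ω} [ContMDiffVectorBundle n F₁ V₁ 𝓘(ℝ, E)]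
    {φ : ∀ x, V₁ x →L[ℝ] V₂ x} {x₀ : M}
    (hφ : ∀ s : ∀ x, V₁ x, ContMDiffAt 𝓘(ℝ, E) (𝓘(ℝ, E).prod 𝓘(ℝ, F₁)) n
        (fun x => TotalSpace.mk' F₁ x (s x)) x₀ →
      ContMDiffAt 𝓘(ℝ, E) (𝓘(ℝ, E).prod 𝓘(ℝ, F₂)) n
        (fun x => TotalSpace.mk' F₂ x (φ x (s x))) x₀) :
    ContMDiffAt 𝓘(ℝ, E) (𝓘(ℝ, E).prod 𝓘(ℝ, F₁ →L[ℝ] F₂)) n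
      (fun x => TotalSpace.mk' (F₁ →L[ℝ] F₂) (E := fun x => V₁ x →L[ℝ] V₂ x) x (φ x)) x₀ := by
  rw [contMDiffAt_hom_bundle]
  refine ⟨contMDiffAt_id, contMDiffAt_clm_of_apply fun v => ?_⟩
  have h₁ : (trivializationAt F₁ V₁ x₀).baseSet ∈ 𝓝 x₀ :=
    (trivializationAt F₁ V₁ x₀).open_baseSet.mem_nhds
      (FiberBundle.mem_baseSet_trivializationAt' x₀)
  have h₂ : (trivializationAt F₂ V₂ x₀).baseSet ∈ 𝓝 x₀ :=
    (trivializationAt F₂ V₂ x₀).open_baseSet.mem_nhds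
      (FiberBundle.mem_baseSet_trivializationAt' x₀)
  -- The test section is constant in the trivialization around x₀.
  have hs : ContMDiffAt 𝓘(ℝ, E) (𝓘(ℝ, E).prod 𝓘(ℝ, F₁)) n
      (fun x => TotalSpace.mk' F₁ x ((trivializationAt F₁ V₁ x₀).symm x v)) x₀ := by
    rw [contMDiffAt_totalSpace]
    refine ⟨contMDiffAt_id, contMDiffAt_const (c := v) |>.congr_of_eventuallyEq ?_⟩
    filter_upwards [h₁] with x hx
    exact congrArg Prod.snd ((trivializationAt F₁ V₁ x₀).apply_mk_symm hx v)
  refine (contMDiffAt_totalSpace.1 (hφ _ hs)).2.congr_of_eventuallyEq ?_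
  filter_upwards [h₁, h₂] with x hx₁ hx₂
  simp only [ContinuousLinearMap.inCoordinates_eq hx₁ hx₂]
  simp

end HomBundle

/-! ### The Riemannian metric on the orbit space -/

section QuotientMetric

variable {E : Type w} [NormedAddCommGroup E] [NormedSpace ℝ E]
  {X : LineBundleWithConnection.{u, v, w} E} {G : Type z} [Group G]

namespace BundleAction

/-- The differential of the action of `g`, with a prescribed target point. -/
def tangentMap (A : BundleAction G X) (g : G) {x x' : X.M} (_hx : A.act g x = x') :
    TangentSpace 𝓘(ℝ, E) x →L[ℝ] TangentSpace 𝓘(ℝ, E) x' :=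
  (mfderiv 𝓘(ℝ, E) 𝓘(ℝ, E) (A.act g) x : _)

lemma inner_tangentMap (A : BundleAction G X) (g : G) {x x' : X.M} (hx : A.act g x = x')
    (u v : TangentSpace 𝓘(ℝ, E) x) :
    inner ℝ (A.tangentMap g hx u) (A.tangentMap g hx v) = inner ℝ u v := by
  subst hx
  exact A.isometry g x u v

lemma conn_tangentMap (A : BundleAction G X) (g : G) {x x' : X.M} (hx : A.act g x = x')
    {s t : Π x, X.L x} (hst : ∀ x, t (A.act g x) = A.onFiber g x (s x))
    (u : TangentSpace 𝓘(ℝ, E) x)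
    (hs : MDifferentiableAt 𝓘(ℝ, E) (𝓘(ℝ, E).prod 𝓘(ℝ, ℂ)) (fun y => TotalSpace.mk' ℂ y (s y)) x) :
    X.conn t x' (A.tangentMap g hx u) = A.fiberMap g hx (X.conn s x u) := by
  subst hx
  exact A.preserves_conn g s t hst x u hs

lemma norm_fiberMap {A : BundleAction G X} {Γ : Subgroup G} (hA : A.PreservesHermitian Γ) {g : G}
    (hg : g ∈ Γ) {x x' : X.M} (hx : A.act g x = x') (v : X.L x) : ‖A.fiberMap g hx v‖ = ‖v‖ := by
  subst hx
  exact hA g hg x v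

namespace OrbitSpace

variable {A : BundleAction G X} {Γ : Subgroup G} {h : A.ActsFreely Γ} [Finite G]

/-- The tangent map of the local section of the orbit space through the representative of `y`. -/
def tangentOut (y : A.OrbitSpace Γ h) :
    TangentSpace 𝓘(ℝ, E) y →L[ℝ] TangentSpace 𝓘(ℝ, E) (out y) :=
  (mfderiv 𝓘(ℝ, E) 𝓘(ℝ, E) (localSection (out y)) y : _)

/-- Near x the local section composed with the projection is the action of some γ, and freeness
identifies γ with `toOut h x`. -/
lemma tangentOut_mfderiv (x : X.M) (u : TangentSpace 𝓘(ℝ, E) x) :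
    tangentOut (mk x : A.OrbitSpace Γ h)
        (mfderiv 𝓘(ℝ, E) 𝓘(ℝ, E) (mk : X.M → A.OrbitSpace Γ h) x u)
      = A.tangentMap (toOut h x) (act_toOut h x) u := by
  have hm := mem_localSection_out_source (mk x : A.OrbitSpace Γ h)
  obtain ⟨γ, hγ, hγx, hev⟩ := eventually_localSection_mk hm
  rw [localSection_out, ← act_toOut h x] at hγx
  obtain rfl := eq_of_act_eq h hγ (toOut_mem h x) hγx
  have h1 : MDifferentiableAt 𝓘(ℝ, E) 𝓘(ℝ, E) (localSection (out (mk x : A.OrbitSpace Γ h)))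
      (mk x : A.OrbitSpace Γ h) :=
    ((contMDiffOn_localSection _).contMDiffAt
      ((localSection _).open_source.mem_nhds hm)).mdifferentiableAt (by simp)
  have h2 : MDifferentiableAt 𝓘(ℝ, E) 𝓘(ℝ, E) (mk : X.M → A.OrbitSpace Γ h) x :=
    contMDiff_mk.contMDiffAt.mdifferentiableAt (by simp)
  have h3 := mfderiv_comp x h1 h2
  have h4 : mfderiv 𝓘(ℝ, E) 𝓘(ℝ, E) (A.act (toOut h x)) x
      = mfderiv 𝓘(ℝ, E) 𝓘(ℝ, E) (localSection (out (mk x : A.OrbitSpace Γ h)) ∘ mk) x :=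
    Filter.EventuallyEq.mfderiv_eq hev
  exact (congrArg (fun B => B u) (h4.trans h3)).symm

lemma isInvertible_mfderiv_mk (x : X.M) :
    (mfderiv 𝓘(ℝ, E) 𝓘(ℝ, E) (mk : X.M → A.OrbitSpace Γ h) x).IsInvertible :=
  ⟨(isLocalDiffeomorph_mk (h := h) x).mfderivToContinuousLinearEquiv (by simp), rfl⟩

lemma exists_mfderiv_mk_eq (x : X.M) (u : TangentSpace 𝓘(ℝ, E) (mk x : A.OrbitSpace Γ h)) :
    ∃ u', mfderiv 𝓘(ℝ, E) 𝓘(ℝ, E) (mk : X.M → A.OrbitSpace Γ h) x u' = u :=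
  (isInvertible_mfderiv_mk x).surjective u

lemma mfderiv_mk_mpullback (V : Π y : A.OrbitSpace Γ h, TangentSpace 𝓘(ℝ, E) y) (x : X.M) :
    mfderiv 𝓘(ℝ, E) 𝓘(ℝ, E) (mk : X.M → A.OrbitSpace Γ h) x
      (VectorField.mpullback 𝓘(ℝ, E) 𝓘(ℝ, E) mk V x) = V (mk x) := by
  rw [VectorField.mpullback_apply]
  exact (isInvertible_mfderiv_mk x).self_apply_inverse _

section Descent

variable {F : Type*} [NormedAddCommGroup F] [NormedSpace ℝ F] {H : Type*} [TopologicalSpace H]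
  {I : ModelWithCorners ℝ F H} {N : Type*} [TopologicalSpace N] [ChartedSpace H N]

/-- A map on the orbit space is smooth if its composition with the projection is. -/
lemma contMDiffAt_of_comp_mk {f : A.OrbitSpace Γ h → N} {x : X.M}
    (hf : ContMDiffAt 𝓘(ℝ, E) I ∞ (fun x' => f (mk x')) x) :
    ContMDiffAt 𝓘(ℝ, E) I ∞ f (mk x) := by
  have hm := (localSection (h := h) x).open_source.mem_nhds (mem_localSection_source x)
  have hs := (contMDiffOn_localSection (h := h) x).contMDiffAt hm
  rw [← localSection_mk (h := h) x] at hf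
  refine (hf.comp _ hs).congr_of_eventuallyEq ?_
  filter_upwards [hm] with y hy
  exact congrArg f (mk_localSection hy).symm

lemma mdifferentiableAt_of_comp_mk {f : A.OrbitSpace Γ h → N} {x : X.M}
    (hf : MDifferentiableAt 𝓘(ℝ, E) I (fun x' => f (mk x')) x) :
    MDifferentiableAt 𝓘(ℝ, E) I f (mk x) := by
  have hm := (localSection (h := h) x).open_source.mem_nhds (mem_localSection_source x)
  have hs := (contMDiffOn_localSection (h := h) x).contMDiffAt hm
  rw [← localSection_mk (h := h) x] at hf
  refine (hf.comp _ (hs.mdifferentiableAt (by simp))).congr_of_eventuallyEq ?_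
  filter_upwards [hm] with y hy
  exact congrArg f (mk_localSection hy).symm

end Descent

/-- The projection also reflects differentiability, so where f is not differentiable both
derivatives are the default value 0. -/
lemma mvfderiv_comp_mk {F : Type*} [NormedAddCommGroup F] [NormedSpace ℝ F]
    (f : A.OrbitSpace Γ h → F) (x : X.M) (u : TangentSpace 𝓘(ℝ, E) x) :
    mvfderiv 𝓘(ℝ, E) (fun x' => f (mk x')) x u
      = mvfderiv 𝓘(ℝ, E) f (mk x)
          (mfderiv 𝓘(ℝ, E) 𝓘(ℝ, E) (mk : X.M → A.OrbitSpace Γ h) x u) := by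
  by_cases hf : MDifferentiableAt 𝓘(ℝ, E) 𝓘(ℝ, F) f (mk x)
  · exact congrArg (fun B => B u)
      (mfderiv_comp x hf (contMDiff_mk.contMDiffAt.mdifferentiableAt (by simp)))
  · have hf' : ¬ MDifferentiableAt 𝓘(ℝ, E) 𝓘(ℝ, F) (fun x' => f (mk x')) x :=
      fun h' => hf (mdifferentiableAt_of_comp_mk h')
    have h1 : mvfderiv 𝓘(ℝ, E) (fun x' => f (mk x')) x = 0 := mfderiv_zero_of_not_mdifferentiableAt hf'
    have h2 : mvfderiv 𝓘(ℝ, E) f (mk x) = 0 := mfderiv_zero_of_not_mdifferentiableAt hf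
    rw [h1, h2]
    rfl

/-- The metric of the orbit space. -/
def metric (y : A.OrbitSpace Γ h) :
    TangentSpace 𝓘(ℝ, E) y →L[ℝ] TangentSpace 𝓘(ℝ, E) y →L[ℝ] ℝ :=
  (ContinuousLinearMap.precomp ℝ (tangentOut y)).comp ((X.riemM.g.inner (out y)).comp (tangentOut y))

lemma metric_apply (y : A.OrbitSpace Γ h) (u v : TangentSpace 𝓘(ℝ, E) y) :
    metric y u v = inner ℝ (tangentOut y u) (tangentOut y v) := rfl

/-- The metric is read at the chosen representative, to which x is moved by an isometry. The
projection is therefore isometric at every point of the orbit. -/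
lemma metric_mfderiv_mk (x : X.M) (u v : TangentSpace 𝓘(ℝ, E) x) :
    metric (mk x : A.OrbitSpace Γ h)
      (mfderiv 𝓘(ℝ, E) 𝓘(ℝ, E) (mk : X.M → A.OrbitSpace Γ h) x u)
      (mfderiv 𝓘(ℝ, E) 𝓘(ℝ, E) (mk : X.M → A.OrbitSpace Γ h) x v) = inner ℝ u v := by
  rw [metric_apply, tangentOut_mfderiv, tangentOut_mfderiv, inner_tangentMap]

variable [FiniteDimensional ℝ E]

lemma contMDiffAt_mpullback_mk {V : Π y : A.OrbitSpace Γ h, TangentSpace 𝓘(ℝ, E) y} {x : X.M}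
    (hV : ContMDiffAt 𝓘(ℝ, E) (𝓘(ℝ, E).prod 𝓘(ℝ, E)) ∞ (fun y => TotalSpace.mk' E y (V y))
      (mk x)) :
    ContMDiffAt 𝓘(ℝ, E) (𝓘(ℝ, E).prod 𝓘(ℝ, E)) ∞
      (fun x => TotalSpace.mk' E x (VectorField.mpullback 𝓘(ℝ, E) 𝓘(ℝ, E) mk V x)) x := by
  have := ContMDiffWithinAt.mpullback_vectorField_preimage (t := Set.univ) hV.contMDiffWithinAt
    contMDiff_mk.contMDiffAt (isInvertible_mfderiv_mk x) (m := ∞) (n := ∞) (by simp)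
  simpa using! this

/-- Tested on smooth fields V and W, the metric pulls back to the inner product of their pull-backs
to M, which is smooth, and smooth functions descend. -/
lemma contMDiff_metric : ContMDiff 𝓘(ℝ, E) (𝓘(ℝ, E).prod 𝓘(ℝ, E →L[ℝ] E →L[ℝ] ℝ)) ∞
    (fun y : A.OrbitSpace Γ h => TotalSpace.mk' (E →L[ℝ] E →L[ℝ] ℝ)
      (E := fun y : A.OrbitSpace Γ h =>
        TangentSpace 𝓘(ℝ, E) y →L[ℝ] TangentSpace 𝓘(ℝ, E) y →L[ℝ] ℝ) y (metric y)) := by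
  intro y
  obtain ⟨x, rfl⟩ := mk_surjective y
  refine contMDiffAt_hom_of_apply fun V hV => ?_
  refine contMDiffAt_hom_of_apply (V₂ := Bundle.Trivial (A.OrbitSpace Γ h) ℝ) fun W hW => ?_
  rw [contMDiffAt_totalSpace]
  refine ⟨contMDiffAt_id, ?_⟩
  refine contMDiffAt_of_comp_mk (f := fun y => metric y (V y) (W y)) ?_
  have hi : ContMDiffAt 𝓘(ℝ, E) 𝓘(ℝ, ℝ) ∞
      (fun x' : X.M => inner ℝ (VectorField.mpullback 𝓘(ℝ, E) 𝓘(ℝ, E) mk V x')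
        (VectorField.mpullback 𝓘(ℝ, E) 𝓘(ℝ, E) mk W x')) x :=
    ContMDiffAt.inner_bundle (E := fun x : X.M => TangentSpace 𝓘(ℝ, E) x) 
      (contMDiffAt_mpullback_mk hV) (contMDiffAt_mpullback_mk hW)
  refine hi.congr_of_eventuallyEq (Filter.Eventually.of_forall fun x' => ?_)
  dsimp only
  rw [← metric_mfderiv_mk (h := h), mfderiv_mk_mpullback, mfderiv_mk_mpullback]

variable (A Γ h) in
/-- The Riemannian metric of the orbit space. -/
def riemannianMetric : ContMDiffRiemannianMetric 𝓘(ℝ, E) ∞ E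
    (fun y : A.OrbitSpace Γ h => TangentSpace 𝓘(ℝ, E) y) where
  inner := metric
  symm y u v := real_inner_comm (tangentOut y v) (tangentOut y u)
  pos y u hu := by
    obtain ⟨x, rfl⟩ := mk_surjective y
    obtain ⟨u, rfl⟩ := exists_mfderiv_mk_eq x u
    rw [metric_mfderiv_mk]
    exact real_inner_self_pos.2 fun h0 => hu (by rw [h0, map_zero])
  isVonNBounded y := by
    obtain ⟨x, rfl⟩ := mk_surjective y
    -- The unit ball of the quotient metric lies in the image, under the continuous linear map
    -- d(mk), of the bounded unit ball at x.
    have hb := (X.riemM.g.isVonNBounded x).image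
      (mfderiv 𝓘(ℝ, E) 𝓘(ℝ, E) (mk : X.M → A.OrbitSpace Γ h) x)
    refine hb.subset fun u hu => ?_
    obtain ⟨u, rfl⟩ := exists_mfderiv_mk_eq x u
    rw [Set.mem_ofPred_eq, metric_mfderiv_mk] at hu
    exact ⟨u, hu, rfl⟩
  contMDiff := contMDiff_metric

instance : RiemannianBundle (fun y : A.OrbitSpace Γ h => TangentSpace 𝓘(ℝ, E) y) :=
  ⟨(riemannianMetric A Γ h).toRiemannianMetric⟩

instance : IsContMDiffRiemannianBundle 𝓘(ℝ, E) ∞ E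
    (fun y : A.OrbitSpace Γ h => TangentSpace 𝓘(ℝ, E) y) :=
  inferInstance

lemma inner_mfderiv_mk (x : X.M) (u v : TangentSpace 𝓘(ℝ, E) x) :
    inner ℝ (mfderiv 𝓘(ℝ, E) 𝓘(ℝ, E) (mk : X.M → A.OrbitSpace Γ h) x u)
      (mfderiv 𝓘(ℝ, E) 𝓘(ℝ, E) (mk : X.M → A.OrbitSpace Γ h) x v) = inner ℝ u v :=
  metric_mfderiv_mk x u v

end OrbitSpace

end BundleAction

end QuotientMetric

/-! ### The quotient connection and the quotient bundle -/

section QuotientConnection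

variable {E : Type w} [NormedAddCommGroup E] [NormedSpace ℝ E]
  {X : LineBundleWithConnection.{u, v, w} E} {G : Type z} [Group G]

namespace BundleAction

namespace OrbitSpace

variable {A : BundleAction G X} {Γ : Subgroup G} {h : A.ActsFreely Γ}

lemma liftTotal_pullbackSection (t : Π y, A.Fiber Γ h y) (x : X.M) :
    liftTotal h ⟨x, pullbackSection (lift h) t x⟩ = ⟨mk x, t (mk x)⟩ :=
  congrArg (TotalSpace.mk' ℂ (mk x)) ((lift h x).apply_symm_apply _)

/-- The pull-back of a section of the quotient bundle is invariant. -/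
lemma pullbackSection_act (t : Π y, A.Fiber Γ h y) {γ : G} (hγ : γ ∈ Γ) (x : X.M) :
    pullbackSection (lift h) t (A.act γ x) = A.onFiber γ x (pullbackSection (lift h) t x) := by
  have h1 : liftTotal h (A.actTotal γ ⟨x, pullbackSection (lift h) t x⟩)
      = liftTotal h ⟨A.act γ x, pullbackSection (lift h) t (A.act γ x)⟩ := by
    rw [liftTotal_actTotal hγ, liftTotal_pullbackSection, liftTotal_pullbackSection, mk_act hγ]
  have h2 := eq_of_liftTotal_eq (actTotal_fst γ _) h1
  rw [A.actTotal_mk] at h2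
  exact (eq_of_heq (TotalSpace.mk.inj h2).2).symm

variable [Finite G]

lemma mdifferentiableAt_pullbackSection_lift {t : Π y, A.Fiber Γ h y} {x : X.M}
    (ht : MDifferentiableAt 𝓘(ℝ, E) (𝓘(ℝ, E).prod 𝓘(ℝ, ℂ))
      (fun y => TotalSpace.mk' ℂ y (t y)) (mk x)) :
    MDifferentiableAt 𝓘(ℝ, E) (𝓘(ℝ, E).prod 𝓘(ℝ, ℂ))
      (fun y => TotalSpace.mk' ℂ y (pullbackSection (lift h) t y)) x :=
  mdifferentiableAt_pullbackSection contMDiff_liftTotal ht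

lemma contMDiffAt_pullbackSection_lift_iff {t : Π y, A.Fiber Γ h y} {x : X.M} :
    ContMDiffAt 𝓘(ℝ, E) (𝓘(ℝ, E).prod 𝓘(ℝ, ℂ)) ∞
      (fun y => TotalSpace.mk' ℂ y (pullbackSection (lift h) t y)) x ↔
    ContMDiffAt 𝓘(ℝ, E) (𝓘(ℝ, E).prod 𝓘(ℝ, ℂ)) ∞ (fun y => TotalSpace.mk' ℂ y (t y)) (mk x) := by
  refine ⟨fun ht => contMDiffAt_of_comp_mk ?_,
    fun ht => contMDiffAt_pullbackSection contMDiff_liftTotal le_rfl ht⟩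
  refine (contMDiff_liftTotal.contMDiffAt.comp x ht).congr_of_eventuallyEq
    (Filter.Eventually.of_forall fun x' => ?_)
  exact (liftTotal_pullbackSection t x').symm

/-- The covariant derivative on the orbit space, as a function. -/
def connFun (t : Π y, A.Fiber Γ h y) (y : A.OrbitSpace Γ h) :
    TangentSpace 𝓘(ℝ, E) y →L[ℝ] A.Fiber Γ h y :=
  ((X.conn (pullbackSection (lift h) t) (out y)).comp (tangentOut y) : _)

/-- The quotient connection pulls back to the given connection. -/
lemma connFun_mfderiv_mk {t : Π y, A.Fiber Γ h y} {x : X.M}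
    (ht : MDifferentiableAt 𝓘(ℝ, E) (𝓘(ℝ, E).prod 𝓘(ℝ, ℂ))
      (fun y => TotalSpace.mk' ℂ y (pullbackSection (lift h) t y)) x)
    (u : TangentSpace 𝓘(ℝ, E) x) :
    connFun t (mk x) (mfderiv 𝓘(ℝ, E) 𝓘(ℝ, E) (mk : X.M → A.OrbitSpace Γ h) x u)
      = lift h x (X.conn (pullbackSection (lift h) t) x u) := by
  -- A pulled-back section is its own translate under Γ, so `preserves_conn` compares its derivative
  -- at x with that at the representative.
  have h1 := A.conn_tangentMap (toOut h x) (act_toOut h x)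
    (pullbackSection_act t (toOut_mem h x)) u ht
  rw [← tangentOut_mfderiv] at h1
  exact h1

variable (A Γ h) in
/-- The covariant derivative on the orbit space. -/
def conn : CovariantDerivative 𝓘(ℝ, E) ℂ (A.Fiber Γ h) where
  toFun := connFun
  isCovariantDerivativeOnUniv := {
    add := by
      intro s t y hs ht _
      obtain ⟨x, rfl⟩ := mk_surjective y
      ext u
      obtain ⟨u, rfl⟩ := exists_mfderiv_mk_eq x u
      have hs' := mdifferentiableAt_pullbackSection_lift hs
      have ht' := mdifferentiableAt_pullbackSection_lift ht
      have hst : pullbackSection (lift h) (s + t)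
          = pullbackSection (lift h) s + pullbackSection (lift h) t :=
        funext fun x => map_add (lift h x).symm _ _
      rw [connFun_mfderiv_mk, add_apply, connFun_mfderiv_mk hs', connFun_mfderiv_mk ht',
        hst, X.conn.isCovariantDerivativeOnUniv.add hs' ht', add_apply, map_add]
      rw [hst]
      exact mdifferentiableAt_add_section hs' ht'
    leibniz := by
      intro s g y hs hg _
      obtain ⟨x, rfl⟩ := mk_surjective y
      ext u
      obtain ⟨u, rfl⟩ := exists_mfderiv_mk_eq x u
      have hs' := mdifferentiableAt_pullbackSection_lift hs
      have hg' : MDifferentiableAt 𝓘(ℝ, E) 𝓘(ℝ, ℝ) (fun x' => g (mk x')) x :=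
        hg.comp x (contMDiff_mk.contMDiffAt.mdifferentiableAt (by simp))
      have hst : pullbackSection (lift h) (g • s)
          = (fun x => g (mk x)) • pullbackSection (lift h) s :=
        funext fun x => (lift h x).symm.toLinearMap.map_smul_of_tower (g (mk x)) (s (mk x))
      rw [connFun_mfderiv_mk, hst, X.conn.isCovariantDerivativeOnUniv.leibniz hs' hg']
      · simp only [add_apply, smul_apply, ContinuousLinearMap.smulRight_apply]
        rw [connFun_mfderiv_mk hs', map_add, mvfderiv_comp_mk]
        refine congrArg₂ (· + ·) ((lift h x).toLinearMap.map_smul_of_tower (g (mk x)) _)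
          (((lift h x).toLinearMap.map_smul_of_tower _ _).trans ?_)
        exact congrArg _ ((lift h x).apply_symm_apply _)
      · rw [hst]
        exact hg'.smul_section hs' }

lemma conn_mfderiv_mk {t : Π y, A.Fiber Γ h y} {x : X.M}
    (ht : MDifferentiableAt 𝓘(ℝ, E) (𝓘(ℝ, E).prod 𝓘(ℝ, ℂ))
      (fun y => TotalSpace.mk' ℂ y (pullbackSection (lift h) t y)) x)
    (u : TangentSpace 𝓘(ℝ, E) x) :
    conn A Γ h t (mk x) (mfderiv 𝓘(ℝ, E) 𝓘(ℝ, E) (mk : X.M → A.OrbitSpace Γ h) x u)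
      = lift h x (X.conn (pullbackSection (lift h) t) x u) :=
  connFun_mfderiv_mk ht u

lemma conn_complex (s : Π y, A.Fiber Γ h y) (c : ℂ) (y : A.OrbitSpace Γ h)
    (u : TangentSpace 𝓘(ℝ, E) y)
    (hs : MDifferentiableAt 𝓘(ℝ, E) (𝓘(ℝ, E).prod 𝓘(ℝ, ℂ))
      (fun y => TotalSpace.mk' ℂ y (s y)) y) :
    conn A Γ h (c • s) y u = c • conn A Γ h s y u := by
  obtain ⟨x, rfl⟩ := mk_surjective y
  obtain ⟨u, rfl⟩ := exists_mfderiv_mk_eq x u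
  have hs' := mdifferentiableAt_pullbackSection_lift hs
  have hst : pullbackSection (lift h) (c • s) = c • pullbackSection (lift h) s :=
    funext fun x => map_smul (lift h x).symm c _
  rw [conn_mfderiv_mk hs', conn_mfderiv_mk, hst, X.conn_complex _ _ _ _ hs', map_smul]
  rw [hst]
  exact mdifferentiableAt_smul (f := fun _ => c) mdifferentiableAt_const hs'

/-- Tested on a smooth field V, the derivative of s pulls back to the derivative on M of the
pulled-back section along the pulled-back field, and smoothness descends. -/
lemma contMDiffCovariantDerivative_conn [FiniteDimensional ℝ E] :
    CovariantDerivative.ContMDiffCovariantDerivative (conn A Γ h) ∞ := by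
  refine ⟨⟨fun {s} hs => ?_⟩⟩
  rw [contMDiffOn_univ] at hs ⊢
  have hs' : ContMDiff 𝓘(ℝ, E) (𝓘(ℝ, E).prod 𝓘(ℝ, ℂ)) (∞ + 1)
      (fun x => TotalSpace.mk' ℂ x (pullbackSection (lift h) s x)) :=
    fun x => contMDiffAt_pullbackSection contMDiff_liftTotal (by simp) (hs (mk x))
  have hc := X.conn_smooth.contMDiff.contMDiff hs'.contMDiffOn
  rw [contMDiffOn_univ] at hc
  intro y
  obtain ⟨x, rfl⟩ := mk_surjective y
  refine contMDiffAt_hom_of_apply fun V hV => ?_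
  rw [← contMDiffAt_pullbackSection_lift_iff]
  refine ((hc x).clm_bundle_apply (contMDiffAt_mpullback_mk hV)).congr_of_eventuallyEq
    (Filter.Eventually.of_forall fun x' => ?_)
  refine congrArg (TotalSpace.mk' ℂ x') ?_
  rw [pullbackSection, LinearEquiv.symm_apply_eq, ← mfderiv_mk_mpullback V]
  exact conn_mfderiv_mk (mdifferentiableAt_pullbackSection_lift
    ((hs (mk x')).mdifferentiableAt (by simp))) _

section Hermitian

variable (hA : A.PreservesHermitian Γ)

variable (h) in
/-- The isometric projection to the fibres of the quotient bundle. -/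
def liftIsometry (x : X.M) : X.L x ≃ₗᵢ[ℂ] A.Fiber Γ h (mk x) :=
  { lift h x with
    norm_map' := norm_fiberMap hA (toOut_mem h x) (act_toOut h x) }

include hA in
lemma inner_pullbackSection (s t : Π y, A.Fiber Γ h y) (x : X.M) :
    inner ℂ (pullbackSection (lift h) s x) (pullbackSection (lift h) t x)
      = inner ℂ (s (mk x)) (t (mk x)) :=
  (liftIsometry h hA x).symm.inner_map_map _ _

include hA in
lemma hermitian_smooth (s t : Π y, A.Fiber Γ h y) (y : A.OrbitSpace Γ h)
    (hs : ContMDiffAt 𝓘(ℝ, E) (𝓘(ℝ, E).prod 𝓘(ℝ, ℂ)) ∞ (fun y => TotalSpace.mk' ℂ y (s y)) y)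
    (ht : ContMDiffAt 𝓘(ℝ, E) (𝓘(ℝ, E).prod 𝓘(ℝ, ℂ)) ∞ (fun y => TotalSpace.mk' ℂ y (t y)) y) :
    ContMDiffAt 𝓘(ℝ, E) 𝓘(ℝ, ℂ) ∞ (fun y => inner ℂ (s y) (t y)) y := by
  obtain ⟨x, rfl⟩ := mk_surjective y
  refine contMDiffAt_of_comp_mk ?_
  simp only [← inner_pullbackSection hA]
  exact X.hermitian_smooth _ _ x (contMDiffAt_pullbackSection_lift_iff.2 hs)
    (contMDiffAt_pullbackSection_lift_iff.2 ht)

include hA in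
lemma conn_hermitian (s t : Π y, A.Fiber Γ h y) (y : A.OrbitSpace Γ h)
    (u : TangentSpace 𝓘(ℝ, E) y)
    (hs : MDifferentiableAt 𝓘(ℝ, E) (𝓘(ℝ, E).prod 𝓘(ℝ, ℂ))
      (fun y => TotalSpace.mk' ℂ y (s y)) y)
    (ht : MDifferentiableAt 𝓘(ℝ, E) (𝓘(ℝ, E).prod 𝓘(ℝ, ℂ))
      (fun y => TotalSpace.mk' ℂ y (t y)) y) :
    mvfderiv 𝓘(ℝ, E) (fun y => inner ℂ (s y) (t y)) y u
      = inner ℂ (conn A Γ h s y u) (t y) + inner ℂ (s y) (conn A Γ h t y u) := by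
  obtain ⟨x, rfl⟩ := mk_surjective y
  obtain ⟨u, rfl⟩ := exists_mfderiv_mk_eq x u
  have hs' := mdifferentiableAt_pullbackSection_lift hs
  have ht' := mdifferentiableAt_pullbackSection_lift ht
  have hc := X.conn_hermitian _ _ x u hs' ht'
  simp only [inner_pullbackSection hA] at hc
  rw [mvfderiv_comp_mk (fun y => inner ℂ (s y) (t y))] at hc
  rw [hc, conn_mfderiv_mk hs', conn_mfderiv_mk ht',
    ← (liftIsometry h hA x).inner_map_map, ← (liftIsometry h hA x).inner_map_map]
  congr 2
  · exact (lift h x).apply_symm_apply _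
  · exact (lift h x).apply_symm_apply _

variable (h) [FiniteDimensional ℝ E]

/-- The quotient of a line bundle with connection by a group of bundle automorphisms that acts
freely on the base and preserves the metrics and the connection. -/
def quotient : LineBundleWithConnection.{u, v, w} E where
  M := A.OrbitSpace Γ h
  L := A.Fiber Γ h
  hermitian_smooth := hermitian_smooth hA
  conn := conn A Γ h
  conn_smooth := contMDiffCovariantDerivative_conn
  conn_complex := conn_complex
  conn_hermitian := conn_hermitian hA

/-- The projection to the quotient. -/
def quotientMap : QuotientMap A Γ (quotient h hA) where
  proj := mk
  onFiber := liftIsometry h hA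
  proj_surjective := mk_surjective
  proj_eq_iff _ _ := mk_eq_iff
  total_eq_iff _ _ := liftTotal_eq_iff
  proj_localDiffeo := isLocalDiffeomorph_mk
  total_smooth := contMDiff_liftTotal
  isometry := inner_mfderiv_mk
  conn_eq s t hst x u hs := by
    -- The fibre maps are bijective, so s is determined by t.
    have hst' : s = pullbackSection (lift h) t :=
      funext fun x => ((lift h x).symm_apply_eq.2 (hst x)).symm
    subst hst'
    exact conn_mfderiv_mk hs u

end Hermitian

end OrbitSpace

end BundleAction

end QuotientConnection

end SunadaLine

end

theorem proposition3p2 {E : Type w} [NormedAddCommGroup E] [NormedSpace ℝ E]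
    [FiniteDimensional ℝ E] (X : SunadaLine.LineBundleWithConnection.{u, v, w} E)
    {G : Type z} [Group G] [Finite G] (A : SunadaLine.BundleAction G X) (Γ₁ Γ₂ : Subgroup G)
    (hfree₁ : A.ActsFreely Γ₁) (hfree₂ : A.ActsFreely Γ₂)
    (hΓ : SunadaLine.AlmostConjugate Γ₁ Γ₂) :
    -- the quotients exist as Hermitian line bundles with connection
    (A.PreservesHermitian Γ₁ → ∃ Y₁ : SunadaLine.LineBundleWithConnection.{u, v, w} E,
      Nonempty (SunadaLine.QuotientMap A Γ₁ Y₁)) ∧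
    (A.PreservesHermitian Γ₂ → ∃ Y₂ : SunadaLine.LineBundleWithConnection.{u, v, w} E,
      Nonempty (SunadaLine.QuotientMap A Γ₂ Y₂)) ∧
    -- and they are isospectral
    (∀ (Y₁ Y₂ : SunadaLine.LineBundleWithConnection.{u, v, w} E)
        (q₁ : SunadaLine.QuotientMap A Γ₁ Y₁) (q₂ : SunadaLine.QuotientMap A Γ₂ Y₂),
      (∀ k : ℕ, 0 < k → Y₁.spec k = Y₂.spec k) ∧
      (∀ Q : X.M → ℝ, ContMDiff 𝓘(ℝ, E) 𝓘(ℝ, ℝ) ∞ Q →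
        (∀ (g : G) (x : X.M), Q (A.act g x) = Q x) →
        ∀ k : ℕ, 0 < k →
          Y₁.specPotential (q₁.induced Q) k = Y₂.specPotential (q₂.induced Q) k)) := by
  refine ⟨fun hA => ⟨_, ⟨SunadaLine.BundleAction.OrbitSpace.quotientMap hfree₁ hA⟩⟩,
    fun hA => ⟨_, ⟨SunadaLine.BundleAction.OrbitSpace.quotientMap hfree₂ hA⟩⟩,
    fun Y₁ Y₂ q₁ q₂ => ⟨fun k _ => hΓ.spec_eq q₁ q₂ k,
      fun Q _ hQ k _ => SunadaLine.AlmostConjugate.specPotential_eq q₁ q₂ hΓ hQ k⟩⟩
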